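/- **LDP in CNNs.** Fix integers $L\ge 1$ (number of hidden layers), $P$ (number of inputs), $C_0$, spatial dimensions $N_0,\dots,N_{L+1}$, and finite mask index sets $\mathcal M_\ell$ with $M_\ell=|\mathcal M_\ell|$, $\ell=0,\dots,L$. Let $\lambda_0,\dots,\lambda_L>0$, let $\sigma:\mathbb R\to\mathbb R$ be an activation function, let $R^{(i,\ell)}=(R^{(i,\ell)}_m)_{m\in\mathcal M_\ell}:\mathbb R^{N_\ell}\to\mathbb R^{M_\ell}$ ($i=1,\dots,N_{\ell+1}$, $\ell=0,\dots,L$) be patch extractors, and fix inputs $\mathbf x_\mu=[x_{\mu,c,i}]\in\mathbb R^{C_0\times N_0}$, $\mu=1,\dots,P$. For each $n\ge1$ let $C_1(n),\dots,C_{L+1}(n)$ be channel counts, $C_0(n):=C_0$, and define, for $c=1,\dots,C_{\ell+1}(n)$ and $i=1,\dots,N_{\ell+1}$, $$h^{(1)}_{c,i}(\mathbf x_\mu)=\frac1{\sqrt{M_0C_0}}\sum_{c'=1}^{C_0}\sum_{m\in\mathcal M_0}W^{(0)}_{m,c',c}R^{(i,0)}_m(x_{\mu,c',:}),$$ $$h^{(\ell+1)}_{c,i}(\mathbf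 x_\mu)=\frac1{\sqrt{M_\ell C_\ell(n)}}\sum_{c'=1}^{C_\ell(n)}\sum_{m\in\mathcal M_\ell}W^{(\ell)}_{m,c',c}\,\sigma\big(R^{(i,\ell)}_m(h^{(\ell)}_{c',:}(\mathbf x_\mu))\big),\qquad \ell=1,\dots,L.$$ Assume: 1. (Gaussian prior) for each $n$ the weights $W^{(\ell)}_{m,c',c}$, $\ell=0,\dots,L$, $m\in\mathcal M_\ell$, $c'\le C_\ell(n)$, $c\le C_{\ell+1}(n)$, are independent random variables with $W^{(\ell)}_{m,c',c}\sim\mathcal N(0,\lambda_\ell^{-1})$; 2. (infinite channels limit) $C_\ell(n)/n\to\alpha_\ell\in(0,+\infty)$ as $n\to\infty$, for $\ell=1,\dots,L$; 3. (asymptotic Lipschitz condition) $\sigma$ is continuous and $|\sigma(x)-\sigma(y)|\le L_\sigma|x-y|+\rho_\sigma(x)+\rho_\sigma(y)$ for all $x,y\in\mathbb R$, for some constant $L_\sigma\ge0$ and some locally bounded $\rho_\sigma$ with $\rho_\sigma(x)=o(|x|)$ as $|x|\to\infty$; for $\ell=1,\dots,L$ and $i=1,\dots,N_{\ell+1}$,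 $R^{(i,\ell)}$ is continuous and $\|R^{(i,\ell)}(z)-R^{(i,\ell)}(z')\|\le L_R\|z-z'\|+\rho_R(z)+\rho_R(z')$ for all $z,z'\in\mathbb R^{N_\ell}$, for some constant $L_R\ge0$ and some function $\rho_R$ with $\rho_R(z)=o(\|z\|)$ as $\|z\|\to\infty$. Let $D_\ell=N_\ell P$, let $\mathcal S_D$ be the set of symmetric real $D\times D$ matrices and $\mathcal S^+_D\subset\mathcal S_D$ the cone of positive semidefinite ones. For $z\in\mathbb R^{N_\ell\times P}\cong\mathbb R^{D_\ell}$ let $G^{(\ell)}(z)\in\mathcal S^+_{D_{\ell+1}}$ be the matrix with entries $$[G^{(\ell)}(z)]_{i,\mu;j,\nu}=\frac1{\lambda_\ell M_\ell}\sum_{m\in\mathcal M_\ell}\sigma\big(R^{(i,\ell)}_m(z_{:,\mu})\big)\,\sigma\big(R^{(j,\ell)}_m(z_{:,\nu})\big),$$ and define the (conditional) covariance matrices $$\mathbf K^{(1)}_{i,\mu;j,\nu}=\frac1{\lambda_0C_0M_0}\sum_{c=1}^{C_0}\sum_{m\in\mathcal M_0}R^{(i,0)}_m(x_{\mu,c,:})R^{(j,0)}_m(x_{\nu,c,:}),\qquad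 \mathbf K^{(\ell+1,n)}=\frac1{C_\ell(n)}\sum_{c=1}^{C_\ell(n)}G^{(\ell)}\big([h^{(\ell)}_{c,i}(\mathbf x_\mu)]_{i,\mu}\big),\quad \ell=1,\dots,L.$$ For $Q_1\in\mathcal S^+_{D_\ell}$ and $Q_2\in\mathcal S^+_{D_{\ell+1}}$ set $$I_\ell(Q_2|Q_1)=\sup_{Q_0\in\mathcal S_{D_{\ell+1}}}\Big\{\operatorname{tr}(Q_0^\top Q_2)-\log\int_{\mathbb R^{D_\ell}}e^{\operatorname{tr}(Q_0^\top G^{(\ell)}(z))}\,\mathcal N(dz\mid\mathbf 0,Q_1)\Big\}.$$ Then the laws of the random tuples $(\mathbf K^{(2,n)},\dots,\mathbf K^{(L+1,n)})$ satisfy, as $n\to\infty$, a large deviation principle on $\mathcal S^+_{D_2}\times\dots\times\mathcal S^+_{D_{L+1}}$ with speed $n$ and rate function $$I_{2,\dots,L+1}(Q_2,\dots,Q_{L+1})=\alpha_1I_1(Q_2|\mathbf K^{(1)})+\sum_{\ell=2}^L\alpha_\ell I_\ell(Q_{\ell+1}|Q_\ell),$$ and this rate function is good. That is, $I:=I_{2,\dots,L+1}$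 takes values in $(-\infty,+\infty]$, is lower semicontinuous and has compact sublevel sets, and the laws $\mu_n$ satisfy $\liminf_n\frac1n\log\mu_n(O)\ge-\inf_OI$ for every open $O$ and $\limsup_n\frac1n\log\mu_n(F)\le-\inf_FI$ for every closed $F$. -/

import Mathlib

open MeasureTheory ProbabilityTheory Filter Topology
open scoped NNReal ENNReal

noncomputable section

/-- The cone of symmetric positive semidefinite real matrices indexed by `ι`, with the topology
inherited from the space of matrices and the Borel `σ`-algebra. -/
abbrev PSDCone (ι : Type) [Fintype ι] : Type := {Q : Matrix ι ι ℝ // Q.PosSemidef}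

instance PSDCone.instMeasurableSpace (ι : Type) [Fintype ι] : MeasurableSpace (PSDCone ι) :=
  borel _

instance PSDCone.instBorelSpace (ι : Type) [Fintype ι] : BorelSpace (PSDCone ι) := ⟨rfl⟩

instance PSDCone.instSecondCountable (ι : Type) [Fintype ι] :
    SecondCountableTopology (PSDCone ι) :=
  haveI : SecondCountableTopology (Matrix ι ι ℝ) :=
    inferInstanceAs (SecondCountableTopology (ι → ι → ℝ))
  inferInstanceAs (SecondCountableTopology ({Q | Q.PosSemidef} : Set (Matrix ι ι ℝ)))

/-! ### Large deviation principles with speed `n` -/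

/-- `I` takes values in `(-∞, +∞]`, is lower semicontinuous, and has compact sublevel sets. -/
def IsGoodRateFunction {X : Type*} [TopologicalSpace X] (I : X → EReal) : Prop :=
  (∀ x, I x ≠ ⊥) ∧ LowerSemicontinuous I ∧ ∀ a : ℝ, IsCompact {x | I x ≤ (a : EReal)}

/-- The measures `μ n` satisfy the large deviation bounds with speed `n` and rate function `I`. -/
def SatisfiesLDP {X : Type*} [TopologicalSpace X] [MeasurableSpace X] [BorelSpace X]
    (μ : ℕ → Measure X) (I : X → EReal) : Prop :=
  (∀ O : Set X, IsOpen O →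
    -(⨅ x ∈ O, I x) ≤ liminf (fun n : ℕ => ENNReal.log (μ n O) / (n : EReal)) atTop) ∧
  (∀ F : Set X, IsClosed F →
    limsup (fun n : ℕ => ENNReal.log (μ n F) / (n : EReal)) atTop ≤ -(⨅ x ∈ F, I x))

/-! ### Asymptotic Lipschitz conditions -/

/-- The activation function is continuous and asymptotically Lipschitz. -/
def AsympLipschitzActivation (σ : ℝ → ℝ) : Prop :=
  Continuous σ ∧ ∃ (Lσ : ℝ) (ρ : ℝ → ℝ), 0 ≤ Lσ ∧
    (∀ r : ℝ, ∃ B : ℝ, ∀ x : ℝ, |x| ≤ r → |ρ x| ≤ B) ∧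
    ρ =o[Bornology.cobounded ℝ] (fun x : ℝ => |x|) ∧
    ∀ x y : ℝ, |σ x - σ y| ≤ Lσ * |x - y| + ρ x + ρ y

/-- A map between finite-dimensional Euclidean spaces is continuous and asymptotically Lipschitz
(with respect to the Euclidean norms). -/
def AsympLipschitzMap {ι κ : Type} [Fintype ι] [Fintype κ] (f : (ι → ℝ) → (κ → ℝ)) : Prop :=
  Continuous f ∧ ∃ (LR : ℝ) (ρ : (ι → ℝ) → ℝ), 0 ≤ LR ∧
    ρ =o[Bornology.cobounded (ι → ℝ)] (fun z : ι → ℝ => ‖WithLp.toLp 2 z‖) ∧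
    ∀ z z' : ι → ℝ, ‖WithLp.toLp 2 (f z - f z')‖ ≤ LR * ‖WithLp.toLp 2 (z - z')‖ + ρ z + ρ z'

/-! ### Convolutional networks -/

/-- The fixed (non-random, independent of the scaling parameter) data of a convolutional network.
Layers are numbered by natural numbers; only the layers `0, …, L + 1` play a role. -/
structure ConvNet where
  /-- number of hidden layers -/
  L : ℕ
  /-- number of inputs -/
  P : ℕ
  /-- number of input channels -/
  C₀ : ℕ
  /-- spatial dimensions -/
  N : ℕ → ℕ
  /-- index sets of the masks -/
  Mask : ℕ → Type
  /-- the masks are finite -/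
  maskFintype : ∀ ℓ, Fintype (Mask ℓ)
  /-- activation function -/
  σ : ℝ → ℝ
  /-- patch extractors: `R ℓ i z m` is the component `m` of the receptive field, extracted from the
  spatial vector `z` of layer `ℓ`, of the neuron at position `i` of layer `ℓ + 1` -/
  R : (ℓ : ℕ) → Fin (N (ℓ + 1)) → (Fin (N ℓ) → ℝ) → (Mask ℓ → ℝ)
  /-- precisions of the weights -/
  prec : ℕ → ℝ≥0
  /-- the inputs: `x μ c i` -/
  x : Fin P → Fin C₀ → Fin (N 0) → ℝ

namespace ConvNet

attribute [instance] ConvNet.maskFintype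

variable (A : ConvNet)

/-- The index set of pairs (spatial position at layer `ℓ`, input); it has `N ℓ * P` elements. -/
abbrev Idx (ℓ : ℕ) : Type := Fin (A.N ℓ) × Fin A.P

/-- Number of channels of each layer, the layers `ℓ ≥ 1` having `C ℓ` channels. -/
def chan (C : ℕ → ℕ) : ℕ → ℕ
  | 0 => A.C₀
  | ℓ + 1 => C (ℓ + 1)

/-- Values of all the weights: `w ℓ m c' c` is the weight `W^{(ℓ)}_{m,c',c}`. -/
abbrev Weights (C : ℕ → ℕ) : Type :=
  (ℓ : ℕ) → A.Mask ℓ → Fin (A.chan C ℓ) → Fin (A.chan C (ℓ + 1)) → ℝ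

/-- Pre-activations: `A.preact C w ℓ c (i, μ)` is `h^{(ℓ+1)}_{c,i}(x_μ)`. -/
def preact (C : ℕ → ℕ) (w : A.Weights C) :
    (ℓ : ℕ) → Fin (A.chan C (ℓ + 1)) → A.Idx (ℓ + 1) → ℝ
  | 0, c, p =>
      1 / √((Fintype.card (A.Mask 0) : ℝ) * (A.chan C 0 : ℝ)) *
        ∑ c' : Fin (A.chan C 0), ∑ m : A.Mask 0, w 0 m c' c * A.R 0 p.1 (A.x p.2 c') m
  | ℓ + 1, c, p =>
      1 / √((Fintype.card (A.Mask (ℓ + 1)) : ℝ) * (A.chan C (ℓ + 1) : ℝ)) *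
        ∑ c' : Fin (A.chan C (ℓ + 1)), ∑ m : A.Mask (ℓ + 1),
          w (ℓ + 1) m c' c * A.σ (A.R (ℓ + 1) p.1 (fun i => preact C w ℓ c' (i, p.2)) m)

/-- The matrix-valued function `G^{(ℓ)}`. -/
def G (ℓ : ℕ) (z : A.Idx ℓ → ℝ) : Matrix (A.Idx (ℓ + 1)) (A.Idx (ℓ + 1)) ℝ :=
  Matrix.of fun p q =>
    1 / ((A.prec ℓ : ℝ) * (Fintype.card (A.Mask ℓ) : ℝ)) *
      ∑ m : A.Mask ℓ, A.σ (A.R ℓ p.1 (fun i => z (i, p.2)) m) *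
        A.σ (A.R ℓ q.1 (fun i => z (i, q.2)) m)

/-- The deterministic covariance matrix `K^{(1)}` of the first layer. -/
def K1Mat : Matrix (A.Idx 1) (A.Idx 1) ℝ :=
  Matrix.of fun p q =>
    1 / ((A.prec 0 : ℝ) * (A.C₀ : ℝ) * (Fintype.card (A.Mask 0) : ℝ)) *
      ∑ c : Fin A.C₀, ∑ m : A.Mask 0, A.R 0 p.1 (A.x p.2 c) m * A.R 0 q.1 (A.x q.2 c) m

/-- `A.KMat C w ℓ` is the conditional covariance matrix `K^{(ℓ+2)}`, the average of
`G^{(ℓ+1)}(H^{(ℓ+1)}_{c,:,:})` over the channels `c` of layer `ℓ + 1`. -/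
def KMat (C : ℕ → ℕ) (w : A.Weights C) (ℓ : ℕ) : Matrix (A.Idx (ℓ + 2)) (A.Idx (ℓ + 2)) ℝ :=
  (1 / (A.chan C (ℓ + 1) : ℝ)) • ∑ c : Fin (A.chan C (ℓ + 1)), A.G (ℓ + 1) (A.preact C w ℓ c)

theorem posSemidef_gram {ι κ : Type} [Fintype ι] [Fintype κ] (a : ℝ) (ha : 0 ≤ a)
    (u : κ → ι → ℝ) :
    (Matrix.of fun p q => a * ∑ k, u k p * u k q : Matrix ι ι ℝ).PosSemidef := by
  have h : (Matrix.of fun p q => a * ∑ k, u k p * u k q : Matrix ι ι ℝ) =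
      a • ∑ k, Matrix.vecMulVec (u k) (star (u k)) := by
    ext p q
    simp [Matrix.sum_apply, Matrix.vecMulVec_apply]
  rw [h]
  exact (Matrix.posSemidef_sum _ fun k _ => Matrix.posSemidef_vecMulVec_self_star (u k)).smul ha

theorem G_posSemidef (ℓ : ℕ) (z : A.Idx ℓ → ℝ) : (A.G ℓ z).PosSemidef :=
  posSemidef_gram _ (by positivity)
    (fun (m : A.Mask ℓ) (p : A.Idx (ℓ + 1)) => A.σ (A.R ℓ p.1 (fun i => z (i, p.2)) m))

theorem K1Mat_posSemidef : A.K1Mat.PosSemidef := by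
  have h := posSemidef_gram (1 / ((A.prec 0 : ℝ) * (A.C₀ : ℝ) * (Fintype.card (A.Mask 0) : ℝ)))
    (by positivity)
    (fun (k : Fin A.C₀ × A.Mask 0) (p : A.Idx 1) => A.R 0 p.1 (A.x p.2 k.1) k.2)
  simpa only [K1Mat, Fintype.sum_prod_type] using h

theorem KMat_posSemidef (C : ℕ → ℕ) (w : A.Weights C) (ℓ : ℕ) : (A.KMat C w ℓ).PosSemidef :=
  (Matrix.posSemidef_sum _ fun _ _ => A.G_posSemidef _ _).smul (by positivity)

/-- `K^{(1)}` as a point of the cone. -/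
def K1 : PSDCone (A.Idx 1) := ⟨A.K1Mat, A.K1Mat_posSemidef⟩

/-- The space of tuples `(Q_2, …, Q_{L+1})`, the component `k` being `Q_{k+2}`. -/
abbrev CovTuple : Type := (k : Fin A.L) → PSDCone (A.Idx (k + 2))

/-- The tuple `(K^{(2)}, …, K^{(L+1)})` of conditional covariance matrices. -/
def covTuple (C : ℕ → ℕ) (w : A.Weights C) : A.CovTuple :=
  fun k => ⟨A.KMat C w k, A.KMat_posSemidef C w k⟩

/-- The conditional rate `I_ℓ(Q₂ | Q₁)`: the Legendre transform, over symmetric matrices, of the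
log-moment generating function (with values in `(-∞, +∞]`) of `G^{(ℓ)}` under `N(0, Q₁)`. -/
def condRate (ℓ : ℕ) (Q₂ : PSDCone (A.Idx (ℓ + 1))) (Q₁ : PSDCone (A.Idx ℓ)) : EReal :=
  ⨆ (Q₀ : Matrix (A.Idx (ℓ + 1)) (A.Idx (ℓ + 1)) ℝ) (_ : Q₀.IsSymm),
    (((Q₀.transpose * Q₂.1).trace : ℝ) : EReal) -
      ENNReal.log (∫⁻ z : EuclideanSpace ℝ (A.Idx ℓ),
        ENNReal.ofReal (Real.exp ((Q₀.transpose * A.G ℓ z.ofLp).trace))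
          ∂(multivariateGaussian 0 Q₁.1))

/-- For a tuple `(Q_2, …, Q_{L+1})` and `k ≤ L`, the matrix `Q_{k+1}`, where `Q_1 := K^{(1)}`. -/
def entry (Q : A.CovTuple) : (k : ℕ) → k ≤ A.L → PSDCone (A.Idx (k + 1))
  | 0, _ => A.K1
  | k + 1, h => Q ⟨k, h⟩

/-- The joint rate function
`α_1 I_1(Q_2 | K^{(1)}) + ∑_{ℓ=2}^{L} α_ℓ I_ℓ(Q_{ℓ+1} | Q_ℓ)`;
the summand with index `k` is the one with `ℓ = k + 1`. -/
def rate (α : ℕ → ℝ) (Q : A.CovTuple) : EReal :=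
  ∑ k : Fin A.L,
    (α (k + 1) : EReal) * A.condRate (k + 1) (Q k) (A.entry Q k k.2.le)

/-- The index set of the weights of the layers `0, …, L`. -/
abbrev WeightIdx (C : ℕ → ℕ) : Type :=
  (ℓ : Fin (A.L + 1)) × (A.Mask ℓ × Fin (A.chan C ℓ) × Fin (A.chan C (ℓ + 1)))

end ConvNet

end

/-!
Given the first `ℓ` layers, the channels of layer `ℓ` are i.i.d. Gaussian vectors with covariance
`K^{(ℓ)}`, so `K^{(ℓ+1)}` is an empirical mean of `α_ℓ n` i.i.d. copies of `G^{(ℓ)}(z)` with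
`z ∼ N(0, K^{(ℓ)})`. Cramér's theorem gives both bounds for this mean with speed `α_ℓ n` and rate
`I_ℓ(· | K^{(ℓ)})`. The bounds hold uniformly for covariances near a given `K^{(ℓ)}`, because the
growth of `G^{(ℓ)}` is at most quadratic: after shrinking the dual variable by a factor `s < 1` the
exponential moments are continuous in the covariance. Weights of different layers being
independent, the estimates for single layers multiply; their product, over neighbourhoods of the
points of a tuple, has the sum of the rates as its exponent. A bound on the traces, layer after
layer, makes the laws exponentially tight, which passes from compact to closed sets and makes the
rate function good.
-/

noncomputable section

section ProductMeasure

variable {ι Z : Type*} [Fintype ι] [MeasurableSpace Z]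

theorem pi_sum_ge_le_exp (γ : Measure Z) [IsProbabilityMeasure γ] {f : Z → ℝ} (hf : Measurable f)
    {a c : ℝ} (h : ∫⁻ x, ENNReal.ofReal (Real.exp (f x)) ∂γ ≤ ENNReal.ofReal (Real.exp c)) :
    (Measure.pi fun _ : ι => γ) {z | Fintype.card ι * a ≤ ∑ i, f (z i)} ≤
      ENNReal.ofReal (Real.exp (-(Fintype.card ι * (a - c)))) := by
  have hint : Integrable (fun x => Real.exp (f x)) γ :=
    (lintegral_ofReal_ne_top_iff_integrable (by fun_prop)
      (ae_of_all _ fun _ => (Real.exp_pos _).le)).1 (ne_top_of_le_ne_top ENNReal.ofReal_ne_top h)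
  have hle : ∫ x, Real.exp (f x) ∂γ ≤ Real.exp c := by
    rwa [← ofReal_integral_eq_lintegral_ofReal hint (ae_of_all _ fun _ => (Real.exp_pos _).le),
      ENNReal.ofReal_le_ofReal_iff (Real.exp_pos _).le] at h
  have hsum : ∀ z : ι → Z, Real.exp (1 * ∑ i, f (z i)) = ∏ i, Real.exp (f (z i)) := fun z => by
    rw [one_mul, Real.exp_sum]
  have hmgf : mgf (fun z => ∑ i, f (z i)) (Measure.pi fun _ : ι => γ) 1 =
      (∫ x, Real.exp (f x) ∂γ) ^ Fintype.card ι := by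
    simp_rw [mgf, hsum]
    exact integral_fintype_prod_eq_pow (fun x => Real.exp (f x))
  have hchernoff := measure_ge_le_exp_mul_mgf (μ := Measure.pi fun _ : ι => γ)
    (X := fun z => ∑ i, f (z i)) (t := 1) (Fintype.card ι * a) zero_le_one
    (by simp_rw [hsum]; exact Integrable.fintype_prod fun _ => hint)
  rw [← ofReal_measureReal]
  refine ENNReal.ofReal_le_ofReal (hchernoff.trans ?_)
  calc Real.exp (-1 * (Fintype.card ι * a)) * mgf _ _ 1
      ≤ Real.exp (-1 * (Fintype.card ι * a)) * Real.exp c ^ Fintype.card ι := by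
        rw [hmgf]
        gcongr
    _ = Real.exp (-(Fintype.card ι * (a - c))) := by
        rw [← Real.exp_nat_mul, ← Real.exp_add]
        ring_nf

theorem pi_tilted (ν : ι → Measure Z) [∀ i, SigmaFinite (ν i)] (f : ι → Z → ℝ) :
    Measure.pi (fun i => (ν i).tilted (f i)) =
      (Measure.pi ν).tilted fun z => ∑ i, f i (z i) := by
  refine Measure.pi_eq fun s hs => ?_
  have hZ : ∫ z, Real.exp (∑ i, f i (z i)) ∂Measure.pi ν = ∏ i, ∫ x, Real.exp (f i x) ∂ν i := by
    simp_rw [Real.exp_sum]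
    exact integral_fintype_prod_eq_prod (fun i x => Real.exp (f i x))
  rw [tilted_apply_eq_ofReal_integral' _ (MeasurableSet.univ_pi hs)]
  simp_rw [tilted_apply_eq_ofReal_integral' _ (hs _), hZ, Real.exp_sum, ← Finset.prod_div_distrib]
  rw [Measure.restrict_pi_pi,
    integral_fintype_prod_eq_prod (fun i x => Real.exp (f i x) / ∫ x, Real.exp (f i x) ∂ν i),
    ENNReal.ofReal_prod_of_nonneg fun i _ => integral_nonneg fun x => by positivity]

theorem measureReal_tilted_mul_integral_exp_le {X : Type*} [MeasurableSpace X] (μ : Measure X)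
    [IsFiniteMeasure μ] (f : X → ℝ) {s : Set X} (hs : MeasurableSet s) {c : ℝ}
    (hc : ∀ x ∈ s, f x ≤ c) :
    (μ.tilted f).real s * ∫ x, Real.exp (f x) ∂μ ≤ Real.exp c * μ.real s := by
  rw [Measure.real, tilted_apply_eq_ofReal_integral' f hs,
    ENNReal.toReal_ofReal (integral_nonneg fun x => by positivity), integral_div]
  calc (∫ x in s, Real.exp (f x) ∂μ) / (∫ x, Real.exp (f x) ∂μ) * ∫ x, Real.exp (f x) ∂μ
      ≤ ∫ x in s, Real.exp (f x) ∂μ := by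
        rcases eq_or_ne (∫ x, Real.exp (f x) ∂μ) 0 with hZ | hZ
        · rw [hZ, mul_zero]
          positivity
        · rw [div_mul_cancel₀ _ hZ]
    _ ≤ ∫ _ in s, Real.exp c ∂μ :=
        integral_mono_of_nonneg (ae_of_all _ fun x => (Real.exp_pos _).le) (integrable_const _)
          ((ae_restrict_mem hs).mono fun x hx => Real.exp_le_exp.2 (hc x hx))
    _ = Real.exp c * μ.real s := by simp [mul_comm]

theorem pi_restrict_le (γ : Measure Z) [SigmaFinite γ] (s : Set Z) :
    Measure.pi (fun _ : ι => γ.restrict s) ≤ Measure.pi fun _ : ι => γ := by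
  rw [← Measure.restrict_pi_pi]
  exact Measure.restrict_le_self

theorem measurePreserving_fin_append (γ : Measure Z) [SigmaFinite γ] (N M : ℕ) :
    MeasurePreserving (fun p : (Fin N → Z) × (Fin M → Z) => Fin.append p.1 p.2)
      ((Measure.pi fun _ => γ).prod (Measure.pi fun _ => γ)) (Measure.pi fun _ => γ) := by
  have hmeas : Measurable fun p : (Fin N → Z) × (Fin M → Z) => Fin.append p.1 p.2 := by
    refine measurable_pi_lambda _ fun i => ?_
    induction i using Fin.addCases <;> simp only [Fin.append_left, Fin.append_right] <;> fun_prop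
  refine ⟨hmeas, (Measure.pi_eq fun s hs => ?_).symm⟩
  have hbox : (fun p : (Fin N → Z) × (Fin M → Z) => Fin.append p.1 p.2) ⁻¹' Set.univ.pi s =
      (Set.univ.pi fun i => s (Fin.castAdd M i)) ×ˢ Set.univ.pi fun i => s (Fin.natAdd N i) := by
    ext p
    simp [Set.mem_pi, Fin.forall_fin_add]
  rw [Measure.map_apply hmeas (MeasurableSet.univ_pi hs), hbox, Measure.prod_prod, Measure.pi_pi,
    Measure.pi_pi, Fin.prod_univ_add]

theorem measurePreserving_infinitePi_pi (γ : Measure Z) [IsProbabilityMeasure γ] (N : ℕ) :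
    MeasurePreserving (fun (ω : ℕ → Z) (i : Fin N) => ω i) (Measure.infinitePi fun _ => γ)
      (Measure.pi fun _ => γ) := by
  refine ⟨by fun_prop, ?_⟩
  have hindep : iIndepFun (fun (i : Fin N) (ω : ℕ → Z) => ω i) (Measure.infinitePi fun _ => γ) :=
    (iIndepFun_infinitePi (X := fun _ => id) fun _ => measurable_id).precomp Fin.val_injective
  rw [(iIndepFun_iff_map_fun_eq_pi_map fun i => (measurable_pi_apply _).aemeasurable).1 hindep]
  simp_rw [Measure.infinitePi_map_eval (fun _ : ℕ => γ)]

end ProductMeasure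

theorem eventually_lt_measureReal_of_ae_tendsto {X E T : Type*} [MeasurableSpace X]
    (μ : Measure X) [IsFiniteMeasure μ] [TopologicalSpace E] [MeasurableSpace E]
    [OpensMeasurableSpace E] {l : Filter T} [l.IsCountablyGenerated] {f : T → X → E} {f₀ : X → E}
    (hf : ∀ t, Measurable (f t)) (hf₀ : Measurable f₀)
    (hlim : ∀ᵐ x ∂μ, Tendsto (fun t => f t x) l (𝓝 (f₀ x))) {O : Set E} (hO : IsOpen O) {c : ℝ}
    (hc : c < μ.real (f₀ ⁻¹' O)) : ∀ᶠ t in l, c < μ.real (f t ⁻¹' O) := by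
  have hinter : Tendsto (fun t => μ (f t ⁻¹' O ∩ f₀ ⁻¹' O)) l (𝓝 (μ (f₀ ⁻¹' O))) := by
    refine tendsto_measure_of_ae_tendsto_indicator l (hf₀ hO.measurableSet)
      (fun t => (hf t hO.measurableSet).inter (hf₀ hO.measurableSet)) MeasurableSet.univ
      (measure_ne_top _ _) (Eventually.of_forall fun _ => Set.subset_univ _)
      (hlim.mono fun x hlim_x => ?_)
    by_cases hx : f₀ x ∈ O
    · filter_upwards [hlim_x.eventually (hO.mem_nhds hx)] with t ht
      exact iff_of_true ⟨ht, hx⟩ hx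
    · exact Eventually.of_forall fun t => iff_of_false (fun h => hx h.2) hx
  filter_upwards [((ENNReal.tendsto_toReal (measure_ne_top _ _)).comp hinter).eventually_const_lt
    hc] with t ht
  exact ht.trans_le (measureReal_mono Set.inter_subset_left)

section VectorMGF

variable {Ξ E : Type*} [MeasurableSpace Ξ] [NormedAddCommGroup E] [InnerProductSpace ℝ E]

open scoped RealInnerProductSpace

/-- The moment generating function `θ ↦ E[exp ⟪θ, Y⟫]` of a random vector `Y`. -/
def vectorMGF (Y : Ξ → E) (ν : Measure Ξ) (θ : E) : ℝ := ∫ ξ, Real.exp ⟪θ, Y ξ⟫ ∂ν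

theorem vectorMGF_zero (Y : Ξ → E) (ν : Measure Ξ) : vectorMGF Y ν 0 = ν.real Set.univ := by
  simp [vectorMGF]

variable {Y : Ξ → E} {ν : Measure Ξ} [IsFiniteMeasure ν] {R : ℝ}

theorem integrable_exp_inner (hY : AEStronglyMeasurable Y ν) (hR : ∀ᵐ ξ ∂ν, ‖Y ξ‖ ≤ R) (θ : E) :
    Integrable (fun ξ => Real.exp ⟪θ, Y ξ⟫) ν := by
  refine .of_bound (C := Real.exp (‖θ‖ * R)) (by fun_prop) (hR.mono fun ξ hξ => ?_)
  rw [Real.norm_of_nonneg (Real.exp_pos _).le, Real.exp_le_exp]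
  exact (real_inner_le_norm _ _).trans (by gcongr)

theorem vectorMGF_pos [NeZero ν] (hY : AEStronglyMeasurable Y ν) (hR : ∀ᵐ ξ ∂ν, ‖Y ξ‖ ≤ R)
    (θ : E) : 0 < vectorMGF Y ν θ :=
  integral_exp_pos (integrable_exp_inner hY hR θ)

theorem continuous_vectorMGF (hY : AEStronglyMeasurable Y ν) (hR : ∀ᵐ ξ ∂ν, ‖Y ξ‖ ≤ R) :
    Continuous (vectorMGF Y ν) := by
  refine continuous_iff_continuousAt.2 fun θ₀ =>
    continuousAt_of_dominated (bound := fun _ => Real.exp ((‖θ₀‖ + 1) * R))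
      (Eventually.of_forall fun θ => by fun_prop) ?_ (integrable_const _)
      (ae_of_all _ fun ξ => by fun_prop)
  filter_upwards [continuous_norm.continuousAt.eventually_lt_const (lt_add_one ‖θ₀‖)] with θ hθ
  filter_upwards [hR] with ξ hξ
  rw [Real.norm_of_nonneg (Real.exp_pos _).le, Real.exp_le_exp]
  exact (real_inner_le_norm _ _).trans (by gcongr)

theorem measureReal_univ_mul_exp_le_vectorMGF (hY : AEStronglyMeasurable Y ν)
    (hR : ∀ᵐ ξ ∂ν, ‖Y ξ‖ ≤ R) (θ : E) :
    ν.real Set.univ * Real.exp (-(‖θ‖ * R)) ≤ vectorMGF Y ν θ := by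
  calc ν.real Set.univ * Real.exp (-(‖θ‖ * R)) = ∫ _, Real.exp (-(‖θ‖ * R)) ∂ν := by simp
    _ ≤ vectorMGF Y ν θ := by
      refine integral_mono_ae (integrable_const _) (integrable_exp_inner hY hR θ)
        (hR.mono fun ξ hξ => Real.exp_le_exp.2 ?_)
      calc -(‖θ‖ * R) ≤ -(‖θ‖ * ‖Y ξ‖) := by gcongr
        _ ≤ ⟪θ, Y ξ⟫ := neg_le_of_abs_le (abs_real_inner_le_norm _ _)

theorem log_vectorMGF_add_smul [NeZero ν] (hY : AEStronglyMeasurable Y ν)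
    (hR : ∀ᵐ ξ ∂ν, ‖Y ξ‖ ≤ R) (θ v : E) (t : ℝ) :
    Real.log (vectorMGF Y ν (θ + t • v)) =
      Real.log (vectorMGF Y ν θ) +
        cgf (fun ξ => ⟪v, Y ξ⟫) (ν.tilted fun ξ => ⟪θ, Y ξ⟫) t := by
  have hmgf : mgf (fun ξ => ⟪v, Y ξ⟫) (ν.tilted fun ξ => ⟪θ, Y ξ⟫) t =
      vectorMGF Y ν (θ + t • v) / vectorMGF Y ν θ := by
    simp only [mgf, vectorMGF, integral_exp_tilted (fun ξ => ⟪θ, Y ξ⟫) fun ξ => t * ⟪v, Y ξ⟫,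
      Pi.add_apply, inner_add_left, real_inner_smul_left]
  rw [cgf, hmgf, Real.log_div (vectorMGF_pos hY hR _).ne' (vectorMGF_pos hY hR _).ne']
  ring

theorem hasDerivAt_log_vectorMGF [CompleteSpace E] [NeZero ν] (hY : AEStronglyMeasurable Y ν)
    (hR : ∀ᵐ ξ ∂ν, ‖Y ξ‖ ≤ R) (θ v : E) :
    HasDerivAt (fun t : ℝ => Real.log (vectorMGF Y ν (θ + t • v)))
      ⟪v, ∫ ξ, Y ξ ∂(ν.tilted fun ξ => ⟪θ, Y ξ⟫)⟫ 0 := by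
  set τ := ν.tilted fun ξ => ⟪θ, Y ξ⟫
  have : IsProbabilityMeasure τ := isProbabilityMeasure_tilted (integrable_exp_inner hY hR θ)
  have hYτ : AEStronglyMeasurable Y τ := hY.mono_ac (tilted_absolutelyContinuous _ _)
  have hRτ : ∀ᵐ ξ ∂τ, ‖Y ξ‖ ≤ R := (tilted_absolutelyContinuous _ _).ae_le hR
  have hzero : (0 : ℝ) ∈ interior (integrableExpSet (fun ξ => ⟪v, Y ξ⟫) τ) := by
    have huniv : integrableExpSet (fun ξ => ⟪v, Y ξ⟫) τ = Set.univ :=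
      Set.eq_univ_of_forall fun t => by
        simpa only [integrableExpSet, Set.mem_ofPred_eq, real_inner_smul_left] using
          integrable_exp_inner hYτ hRτ (t • v)
    rw [huniv, interior_univ]
    exact Set.mem_univ _
  have hderiv := (analyticAt_cgf hzero).differentiableAt.hasDerivAt.const_add
    (Real.log (vectorMGF Y ν θ))
  simp_rw [log_vectorMGF_add_smul hY hR θ v]
  rwa [deriv_cgf_zero hzero, probReal_univ, div_one,
    integral_inner (.of_bound hYτ R hRτ)] at hderiv

section FiniteDimensional

variable [FiniteDimensional ℝ E]

theorem tendsto_log_vectorMGF_add_cocompact [NeZero ν] (hY : AEStronglyMeasurable Y ν)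
    (hR : ∀ᵐ ξ ∂ν, ‖Y ξ‖ ≤ R) {δ : ℝ} (hδ : 0 < δ) :
    Tendsto (fun θ => Real.log (vectorMGF Y ν θ) + δ * ‖θ‖ ^ 2) (cocompact E) atTop := by
  have hquad : Tendsto (fun s : ℝ => s * (δ * s - R)) atTop atTop :=
    tendsto_id.atTop_mul_atTop₀ ((tendsto_id.const_mul_atTop hδ).atTop_add tendsto_const_nhds)
  refine tendsto_atTop_mono (fun θ => ?_) (tendsto_atTop_add_const_left _
    (Real.log (ν.real Set.univ)) (hquad.comp (tendsto_norm_cocompact_atTop (E := E))))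
  have hν : 0 < ν.real Set.univ := measureReal_univ_pos
  have hlog := Real.log_le_log (by positivity) (measureReal_univ_mul_exp_le_vectorMGF hY hR θ)
  rw [Real.log_mul hν.ne' (Real.exp_pos _).ne', Real.log_exp] at hlog
  simp only [Function.comp_apply]
  linarith

theorem isCompact_log_vectorMGF_add_le [NeZero ν] (hY : AEStronglyMeasurable Y ν)
    (hR : ∀ᵐ ξ ∂ν, ‖Y ξ‖ ≤ R) {δ : ℝ} (hδ : 0 < δ) (c : ℝ) :
    IsCompact {θ | Real.log (vectorMGF Y ν θ) + δ * ‖θ‖ ^ 2 ≤ c} := by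
  obtain ⟨K, hK, hKc⟩ := mem_cocompact.1
    ((tendsto_log_vectorMGF_add_cocompact hY hR hδ).eventually_gt_atTop c)
  refine hK.of_isClosed_subset (isClosed_le ?_ continuous_const) fun θ hθ => by_contra fun hθK => ?_
  · exact ((continuous_vectorMGF hY hR).log fun θ => (vectorMGF_pos hY hR θ).ne').add
      (by fun_prop)
  · exact (show c < _ from hKc hθK).not_ge hθ

theorem exists_forall_log_vectorMGF_add_le [NeZero ν] (hY : AEStronglyMeasurable Y ν)
    (hR : ∀ᵐ ξ ∂ν, ‖Y ξ‖ ≤ R) {δ : ℝ} (hδ : 0 < δ) :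
    ∃ θ, ∀ θ', Real.log (vectorMGF Y ν θ) + δ * ‖θ‖ ^ 2 ≤
      Real.log (vectorMGF Y ν θ') + δ * ‖θ'‖ ^ 2 :=
  (((continuous_vectorMGF hY hR).log fun θ => (vectorMGF_pos hY hR θ).ne').add
    (by fun_prop)).exists_forall_le (tendsto_log_vectorMGF_add_cocompact hY hR hδ)

theorem integral_tilted_eq_of_forall_log_vectorMGF_add_le [NeZero ν]
    (hY : AEStronglyMeasurable Y ν) (hR : ∀ᵐ ξ ∂ν, ‖Y ξ‖ ≤ R) {δ : ℝ} {θ : E}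
    (hθ : ∀ θ', Real.log (vectorMGF Y ν θ) + δ * ‖θ‖ ^ 2 ≤
      Real.log (vectorMGF Y ν θ') + δ * ‖θ'‖ ^ 2) :
    ∫ ξ, Y ξ ∂(ν.tilted fun ξ => ⟪θ, Y ξ⟫) = -(2 * δ) • θ := by
  refine ext_inner_left ℝ fun v => ?_
  have hsq : HasDerivAt (fun t : ℝ => δ * ‖θ + t • v‖ ^ 2) (δ * (2 * ⟪θ, v⟫)) 0 := by
    have h := (((hasDerivAt_id (0 : ℝ)).smul_const v).const_add θ).norm_sq.const_mul δ
    simpa using h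
  have hmin : IsLocalMin
      (fun t : ℝ => Real.log (vectorMGF Y ν (θ + t • v)) + δ * ‖θ + t • v‖ ^ 2) 0 :=
    Eventually.of_forall fun t => by simpa using hθ (θ + t • v)
  have hzero := hmin.hasDerivAt_eq_zero ((hasDerivAt_log_vectorMGF hY hR θ v).add hsq)
  rw [real_inner_smul_right, real_inner_comm θ v]
  linarith

end FiniteDimensional

end VectorMGF

section Truncation

variable {Ξ E : Type*} [NormedAddCommGroup E]

open scoped RealInnerProductSpace

theorem monotone_setOf_norm_le (Y : Ξ → E) : Monotone fun n : ℕ => {ξ | ‖Y ξ‖ ≤ n} :=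
  fun _ _ hmn _ hξ => le_trans (Set.mem_ofPred_eq.mp hξ) (Nat.cast_le.2 hmn)

variable [MeasurableSpace Ξ] {γ : Measure Ξ} {Y : Ξ → E}

/-- The restriction of `γ` to the event that the random vector `Y` has norm at most `n`; under it
every moment generating function is finite. -/
def normTruncation (γ : Measure Ξ) (Y : Ξ → E) (n : ℕ) : Measure Ξ := γ.restrict {ξ | ‖Y ξ‖ ≤ n}

instance [IsFiniteMeasure γ] (n : ℕ) : IsFiniteMeasure (normTruncation γ Y n) := by
  unfold normTruncation; infer_instance

theorem monotone_normTruncation : Monotone (normTruncation γ Y) := fun _ _ hmn =>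
  Measure.restrict_mono (monotone_setOf_norm_le Y hmn) le_rfl

theorem lintegral_eq_iSup_normTruncation (f : Ξ → ℝ≥0∞) :
    ∫⁻ ξ, f ξ ∂γ = ⨆ n, ∫⁻ ξ, f ξ ∂normTruncation γ Y n := by
  have hunion : ⋃ n : ℕ, {ξ | ‖Y ξ‖ ≤ n} = Set.univ :=
    Set.iUnion_eq_univ_iff.2 fun ξ => exists_nat_ge ‖Y ξ‖
  rw [← setLIntegral_univ, ← hunion]
  exact setLIntegral_iUnion_of_directed f (monotone_setOf_norm_le Y).directed_le

theorem exists_forall_normTruncation_neZero [NeZero γ] :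
    ∃ n₀, ∀ n ≥ n₀, NeZero (normTruncation γ Y n) := by
  have hpos : 0 < ⨆ n, ∫⁻ _, 1 ∂normTruncation γ Y n := by
    rw [← lintegral_eq_iSup_normTruncation, lintegral_one]
    exact Measure.measure_univ_pos.2 (NeZero.ne γ)
  obtain ⟨n₀, hn₀⟩ := lt_iSup_iff.1 hpos
  rw [lintegral_one, Measure.measure_univ_pos] at hn₀
  exact ⟨n₀, fun n hn => ⟨fun h => hn₀ (le_bot_iff.1 ((monotone_normTruncation hn).trans_eq h))⟩⟩

variable [MeasurableSpace E] [BorelSpace E]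

theorem ae_normTruncation_norm_le (hY : Measurable Y) (n : ℕ) :
    ∀ᵐ ξ ∂normTruncation γ Y n, ‖Y ξ‖ ≤ n :=
  ae_restrict_mem (measurableSet_le hY.norm measurable_const)

variable [InnerProductSpace ℝ E] [FiniteDimensional ℝ E]

variable [IsProbabilityMeasure γ]

theorem monotone_vectorMGF_normTruncation (hY : Measurable Y) (θ : E) :
    Monotone fun n => vectorMGF Y (normTruncation γ Y n) θ := fun _ n hmn =>
  integral_mono_measure (monotone_normTruncation hmn) (ae_of_all _ fun _ => (Real.exp_pos _).le)
    (integrable_exp_inner hY.aestronglyMeasurable (ae_normTruncation_norm_le hY n) θ)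

theorem ofReal_vectorMGF_normTruncation (hY : Measurable Y) (n : ℕ) (θ : E) :
    ENNReal.ofReal (vectorMGF Y (normTruncation γ Y n) θ) =
      ∫⁻ ξ, ENNReal.ofReal (Real.exp ⟪θ, Y ξ⟫) ∂normTruncation γ Y n :=
  ofReal_integral_eq_lintegral_ofReal
    (integrable_exp_inner hY.aestronglyMeasurable (ae_normTruncation_norm_le hY n) θ)
    (ae_of_all _ fun _ => (Real.exp_pos _).le)

theorem exists_lt_log_vectorMGF_normTruncation (hY : Measurable Y) {a b : ℝ} (hab : a < b) {θ : E}
    (hb : ENNReal.ofReal (Real.exp b) ≤ ∫⁻ ξ, ENNReal.ofReal (Real.exp ⟪θ, Y ξ⟫) ∂γ) :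
    ∃ n₀, ∀ n ≥ n₀, a < Real.log (vectorMGF Y (normTruncation γ Y n) θ) := by
  have hlt : ENNReal.ofReal (Real.exp a) <
      ⨆ n, ∫⁻ ξ, ENNReal.ofReal (Real.exp ⟪θ, Y ξ⟫) ∂normTruncation γ Y n := by
    rw [← lintegral_eq_iSup_normTruncation]
    exact ((ENNReal.ofReal_lt_ofReal_iff (Real.exp_pos _)).2 (Real.exp_lt_exp.2 hab)).trans_le hb
  obtain ⟨n₀, hn₀⟩ := lt_iSup_iff.1 hlt
  rw [← ofReal_vectorMGF_normTruncation hY, ENNReal.ofReal_lt_ofReal_iff'] at hn₀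
  refine ⟨n₀, fun n hn => ?_⟩
  have hexp := hn₀.1.trans_le (monotone_vectorMGF_normTruncation hY θ hn)
  exact (Real.lt_log_iff_exp_lt ((Real.exp_pos a).trans hexp)).2 hexp

-- The sublevel sets of the truncated functionals are compact and decrease with the truncation
-- level, and by monotone convergence no `θ` lies in all of them.
theorem exists_forall_lt_log_vectorMGF_normTruncation_add (hY : Measurable Y) {a b : ℝ}
    (hab : a < b) (hb : ∀ θ : E, ENNReal.ofReal (Real.exp b) ≤
      ∫⁻ ξ, ENNReal.ofReal (Real.exp ⟪θ, Y ξ⟫) ∂γ) {δ : ℝ} (hδ : 0 < δ) :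
    ∃ n, NeZero (normTruncation γ Y n) ∧
      ∀ θ, a < Real.log (vectorMGF Y (normTruncation γ Y n) θ) + δ * ‖θ‖ ^ 2 := by
  obtain ⟨n₀, hn₀⟩ := exists_forall_normTruncation_neZero (γ := γ) (Y := Y)
  have hne : ∀ k, NeZero (normTruncation γ Y (n₀ + k)) := fun k => hn₀ _ (Nat.le_add_right _ _)
  have hY' (n : ℕ) : AEStronglyMeasurable Y (normTruncation γ Y n) := hY.aestronglyMeasurable
  have hR := ae_normTruncation_norm_le (γ := γ) hY
  set F : ℕ → Set E := fun k =>
    {θ | Real.log (vectorMGF Y (normTruncation γ Y (n₀ + k)) θ) + δ * ‖θ‖ ^ 2 ≤ a}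
  have hcompact (k : ℕ) : IsCompact (F k) := isCompact_log_vectorMGF_add_le (hY' _) (hR _) hδ a
  have hanti : Antitone F := fun j k hjk θ (hθ : _ ≤ a) => by
    refine le_trans (add_le_add_left (Real.log_le_log (vectorMGF_pos (hY' _) (hR _) θ) ?_) _) hθ
    exact monotone_vectorMGF_normTruncation hY θ (Nat.add_le_add_left hjk n₀)
  have hempty : F 0 ∩ ⋂ k, F k = ∅ := Set.eq_empty_of_forall_notMem fun θ hθ => by
    obtain ⟨k, hk⟩ := exists_lt_log_vectorMGF_normTruncation hY hab (hb θ)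
    have hle : _ ≤ a := Set.mem_iInter.1 hθ.2 k
    linarith [hk (n₀ + k) (Nat.le_add_left k n₀), mul_nonneg hδ.le (sq_nonneg ‖θ‖)]
  obtain ⟨k, hk⟩ := (hcompact 0).elim_directed_family_closed F (fun k => (hcompact k).isClosed)
    hempty hanti.directed_ge
  rw [Set.inter_eq_right.2 (hanti (Nat.zero_le k))] at hk
  exact ⟨n₀ + k, hne k, fun θ => not_le.1 fun hθ => Set.eq_empty_iff_forall_notMem.1 hk θ hθ⟩

/- Minimising the logarithmic moment generating function plus `δ * ‖θ‖ ^ 2` always yields a tilting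
parameter, at the price of a mean `m` which is small instead of zero. -/
theorem exists_tilted_normTruncation (hY : Measurable Y) {b : ℝ}
    (hb : ∀ θ : E, ENNReal.ofReal (Real.exp (-b)) ≤
      ∫⁻ ξ, ENNReal.ofReal (Real.exp ⟪θ, Y ξ⟫) ∂γ) {r ε : ℝ} (hr : 0 < r) (hε : 0 < ε) :
    ∃ n, NeZero (normTruncation γ Y n) ∧ ∃ θ m : E, ‖m‖ < r ∧
      ∫ ξ, Y ξ ∂((normTruncation γ Y n).tilted fun ξ => ⟪θ, Y ξ⟫) = m ∧
      -b - ε < Real.log (vectorMGF Y (normTruncation γ Y n) θ) - ⟪θ, m⟫ := by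
  have hb₀ : 0 ≤ b := by simpa using hb 0
  set δ : ℝ := r ^ 2 / (16 * (b + ε)) with hδ_def
  have hδ : 0 < δ := by positivity
  have hδb : 8 * δ * (b + ε) = r ^ 2 / 2 := by rw [hδ_def]; field_simp; norm_num
  obtain ⟨n, hne, hlower⟩ := exists_forall_lt_log_vectorMGF_normTruncation_add hY
    (show -b - ε < -b by linarith) hb (half_pos hδ)
  have hR := ae_normTruncation_norm_le (γ := γ) hY n
  obtain ⟨θ, hθ⟩ := exists_forall_log_vectorMGF_add_le hY.aestronglyMeasurable hR hδ
  have hmin : Real.log (vectorMGF Y (normTruncation γ Y n) θ) + δ * ‖θ‖ ^ 2 ≤ 0 := by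
    have hle := hθ 0
    have hlog : Real.log (vectorMGF Y (normTruncation γ Y n) 0) ≤ 0 := by
      rw [vectorMGF_zero]
      refine Real.log_nonpos measureReal_nonneg ?_
      simp [normTruncation]
    simp only [norm_zero] at hle
    linarith
  have hθ_norm : δ * ‖θ‖ ^ 2 < 2 * (b + ε) := by linarith [hlower θ]
  refine ⟨n, hne, θ, -(2 * δ) • θ, ?_, integral_tilted_eq_of_forall_log_vectorMGF_add_le
    hY.aestronglyMeasurable hR hθ, ?_⟩
  · refine lt_of_pow_lt_pow_left₀ 2 hr.le ?_
    rw [norm_smul, mul_pow, Real.norm_eq_abs, sq_abs]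
    nlinarith [mul_lt_mul_of_pos_left hθ_norm hδ]
  · rw [real_inner_smul_right, real_inner_self_eq_norm_sq]
    linarith [hlower θ, mul_nonneg hδ.le (sq_nonneg ‖θ‖)]

end Truncation

section SampleMean

variable {ι Ξ E : Type*} [Fintype ι] [AddCommGroup E] [Module ℝ E]

/-- The empirical mean of the values of `Y` over the sample `ξ`. -/
def sampleMean (Y : Ξ → E) (ξ : ι → Ξ) : E := (Fintype.card ι : ℝ)⁻¹ • ∑ i, Y (ξ i)

theorem sampleMean_sub_const [Nonempty ι] (Y : Ξ → E) (x : E) (ξ : ι → Ξ) :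
    sampleMean (fun η => Y η - x) ξ = sampleMean Y ξ - x := by
  have hcard : (Fintype.card ι : ℝ) ≠ 0 := Nat.cast_ne_zero.2 Fintype.card_ne_zero
  rw [sampleMean, Finset.sum_sub_distrib, smul_sub, Finset.sum_const, Finset.card_univ,
    ← Nat.cast_smul_eq_nsmul ℝ, inv_smul_smul₀ hcard, sampleMean]

theorem sampleMean_append_mem {C : Set E} (hC : Convex ℝ C) {Y : Ξ → E} {N M : ℕ} (hN : 0 < N)
    (hM : 0 < M) {ξ : Fin N → Ξ} {η : Fin M → Ξ} (hξ : sampleMean Y ξ ∈ C)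
    (hη : sampleMean Y η ∈ C) : sampleMean Y (Fin.append ξ η) ∈ C := by
  have : (0 : ℝ) < N := Nat.cast_pos.2 hN
  have : (0 : ℝ) < M := Nat.cast_pos.2 hM
  have hmean : sampleMean Y (Fin.append ξ η) =
      (N / (N + M) : ℝ) • sampleMean Y ξ + (M / (N + M) : ℝ) • sampleMean Y η := by
    simp only [sampleMean, Fin.sum_univ_add, Fin.append_left, Fin.append_right, Fintype.card_fin,
      smul_smul, smul_add, Nat.cast_add]
    congr 2 <;> field_simp
  rw [hmean]
  exact hC hξ hη (by positivity) (by positivity) (by field_simp)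

end SampleMean

section SampleMeanMeasure

variable {Ξ E : Type*} [MeasurableSpace Ξ] [NormedAddCommGroup E] [MeasurableSpace E]
  [BorelSpace E] {Y : Ξ → E}

@[fun_prop]
theorem measurable_sampleMean {ι : Type*} [Fintype ι] [NormedSpace ℝ E]
    [SecondCountableTopology E] (hY : Measurable Y) :
    Measurable (sampleMean Y : (ι → Ξ) → E) := by
  unfold sampleMean
  fun_prop

theorem eventually_lt_pi_sampleMean_mem_ball [NormedSpace ℝ E] [CompleteSpace E]
    [SecondCountableTopology E] (τ : Measure Ξ) [IsProbabilityMeasure τ] (hY : Measurable Y)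
    (hint : Integrable Y τ) {s c : ℝ} (hs : 0 < s) (hc : c < 1) :
    ∀ᶠ N : ℕ in atTop, c < (Measure.pi fun _ : Fin N => τ).real
      (sampleMean Y ⁻¹' Metric.ball (∫ ξ, Y ξ ∂τ) s) := by
  let μ : Measure (ℕ → Ξ) := Measure.infinitePi fun _ => τ
  have hindep : iIndepFun (fun (i : ℕ) (ω : ℕ → Ξ) => Y (ω i)) μ :=
    iIndepFun_infinitePi (X := fun _ => Y) fun _ => hY
  have heval (i : ℕ) : MeasurePreserving (fun ω : ℕ → Ξ => ω i) μ τ :=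
    measurePreserving_eval_infinitePi (fun _ => τ) i
  have hident (i : ℕ) : IdentDistrib (fun ω : ℕ → Ξ => Y (ω i)) (fun ω => Y (ω 0)) μ μ :=
    IdentDistrib.comp ⟨(heval i).aemeasurable, (heval 0).aemeasurable,
      (heval i).map_eq.trans (heval 0).map_eq.symm⟩ hY
  have hlln := strong_law_ae (μ := μ) (fun i ω => Y (ω i))
    ((heval 0).integrable_comp_of_integrable hint) (fun i j hij => hindep.indepFun hij) hident
  have hmean : ∫ ω, Y (ω 0) ∂μ = ∫ ξ, Y ξ ∂τ := by
    rw [← (heval 0).map_eq, integral_map (heval 0).aemeasurable hY.aestronglyMeasurable]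
  rw [hmean] at hlln
  refine (eventually_lt_measureReal_of_ae_tendsto μ (fun N => ?_) measurable_const hlln
    Metric.isOpen_ball (c := c) (O := Metric.ball (∫ ξ, Y ξ ∂τ) s) ?_).mono fun N hN => ?_
  · exact (Finset.measurable_sum _ fun i _ =>
      hY.comp (measurable_pi_apply i)).const_smul ((N : ℝ)⁻¹)
  · simpa [Metric.mem_ball_self hs] using hc
  · rw [← (measurePreserving_infinitePi_pi τ N).measureReal_preimage
      (measurable_sampleMean hY measurableSet_ball).nullMeasurableSet]
    simpa [sampleMean, Set.preimage, Finset.sum_range] using hN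

theorem pi_preimage_sampleMean_mul_le [NormedSpace ℝ E] [SecondCountableTopology E]
    (γ : Measure Ξ) [SigmaFinite γ] (hY : Measurable Y) {C : Set E} (hC : Convex ℝ C)
    (hCm : MeasurableSet C) {N M : ℕ} (hN : 0 < N) (hM : 0 < M) :
    (Measure.pi fun _ : Fin N => γ) (sampleMean Y ⁻¹' C) *
        (Measure.pi fun _ : Fin M => γ) (sampleMean Y ⁻¹' C) ≤
      (Measure.pi fun _ : Fin (N + M) => γ) (sampleMean Y ⁻¹' C) := by
  rw [← Measure.prod_prod, ← (measurePreserving_fin_append γ N M).measure_preimage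
    (measurable_sampleMean hY hCm).nullMeasurableSet]
  exact measure_mono fun p hp => sampleMean_append_mem hC hN hM hp.1 hp.2

end SampleMeanMeasure

theorem pow_le_of_forall_mul_le_add {p : ℕ → ℝ} {N₀ : ℕ} (hN₀ : 0 < N₀) {c : ℝ} (hc : 0 ≤ c)
    (hmul : ∀ N > 0, ∀ M > 0, p N * p M ≤ p (N + M))
    (hbase : ∀ N ∈ Finset.Ico N₀ (2 * N₀), c ^ N ≤ p N) {N : ℕ} (hN : N₀ ≤ N) : c ^ N ≤ p N := by
  induction N using Nat.strong_induction_on with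
  | _ N ih =>
    rcases lt_or_ge N (2 * N₀) with hlt | hge
    · exact hbase N (Finset.mem_Ico.2 ⟨hN, hlt⟩)
    · obtain ⟨M, rfl⟩ := Nat.exists_eq_add_of_le hN
      calc c ^ (N₀ + M) = c ^ N₀ * c ^ M := pow_add c N₀ M
        _ ≤ p N₀ * p M := by
          have := hbase N₀ (Finset.mem_Ico.2 ⟨le_rfl, by omega⟩)
          gcongr
          · exact (pow_nonneg hc _).trans this
          · exact ih M (by omega) (by omega)
        _ ≤ p (N₀ + M) := hmul N₀ hN₀ M (by omega)

section Cramer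

variable {Ξ E : Type*} [MeasurableSpace Ξ] [NormedAddCommGroup E] [MeasurableSpace E]
  [BorelSpace E] [InnerProductSpace ℝ E] [FiniteDimensional ℝ E] (γ : Measure Ξ)
  [IsProbabilityMeasure γ] {Y : Ξ → E}

open scoped RealInnerProductSpace

theorem pi_tilted_sampleMean_mul_le (hY : Measurable Y) (n : ℕ) [NeZero (normTruncation γ Y n)]
    (θ m : E) {s ε : ℝ} (hs : ‖θ‖ * s ≤ ε) {N : ℕ} (hN : 0 < N) :
    (Measure.pi fun _ : Fin N => (normTruncation γ Y n).tilted fun ξ => ⟪θ, Y ξ⟫).real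
        (sampleMean Y ⁻¹' Metric.ball m s) *
        Real.exp (N * (Real.log (vectorMGF Y (normTruncation γ Y n) θ) - ⟪θ, m⟫ - ε)) ≤
      (Measure.pi fun _ : Fin N => γ).real (sampleMean Y ⁻¹' Metric.ball m s) := by
  set ν := normTruncation γ Y n
  have hpos : 0 < vectorMGF Y ν θ :=
    vectorMGF_pos hY.aestronglyMeasurable (ae_normTruncation_norm_le hY n) θ
  have hsum : ∀ ξ ∈ (sampleMean Y ⁻¹' Metric.ball m s : Set (Fin N → Ξ)),
      ∑ i, ⟪θ, Y (ξ i)⟫ ≤ N * (⟪θ, m⟫ + ε) := by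
    intro ξ hξ
    have hinner : ∑ i, ⟪θ, Y (ξ i)⟫ = N * (⟪θ, m⟫ + ⟪θ, sampleMean Y ξ - m⟫) := by
      rw [← inner_add_right, add_sub_cancel, sampleMean, real_inner_smul_right, inner_sum,
        Fintype.card_fin]
      field_simp
    rw [hinner]
    gcongr
    calc ⟪θ, sampleMean Y ξ - m⟫ ≤ ‖θ‖ * ‖sampleMean Y ξ - m‖ := real_inner_le_norm _ _
      _ ≤ ‖θ‖ * s := by gcongr; exact (mem_ball_iff_norm.1 hξ).le
      _ ≤ ε := hs
  have hchange := measureReal_tilted_mul_integral_exp_le (Measure.pi fun _ : Fin N => ν)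
    (fun ξ => ∑ i, ⟪θ, Y (ξ i)⟫) (measurable_sampleMean hY measurableSet_ball) hsum
  have hmgf : ∫ ξ : Fin N → Ξ, Real.exp (∑ i, ⟪θ, Y (ξ i)⟫) ∂(Measure.pi fun _ => ν) =
      Real.exp (N * Real.log (vectorMGF Y ν θ)) := by
    simp_rw [Real.exp_sum]
    rw [integral_fintype_prod_eq_pow fun ξ => Real.exp ⟪θ, Y ξ⟫, Fintype.card_fin,
      Real.exp_nat_mul, Real.exp_log hpos, vectorMGF]
  rw [hmgf, ← pi_tilted (fun _ => ν) fun _ ξ => ⟪θ, Y ξ⟫] at hchange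
  have hsplit : N * (Real.log (vectorMGF Y ν θ) - ⟪θ, m⟫ - ε) =
      N * Real.log (vectorMGF Y ν θ) - N * (⟪θ, m⟫ + ε) := by ring
  rw [hsplit, Real.exp_sub, ← mul_div_assoc, div_le_iff₀' (Real.exp_pos _)]
  refine hchange.trans (mul_le_mul_of_nonneg_left ?_ (Real.exp_pos _).le)
  exact ENNReal.toReal_mono (measure_ne_top _ _) (pi_restrict_le γ _ _)

theorem eventually_exp_lt_pi_sampleMean_of_zero (hY : Measurable Y) {b : ℝ}
    (hb : ∀ θ : E, ENNReal.ofReal (Real.exp (-b)) ≤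
      ∫⁻ ξ, ENNReal.ofReal (Real.exp ⟪θ, Y ξ⟫) ∂γ) {r ε : ℝ} (hr : 0 < r) (hε : 0 < ε) :
    ∀ᶠ N : ℕ in atTop, Real.exp (-(N * (b + ε))) <
      (Measure.pi fun _ : Fin N => γ).real (sampleMean Y ⁻¹' Metric.ball 0 r) := by
  obtain ⟨n, hne, θ, m, hmr, hmean, hvalue⟩ :=
    exists_tilted_normTruncation hY hb hr (show 0 < ε / 3 by positivity)
  set ν := normTruncation γ Y n
  have hR : ∀ᵐ ξ ∂ν, ‖Y ξ‖ ≤ n := ae_normTruncation_norm_le hY n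
  have : IsProbabilityMeasure (ν.tilted fun ξ => ⟪θ, Y ξ⟫) :=
    isProbabilityMeasure_tilted (integrable_exp_inner hY.aestronglyMeasurable hR θ)
  obtain ⟨s, hs, hsr, hsθ⟩ : ∃ s > 0, ‖m‖ + s ≤ r ∧ ‖θ‖ * s ≤ ε / 3 := by
    refine ⟨min (r - ‖m‖) (ε / 3 / (‖θ‖ + 1)), lt_min (by linarith) (by positivity),
      by linarith [min_le_left (r - ‖m‖) (ε / 3 / (‖θ‖ + 1))], ?_⟩
    calc ‖θ‖ * min (r - ‖m‖) (ε / 3 / (‖θ‖ + 1)) ≤ (‖θ‖ + 1) * (ε / 3 / (‖θ‖ + 1)) :=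
          mul_le_mul (by linarith) (min_le_right _ _) (by positivity) (by positivity)
      _ = ε / 3 := by field_simp
  have hint : Integrable Y (ν.tilted fun ξ => ⟪θ, Y ξ⟫) :=
    .of_bound hY.aestronglyMeasurable n ((tilted_absolutelyContinuous _ _).ae_le hR)
  have hlln := eventually_lt_pi_sampleMean_mem_ball _ hY hint hs (c := 1 / 2) (by norm_num)
  have hlarge : ∀ᶠ N : ℕ in atTop, Real.log 2 ≤ N * (ε / 3) :=
    (tendsto_natCast_atTop_atTop.atTop_mul_const (by positivity)).eventually_ge_atTop _
  filter_upwards [hlln, hlarge, eventually_gt_atTop 0] with N hN hN_large hN_pos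
  rw [hmean] at hN
  calc Real.exp (-(N * (b + ε)))
      ≤ Real.exp (-Real.log 2) *
          Real.exp (N * (Real.log (vectorMGF Y ν θ) - ⟪θ, m⟫ - ε / 3)) := by
        rw [← Real.exp_add, Real.exp_le_exp]
        have := mul_le_mul_of_nonneg_left hvalue.le (Nat.cast_nonneg (α := ℝ) N)
        linarith
    _ < _ := by
        rw [Real.exp_neg, Real.exp_log two_pos, ← one_div]
        exact mul_lt_mul_of_pos_right hN (Real.exp_pos _)
    _ ≤ _ := pi_tilted_sampleMean_mul_le γ hY n θ m hsθ hN_pos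
    _ ≤ _ := measureReal_mono (Set.preimage_mono (Metric.ball_subset_ball' (by
        rw [dist_zero_right]; linarith)))

theorem eventually_exp_lt_pi_sampleMean (hY : Measurable Y) (x : E) {b : ℝ}
    (hb : ∀ θ : E, ENNReal.ofReal (Real.exp (⟪θ, x⟫ - b)) ≤
      ∫⁻ ξ, ENNReal.ofReal (Real.exp ⟪θ, Y ξ⟫) ∂γ) {r ε : ℝ} (hr : 0 < r) (hε : 0 < ε) :
    ∀ᶠ N : ℕ in atTop, Real.exp (-(N * (b + ε))) <
      (Measure.pi fun _ : Fin N => γ).real (sampleMean Y ⁻¹' Metric.ball x r) := by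
  have hcentred : ∀ θ : E, ENNReal.ofReal (Real.exp (-b)) ≤
      ∫⁻ ξ, ENNReal.ofReal (Real.exp ⟪θ, Y ξ - x⟫) ∂γ := fun θ => by
    have hexp (u : ℝ) : ENNReal.ofReal (Real.exp (u - ⟪θ, x⟫)) =
        ENNReal.ofReal (Real.exp (-⟪θ, x⟫)) * ENNReal.ofReal (Real.exp u) := by
      rw [← ENNReal.ofReal_mul (Real.exp_pos _).le, ← Real.exp_add, neg_add_eq_sub]
    simp_rw [inner_sub_right, hexp, lintegral_const_mul' _ _ ENNReal.ofReal_ne_top]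
    calc ENNReal.ofReal (Real.exp (-b))
        = ENNReal.ofReal (Real.exp (-⟪θ, x⟫)) * ENNReal.ofReal (Real.exp (⟪θ, x⟫ - b)) := by
          rw [← hexp]; ring_nf
      _ ≤ _ := by gcongr; exact hb θ
  filter_upwards [eventually_exp_lt_pi_sampleMean_of_zero γ (hY.sub_const x) hcentred hr hε,
    eventually_gt_atTop 0] with N hN hN_pos
  have : Nonempty (Fin N) := ⟨⟨0, hN_pos⟩⟩
  refine hN.trans_le (measureReal_mono fun ξ hξ => ?_)
  rwa [Set.mem_preimage, sampleMean_sub_const, mem_ball_zero_iff, ← mem_ball_iff_norm] at hξ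

/- Superadditivity in `N` of the logarithm of the probability reduces uniformity in `t` over all
`N ≥ N₀` to the finitely many `N < 2 * N₀`. -/
theorem cramer_lower_bound {T : Type*} {l : Filter T} [l.IsCountablyGenerated] {y : T → Ξ → E}
    {y₀ : Ξ → E} (hy : ∀ t, Measurable (y t)) (hy₀ : Measurable y₀)
    (hlim : ∀ ξ, Tendsto (fun t => y t ξ) l (𝓝 (y₀ ξ))) (x : E) {b : ℝ}
    (hb : ∀ θ : E, ENNReal.ofReal (Real.exp (⟪θ, x⟫ - b)) ≤
      ∫⁻ ξ, ENNReal.ofReal (Real.exp ⟪θ, y₀ ξ⟫) ∂γ) {U : Set E} (hU : U ∈ 𝓝 x) {ε : ℝ}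
    (hε : 0 < ε) :
    ∃ N₀ : ℕ, ∀ᶠ t in l, ∀ N ≥ N₀, Real.exp (-(N * (b + ε))) ≤
      (Measure.pi fun _ : Fin N => γ).real (sampleMean (y t) ⁻¹' U) := by
  obtain ⟨r, hr, hball⟩ := Metric.mem_nhds_iff.1 hU
  obtain ⟨N₀, hN₀⟩ := eventually_atTop.1
    ((eventually_exp_lt_pi_sampleMean γ hy₀ x hb hr hε).and (eventually_gt_atTop 0))
  have hbase : ∀ N ∈ Finset.Ico N₀ (2 * N₀), ∀ᶠ t in l, Real.exp (-(N * (b + ε))) <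
      (Measure.pi fun _ : Fin N => γ).real (sampleMean (y t) ⁻¹' Metric.ball x r) :=
    fun N hN => eventually_lt_measureReal_of_ae_tendsto _ (fun t => measurable_sampleMean (hy t))
      (measurable_sampleMean hy₀)
      (ae_of_all _ fun ξ => (tendsto_finsetSum _ fun i _ => hlim (ξ i)).const_smul _)
      Metric.isOpen_ball (hN₀ N (Finset.mem_Ico.1 hN).1).1
  refine ⟨N₀, ((Finset.eventually_all _).2 hbase).mono fun t ht N hN => ?_⟩
  have hexp : ∀ N : ℕ, Real.exp (-(N * (b + ε))) = Real.exp (-(b + ε)) ^ N := fun N => by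
    rw [← Real.exp_nat_mul, mul_neg]
  simp_rw [hexp] at ht ⊢
  refine (pow_le_of_forall_mul_le_add (hN₀ N₀ le_rfl).2 (Real.exp_pos _).le (fun N hN M hM => ?_)
    (fun N hN => (ht N hN).le) hN).trans
    (measureReal_mono (fun ξ (hξ : _ ∈ Metric.ball x r) => hball hξ))
  simpa only [Measure.real, ENNReal.toReal_mul] using ENNReal.toReal_mono (measure_ne_top _ _)
    (pi_preimage_sampleMean_mul_le γ (hy t) (convex_ball x r) measurableSet_ball hN hM)

end Cramer

theorem isClosed_setOf_posSemidef {ι : Type*} [Finite ι] :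
    IsClosed {Q : Matrix ι ι ℝ | Q.PosSemidef} := by
  have := Fintype.ofFinite ι
  simp only [Matrix.posSemidef_iff_dotProduct_mulVec, Matrix.IsHermitian, Set.ofPred_and,
    Set.ofPred_forall]
  exact (isClosed_eq (by fun_prop) continuous_id).inter
    (isClosed_iInter fun x => isClosed_le continuous_const (by fun_prop))

namespace PSDCone

variable {ι : Type} [Fintype ι]

theorem abs_apply_le_trace (Q : PSDCone ι) (i j : ι) : |Q.1 i j| ≤ Q.1.trace := by
  classical
  have hle (k : ι) : Q.1 k k ≤ Q.1.trace :=
    Finset.single_le_sum (f := fun k => Q.1 k k) (fun _ _ => Q.2.diag_nonneg) (Finset.mem_univ k)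
  have hsymm : Q.1 j i = Q.1 i j := by simpa using Q.2.isHermitian.apply i j
  have hadd := Q.2.dotProduct_mulVec_nonneg (Pi.single i 1 + Pi.single j 1)
  have hsub := Q.2.dotProduct_mulVec_nonneg (Pi.single i 1 - Pi.single j 1)
  simp only [star_trivial, Matrix.mulVec_add, Matrix.mulVec_sub, add_dotProduct, sub_dotProduct,
    dotProduct_add, dotProduct_sub, single_dotProduct, Matrix.mulVec_single, Matrix.col_apply,
    MulOpposite.op_one, one_smul, one_mul, hsymm] at hadd hsub
  rw [abs_le]
  constructor <;> linarith [hle i, hle j]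

theorem continuous_trace : Continuous fun Q : PSDCone ι => Q.1.trace := by
  fun_prop

theorem isCompact_trace_le (r : ℝ) : IsCompact {Q : PSDCone ι | Q.1.trace ≤ r} := by
  have hbox : IsCompact (X := Matrix ι ι ℝ)
      (Set.univ.pi fun _ => Set.univ.pi fun _ => Set.Icc (-r) r) :=
    isCompact_univ_pi (X := fun _ : ι => ι → ℝ) fun _ => isCompact_univ_pi fun _ => isCompact_Icc
  have hcompact := isClosed_setOf_posSemidef.isClosedEmbedding_subtypeVal.isCompact_preimage hbox
  exact hcompact.of_isClosed_subset (isClosed_le continuous_trace continuous_const)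
    fun Q hQ i _ j _ => abs_le.1 ((abs_apply_le_trace Q i j).trans hQ)

variable [DecidableEq ι]

open scoped MatrixOrder in
/-- The square root of a positive semidefinite matrix, as an operator on Euclidean space. It maps
the standard Gaussian law to the centred Gaussian law with the given covariance matrix. -/
def sqrtCLM (Q : PSDCone ι) : EuclideanSpace ℝ ι →L[ℝ] EuclideanSpace ℝ ι :=
  Matrix.toEuclideanCLM (𝕜 := ℝ) (CFC.sqrt Q.1)

theorem multivariateGaussian_eq_map (Q : PSDCone ι) :
    multivariateGaussian 0 Q.1 = (stdGaussian (EuclideanSpace ℝ ι)).map (sqrtCLM Q) := by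
  simp [multivariateGaussian, sqrtCLM]

open scoped Matrix.Norms.L2Operator MatrixOrder in
theorem continuous_sqrtCLM : Continuous (sqrtCLM (ι := ι)) :=
  (LinearMap.continuous_of_finiteDimensional
    (Matrix.toEuclideanCLM (n := ι) (𝕜 := ℝ)).toAlgEquiv.toLinearMap).comp
    (CFC.continuousOn_sqrt.comp_continuous continuous_subtype_val fun Q => Q.2.nonneg)

theorem continuous_sqrtCLM_apply (ξ : EuclideanSpace ℝ ι) :
    Continuous fun Q : PSDCone ι => Q.sqrtCLM ξ :=
  continuous_sqrtCLM.clm_apply continuous_const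

theorem exists_norm_sqrtCLM_le (r : ℝ) :
    ∃ B : ℝ, ∀ Q : PSDCone ι, Q.1.trace ≤ r → ‖sqrtCLM Q‖ ≤ B := by
  obtain ⟨B, hB⟩ := ((isCompact_trace_le (ι := ι) r).image continuous_sqrtCLM.norm).bddAbove
  exact ⟨B, fun Q hQ => hB (Set.mem_image_of_mem _ hQ)⟩

end PSDCone

section NearLipschitz

variable {E F H : Type*} [NormedAddCommGroup E] [NormedAddCommGroup F] [NormedAddCommGroup H]

/-- `f` is Lipschitz up to an error of sublinear growth. The error is encoded as
`ε * (‖z‖ + ‖z'‖) + C` with arbitrarily small `ε`, which is stable under composition. -/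
def NearLipschitz (f : E → F) : Prop :=
  ∃ L : ℝ≥0, ∀ ε > 0, ∃ C : ℝ, ∀ z z' : E,
    ‖f z - f z'‖ ≤ L * ‖z - z'‖ + ε * (‖z‖ + ‖z'‖) + C

/-- `f` is continuous and has the local Lipschitz behaviour of a quadratic function, up to an error
of subquadratic growth, encoded as in `NearLipschitz`. -/
structure NearQuadratic (f : E → ℝ) : Prop where
  continuous : Continuous f
  exists_abs_sub_le : ∃ L : ℝ≥0, ∀ ε > 0, ∃ C : ℝ, ∀ z z' : E,
    |f z - f z'| ≤ L * ‖z - z'‖ * (‖z‖ + ‖z'‖) + ε * (‖z‖ + ‖z'‖) ^ 2 + C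

namespace NearLipschitz

theorem exists_forall_exists_mem_norm_sub_le [ProperSpace E] {f : E → F} (hf : Continuous f)
    {G : Set E} (hG : G ∈ Bornology.cobounded E) (hne : G.Nonempty) :
    ∃ D ≥ 0, ∀ z, ∃ w ∈ G, ‖f z - f w‖ ≤ D ∧ ‖z - w‖ ≤ D := by
  obtain ⟨w₀, hw₀⟩ := hne
  have hbdd : Bornology.IsBounded Gᶜ := Bornology.isBounded_def.2 (by rwa [compl_compl])
  obtain ⟨M, hM⟩ := (hbdd.isCompact_closure.image (f := fun z => max ‖f z - f w₀‖ ‖z - w₀‖)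
    (by fun_prop)).bddAbove
  refine ⟨max 0 M, le_max_left _ _, fun z => ?_⟩
  by_cases hz : z ∈ G
  · exact ⟨z, hz, by simp, by simp⟩
  · have hzM := (hM (Set.mem_image_of_mem _ (subset_closure hz))).trans (le_max_right 0 M)
    exact ⟨w₀, hw₀, (le_max_left _ _).trans hzM, (le_max_right _ _).trans hzM⟩

/- A point where `ρ ≤ ε * ‖·‖ + |ρ 0|` fails is replaced by one at bounded distance where it
holds. -/
theorem of_isLittleO [ProperSpace E] {f : E → F} (hf : Continuous f) {L : ℝ≥0}
    {ρ : E → ℝ} (hρ : ρ =o[Bornology.cobounded E] fun z => ‖z‖)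
    (h : ∀ z z', ‖f z - f z'‖ ≤ L * ‖z - z'‖ + ρ z + ρ z') : NearLipschitz f := by
  refine ⟨L, fun ε hε => ?_⟩
  have hgood : {z | ρ z ≤ ε * ‖z‖ + |ρ 0|} ∈ Bornology.cobounded E := by
    filter_upwards [hρ.bound hε] with z hz
    rw [norm_norm] at hz
    exact (le_abs_self _).trans (hz.trans (le_add_of_nonneg_right (abs_nonneg _)))
  obtain ⟨D, _, hproj⟩ :=
    exists_forall_exists_mem_norm_sub_le hf hgood ⟨0, by simpa using le_abs_self (ρ 0)⟩
  refine ⟨2 * D + L * (2 * D) + ε * (2 * D) + 2 * |ρ 0|, fun z z' => ?_⟩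
  obtain ⟨w, hw, hfw, hzw⟩ := hproj z
  obtain ⟨w', hw', hfw', hzw'⟩ := hproj z'
  have hnorm : ‖w‖ ≤ ‖z‖ + D := by linarith [norm_le_norm_add_norm_sub z w]
  have hnorm' : ‖w'‖ ≤ ‖z'‖ + D := by linarith [norm_le_norm_add_norm_sub z' w']
  have hdist : ‖w - w'‖ ≤ ‖z - z'‖ + 2 * D := by
    have := norm_add₃_le (a := w - z) (b := z - z') (c := z' - w')
    rw [show w - z + (z - z') + (z' - w') = w - w' by abel, norm_sub_rev w z] at this
    linarith
  calc ‖f z - f z'‖ = ‖(f z - f w) + (f w - f w') - (f z' - f w')‖ := by congr 1; abel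
    _ ≤ ‖f z - f w‖ + ‖f w - f w'‖ + ‖f z' - f w'‖ :=
      (norm_sub_le _ _).trans (by gcongr; exact norm_add_le _ _)
    _ ≤ D + (L * (‖z - z'‖ + 2 * D) + (ε * (‖z‖ + D) + |ρ 0|) +
          (ε * (‖z'‖ + D) + |ρ 0|)) + D := by
      gcongr
      exact (h w w').trans (by gcongr; exacts [hw.trans (by gcongr), hw'.trans (by gcongr)])
    _ = _ := by ring

theorem exists_norm_le {f : E → F} (hf : NearLipschitz f) :
    ∃ K : ℝ≥0, ∀ z, ‖f z‖ ≤ K * (1 + ‖z‖) := by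
  obtain ⟨L, h⟩ := hf
  obtain ⟨C, h⟩ := h 1 one_pos
  lift C to ℝ≥0 using by simpa using h 0 0
  refine ⟨L + 1 + C + ‖f 0‖₊, fun z => ?_⟩
  have hz := h z 0
  rw [sub_zero, norm_zero, add_zero] at hz
  have : 0 ≤ (C + ‖f 0‖) * ‖z‖ := by positivity
  push_cast
  linarith [norm_le_norm_add_norm_sub (f 0) (f z), norm_sub_rev (f 0) (f z), L.2]

theorem comp {g : F → H} {f : E → F} (hg : NearLipschitz g) (hf : NearLipschitz f) :
    NearLipschitz (g ∘ f) := by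
  obtain ⟨K, hK⟩ := hf.exists_norm_le
  obtain ⟨L₁, hg⟩ := hg
  obtain ⟨L₂, hf⟩ := hf
  refine ⟨L₁ * L₂, fun ε hε => ?_⟩
  obtain ⟨η, hη, hηε⟩ := exists_pos_mul_lt hε (L₁ + K : ℝ)
  obtain ⟨C₁, h₁⟩ := hg η hη
  obtain ⟨C₂, h₂⟩ := hf η hη
  refine ⟨L₁ * C₂ + 2 * (K * η) + C₁, fun z z' => ?_⟩
  calc ‖g (f z) - g (f z')‖
      ≤ L₁ * ‖f z - f z'‖ + η * (‖f z‖ + ‖f z'‖) + C₁ := h₁ _ _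
    _ ≤ L₁ * (L₂ * ‖z - z'‖ + η * (‖z‖ + ‖z'‖) + C₂) +
          η * (K * (1 + ‖z‖) + K * (1 + ‖z'‖)) + C₁ := by
      gcongr
      exacts [h₂ z z', hK z, hK z']
    _ = L₁ * L₂ * ‖z - z'‖ + (L₁ + K) * η * (‖z‖ + ‖z'‖) +
          (L₁ * C₂ + 2 * (K * η) + C₁) := by ring
    _ ≤ _ := by push_cast; gcongr

theorem of_clm [NormedSpace ℝ E] [NormedSpace ℝ F] (T : E →L[ℝ] F) : NearLipschitz T := by
  refine ⟨‖T‖₊, fun ε hε => ⟨0, fun z z' => ?_⟩⟩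
  have : 0 ≤ ε * (‖z‖ + ‖z'‖) := by positivity
  rw [← map_sub, coe_nnnorm]
  linarith [T.le_opNorm (z - z')]

end NearLipschitz

namespace NearQuadratic

variable {f g : E → ℝ}

theorem of_forall_abs_sub_le (hf : Continuous f) {L : ℝ≥0} {A : ℝ}
    (h : ∀ ε > 0, ∃ B C : ℝ, ∀ z z' : E, |f z - f z'| ≤
      L * ‖z - z'‖ * (‖z‖ + ‖z'‖) + A * ε * (‖z‖ + ‖z'‖) ^ 2 + B * (‖z‖ + ‖z'‖) + C) :
    NearQuadratic f := by
  refine ⟨hf, L, fun ε hε => ?_⟩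
  obtain ⟨η, hη, hηε⟩ := exists_pos_mul_lt hε (A + 1)
  obtain ⟨B, C, h⟩ := h η hη
  refine ⟨B ^ 2 / (4 * η) + C, fun z z' => (h z z').trans ?_⟩
  set s := ‖z‖ + ‖z'‖
  have hyoung : B * s ≤ η * s ^ 2 + B ^ 2 / (4 * η) := by
    have : η * s ^ 2 + B ^ 2 / (4 * η) - B * s = (2 * η * s - B) ^ 2 / (4 * η) := by
      field_simp; ring
    rw [← sub_nonneg, this]
    positivity
  linarith [mul_le_mul_of_nonneg_right hηε.le (sq_nonneg s)]

theorem zero : NearQuadratic fun _ : E => (0 : ℝ) where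
  continuous := continuous_const
  exists_abs_sub_le := ⟨0, fun ε hε => ⟨0, fun z z' => by
    simp only [sub_self, abs_zero]; positivity⟩⟩

theorem add (hf : NearQuadratic f) (hg : NearQuadratic g) : NearQuadratic fun z => f z + g z where
  continuous := hf.continuous.add hg.continuous
  exists_abs_sub_le := by
    obtain ⟨L₁, h₁⟩ := hf.exists_abs_sub_le
    obtain ⟨L₂, h₂⟩ := hg.exists_abs_sub_le
    refine ⟨L₁ + L₂, fun ε hε => ?_⟩
    obtain ⟨C₁, h₁⟩ := h₁ (ε / 2) (half_pos hε)
    obtain ⟨C₂, h₂⟩ := h₂ (ε / 2) (half_pos hε)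
    refine ⟨C₁ + C₂, fun z z' => ?_⟩
    rw [add_sub_add_comm]
    push_cast
    linarith [abs_add_le (f z - f z') (g z - g z'), h₁ z z', h₂ z z']

theorem const_mul (hf : NearQuadratic f) (c : ℝ) : NearQuadratic fun z => c * f z where
  continuous := hf.continuous.const_mul c
  exists_abs_sub_le := by
    obtain ⟨L, h⟩ := hf.exists_abs_sub_le
    refine ⟨‖c‖₊ * L, fun ε hε => ?_⟩
    obtain ⟨η, hη, hηε⟩ := exists_pos_mul_lt hε |c|
    obtain ⟨C, h⟩ := h η hη
    refine ⟨|c| * C, fun z z' => ?_⟩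
    calc |c * f z - c * f z'| = |c| * |f z - f z'| := by rw [← mul_sub, abs_mul]
      _ ≤ |c| * (L * ‖z - z'‖ * (‖z‖ + ‖z'‖) + η * (‖z‖ + ‖z'‖) ^ 2 + C) := by
        gcongr; exact h z z'
      _ = |c| * L * ‖z - z'‖ * (‖z‖ + ‖z'‖) + |c| * η * (‖z‖ + ‖z'‖) ^ 2 + |c| * C := by ring
      _ ≤ _ := by rw [NNReal.coe_mul, coe_nnnorm, Real.norm_eq_abs]; gcongr

theorem sum {ι : Type*} (s : Finset ι) {f : ι → E → ℝ} (hf : ∀ i ∈ s, NearQuadratic (f i)) :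
    NearQuadratic fun z => ∑ i ∈ s, f i z := by
  classical
  induction s using Finset.induction_on with
  | empty => simpa using zero
  | insert a s ha ih =>
    simp_rw [Finset.sum_insert ha]
    exact (hf a (Finset.mem_insert_self a s)).add
      (ih fun i hi => hf i (Finset.mem_insert_of_mem hi))

theorem exists_le (hf : NearQuadratic f) : ∃ K : ℝ≥0, ∀ z, f z ≤ K * (1 + ‖z‖ ^ 2) := by
  obtain ⟨L, h⟩ := hf.exists_abs_sub_le
  obtain ⟨C, h⟩ := h 1 one_pos
  lift C to ℝ≥0 using by simpa using h 0 0
  refine ⟨L + 1 + C + ‖f 0‖₊, fun z => ?_⟩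
  have hz := h z 0
  rw [sub_zero, norm_zero, add_zero] at hz
  have : 0 ≤ (C + ‖f 0‖) * ‖z‖ ^ 2 := by positivity
  push_cast
  linarith [le_abs_self (f z - f 0), Real.le_norm_self (f 0), L.2]

theorem _root_.NearLipschitz.nearQuadratic_mul (hf : NearLipschitz f) (hg : NearLipschitz g)
    (hfc : Continuous f) (hgc : Continuous g) : NearQuadratic fun z => f z * g z := by
  obtain ⟨K₁, hK₁⟩ := hf.exists_norm_le
  obtain ⟨K₂, hK₂⟩ := hg.exists_norm_le
  obtain ⟨L₁, hf⟩ := hf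
  obtain ⟨L₂, hg⟩ := hg
  refine of_forall_abs_sub_le (hfc.mul hgc) (L := L₁ * K₂ + K₁ * L₂) (A := K₁ + K₂)
    fun ε hε => ?_
  obtain ⟨C₁, h₁⟩ := hf ε hε
  obtain ⟨C₂, h₂⟩ := hg ε hε
  have : 0 ≤ C₁ := by simpa using h₁ 0 0
  refine ⟨(L₁ * K₂ + K₁ * L₂) + (K₁ + K₂) * ε + (K₁ * C₂ + K₂ * C₁), K₁ * C₂ + K₂ * C₁,
    fun z z' => ?_⟩
  push_cast
  set s := ‖z‖ + ‖z'‖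
  have hz : ‖z‖ ≤ s := le_add_of_nonneg_right (norm_nonneg z')
  have hz' : ‖z'‖ ≤ s := le_add_of_nonneg_left (norm_nonneg z)
  have hlin : (L₁ * K₂ + K₁ * L₂) * ‖z - z'‖ ≤ (L₁ * K₂ + K₁ * L₂) * s := by
    gcongr; exact norm_sub_le z z'
  calc |f z * g z - f z' * g z'|
      = |(f z - f z') * g z + f z' * (g z - g z')| := by ring_nf
    _ ≤ |f z - f z'| * |g z| + |f z'| * |g z - g z'| := by
      rw [← abs_mul, ← abs_mul]; exact abs_add_le _ _
    _ ≤ (L₁ * ‖z - z'‖ + ε * s + C₁) * (K₂ * (1 + s)) +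
          (K₁ * (1 + s)) * (L₂ * ‖z - z'‖ + ε * s + C₂) := by
      gcongr
      exacts [h₁ z z', (hK₂ z).trans (by gcongr), (hK₁ z').trans (by gcongr), h₂ z z']
    _ ≤ _ := by linarith

end NearQuadratic

end NearLipschitz

theorem exp_add_le_of_holderConjugate {p q : ℝ} (hpq : p.HolderConjugate q) (a b : ℝ) :
    Real.exp (a + b) ≤ Real.exp (p * a) + Real.exp (q * b) := by
  calc Real.exp (a + b) = Real.exp a * Real.exp b := Real.exp_add a b
    _ ≤ Real.exp a ^ p / p + Real.exp b ^ q / q :=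
      Real.young_inequality_of_nonneg (Real.exp_pos a).le (Real.exp_pos b).le hpq
    _ ≤ Real.exp a ^ p + Real.exp b ^ q := by
      gcongr
      exacts [div_le_self (by positivity) hpq.lt.le, div_le_self (by positivity) hpq.symm.lt.le]
    _ = Real.exp (p * a) + Real.exp (q * b) := by
      rw [← Real.exp_mul, ← Real.exp_mul, mul_comm a, mul_comm b]

section GaussMGF

variable {ι : Type} [Fintype ι] [DecidableEq ι] {f : EuclideanSpace ℝ ι → ℝ}

/-- The exponential moment of `f` under the centred Gaussian law with covariance matrix `q`,
possibly infinite. -/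
def gaussMGF (f : EuclideanSpace ℝ ι → ℝ) (q : PSDCone ι) : ℝ≥0∞ :=
  ∫⁻ z, ENNReal.ofReal (Real.exp (f z)) ∂(multivariateGaussian 0 q.1)

theorem gaussMGF_eq (hf : Continuous f) (q : PSDCone ι) :
    gaussMGF f q = ∫⁻ ξ, ENNReal.ofReal (Real.exp (f (q.sqrtCLM ξ)))
      ∂(stdGaussian (EuclideanSpace ℝ ι)) := by
  rw [gaussMGF, PSDCone.multivariateGaussian_eq_map, lintegral_map (by fun_prop) (by fun_prop)]

theorem gaussMGF_zero (q : PSDCone ι) : gaussMGF (fun _ => 0) q = 1 := by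
  simp [gaussMGF]

theorem gaussMGF_ne_zero (hf : Continuous f) (q : PSDCone ι) : gaussMGF f q ≠ 0 := by
  rw [gaussMGF, Ne, lintegral_eq_zero_iff (by fun_prop)]
  intro h
  obtain ⟨z, hz⟩ := h.exists
  exact (ENNReal.ofReal_pos.2 (Real.exp_pos (f z))).ne' hz

theorem gaussMGF_const_mul_le_rpow (hf : Continuous f) (q : PSDCone ι) {s : ℝ} (hs : 0 < s)
    (hs1 : s ≤ 1) : gaussMGF (fun z => s * f z) q ≤ gaussMGF f q ^ s := by
  have h := eLpNorm'_le_eLpNorm'_of_exponent_le hs hs1 (multivariateGaussian 0 q.1)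
    (f := fun z => Real.exp (f z)) (by fun_prop)
  have hexp (z : EuclideanSpace ℝ ι) : ENNReal.ofReal (Real.exp (f z)) ^ s =
      ENNReal.ofReal (Real.exp (s * f z)) := by
    rw [ENNReal.ofReal_rpow_of_pos (Real.exp_pos _), ← Real.exp_mul, mul_comm]
  simp only [eLpNorm', ENNReal.rpow_one, div_one, Real.enorm_of_nonneg (Real.exp_pos _).le,
    hexp] at h
  simpa only [gaussMGF, one_div, ENNReal.rpow_inv_rpow hs.ne'] using
    ENNReal.rpow_le_rpow h hs.le

theorem NearQuadratic.exists_abs_comp_sqrtCLM_sub_le (hf : NearQuadratic f) (q₁ : PSDCone ι)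
    {δ : ℝ} (hδ : 0 < δ) :
    ∃ C : ℝ, ∀ᶠ q in 𝓝 q₁, ∀ ξ : EuclideanSpace ℝ ι,
      |f (q.sqrtCLM ξ) - f (q₁.sqrtCLM ξ)| ≤ δ * ‖ξ‖ ^ 2 + C := by
  obtain ⟨L, h⟩ := hf.exists_abs_sub_le
  set B := ‖q₁.sqrtCLM‖ + 1
  obtain ⟨η, hη, hηδ⟩ := exists_pos_mul_lt (half_pos hδ) (L * (2 * B))
  obtain ⟨ε, hε, hεδ⟩ := exists_pos_mul_lt (half_pos hδ) ((2 * B) ^ 2)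
  obtain ⟨C, h⟩ := h ε hε
  have hcont := (PSDCone.continuous_sqrtCLM (ι := ι)).tendsto q₁
  refine ⟨C, ?_⟩
  filter_upwards [hcont.eventually (Metric.ball_mem_nhds _ hη),
    hcont.norm.eventually_lt_const (lt_add_one ‖q₁.sqrtCLM‖)] with q hq hqB ξ
  have hdist : ‖q.sqrtCLM ξ - q₁.sqrtCLM ξ‖ ≤ η * ‖ξ‖ :=
    ((q.sqrtCLM - q₁.sqrtCLM).le_opNorm ξ).trans (by gcongr; exact (mem_ball_iff_norm.1 hq).le)
  have hnorm : ‖q.sqrtCLM ξ‖ + ‖q₁.sqrtCLM ξ‖ ≤ 2 * B * ‖ξ‖ := by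
    have hle : ‖q.sqrtCLM ξ‖ ≤ B * ‖ξ‖ := (q.sqrtCLM.le_opNorm ξ).trans (by gcongr)
    have hle₁ : ‖q₁.sqrtCLM ξ‖ ≤ B * ‖ξ‖ :=
      (q₁.sqrtCLM.le_opNorm ξ).trans (by gcongr; exact (lt_add_one _).le)
    linarith
  calc |f (q.sqrtCLM ξ) - f (q₁.sqrtCLM ξ)|
      ≤ L * (η * ‖ξ‖) * (2 * B * ‖ξ‖) + ε * (2 * B * ‖ξ‖) ^ 2 + C :=
        (h _ _).trans (by gcongr)
    _ = (L * (2 * B) * η + (2 * B) ^ 2 * ε) * ‖ξ‖ ^ 2 + C := by ring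
    _ ≤ δ * ‖ξ‖ ^ 2 + C := by gcongr; linarith

theorem tendsto_gaussMGF (hf : NearQuadratic f) (q₁ : PSDCone ι) {p : ℝ} (hp : 1 < p)
    (hfin : gaussMGF (fun z => p * f z) q₁ ≠ ∞) :
    Tendsto (gaussMGF f) (𝓝 q₁) (𝓝 (gaussMGF f q₁)) := by
  have hfc := hf.continuous
  have hpq := Real.HolderConjugate.conjExponent hp
  obtain ⟨c, hc, hcint⟩ := IsGaussian.exists_integrable_exp_sq (stdGaussian (EuclideanSpace ℝ ι))
  obtain ⟨δ, hδ, hδc⟩ := exists_pos_mul_lt hc p.conjExponent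
  obtain ⟨C, hev⟩ := hf.exists_abs_comp_sqrtCLM_sub_le q₁ hδ
  simp_rw [funext fun q => gaussMGF_eq hfc q]
  refine tendsto_lintegral_filter_of_dominated_convergence
    (fun ξ => ENNReal.ofReal (Real.exp (p * f (q₁.sqrtCLM ξ))) +
      ENNReal.ofReal (Real.exp (p.conjExponent * C)) * ENNReal.ofReal (Real.exp (c * ‖ξ‖ ^ 2)))
    (Eventually.of_forall fun q => by fun_prop) ?_ ?_ (ae_of_all _ fun ξ => ?_)
  · filter_upwards [hev] with q hq
    refine ae_of_all _ fun ξ => ?_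
    rw [← ENNReal.ofReal_mul (Real.exp_pos _).le, ← Real.exp_add,
      ← ENNReal.ofReal_add (Real.exp_pos _).le (Real.exp_pos _).le]
    refine ENNReal.ofReal_le_ofReal ?_
    calc Real.exp (f (q.sqrtCLM ξ))
        = Real.exp (f (q₁.sqrtCLM ξ) + (f (q.sqrtCLM ξ) - f (q₁.sqrtCLM ξ))) := by
          rw [add_sub_cancel]
      _ ≤ _ := exp_add_le_of_holderConjugate hpq _ _
      _ ≤ _ := by
        gcongr
        have := mul_le_mul_of_nonneg_left (abs_le.1 (hq ξ)).2 hpq.symm.nonneg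
        linarith [mul_le_mul_of_nonneg_right hδc.le (sq_nonneg ‖ξ‖)]
  · rw [lintegral_add_left (by fun_prop), lintegral_const_mul _ (by fun_prop)]
    rw [gaussMGF_eq (by fun_prop)] at hfin
    exact ENNReal.add_ne_top.2
      ⟨hfin, ENNReal.mul_ne_top ENNReal.ofReal_ne_top hcint.lintegral_lt_top.ne⟩
  · have hcont : Continuous fun q : PSDCone ι => ENNReal.ofReal (Real.exp (f (q.sqrtCLM ξ))) :=
      ENNReal.continuous_ofReal.comp
        (Real.continuous_exp.comp (hfc.comp (PSDCone.continuous_sqrtCLM_apply ξ)))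
    exact hcont.tendsto q₁

/- Shrinking `f` to `s * f` with `s < 1` makes the exponential moment continuous at `q₁`, by
`tendsto_gaussMGF` with `p = s⁻¹`. -/
theorem exists_eventually_gaussMGF_const_mul_le (hf : NearQuadratic f) (q₁ : PSDCone ι)
    {a y Λ : ℝ} (hΛ : gaussMGF f q₁ ≤ ENNReal.ofReal (Real.exp Λ)) (ha : a < y - Λ) :
    ∃ s c : ℝ, (∀ᶠ q in 𝓝 q₁, gaussMGF (fun z => s * f z) q ≤ ENNReal.ofReal (Real.exp c)) ∧
      a < s * y - c := by
  have hlim : Tendsto (fun s : ℝ => s * (y - Λ)) (𝓝[<] 1) (𝓝 (y - Λ)) := by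
    simpa using (tendsto_id.mul_const (y - Λ) : Tendsto _ (𝓝 (1 : ℝ)) _).mono_left
      nhdsWithin_le_nhds
  obtain ⟨s, hs, hs0, hs1⟩ :=
    ((hlim.eventually_const_lt ha).and (Ioo_mem_nhdsLT one_pos)).exists
  obtain ⟨c, hΛc, hcy⟩ := exists_between (show s * Λ < s * y - a by linarith)
  refine ⟨s, c, ?_, by linarith⟩
  have hfin : gaussMGF (fun z => s⁻¹ * (s * f z)) q₁ ≠ ∞ := by
    simp_rw [inv_mul_cancel_left₀ hs0.ne']
    exact (hΛ.trans_lt ENNReal.ofReal_lt_top).ne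
  have hlt : gaussMGF (fun z => s * f z) q₁ < ENNReal.ofReal (Real.exp c) :=
    calc gaussMGF (fun z => s * f z) q₁ ≤ gaussMGF f q₁ ^ s :=
          gaussMGF_const_mul_le_rpow hf.continuous q₁ hs0 hs1.le
      _ ≤ ENNReal.ofReal (Real.exp Λ) ^ s := ENNReal.rpow_le_rpow hΛ hs0.le
      _ = ENNReal.ofReal (Real.exp (s * Λ)) := by
        rw [ENNReal.ofReal_rpow_of_pos (Real.exp_pos _), ← Real.exp_mul, mul_comm]
      _ < _ := (ENNReal.ofReal_lt_ofReal_iff (Real.exp_pos _)).2 (Real.exp_lt_exp.2 hΛc)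
  exact ((tendsto_gaussMGF (hf.const_mul s) q₁ ((one_lt_inv₀ hs0).2 hs1) hfin).eventually_lt_const
    hlt).mono fun q hq => hq.le

theorem exists_gaussMGF_le_of_trace_le (hf : NearQuadratic f) (r : ℝ) :
    ∃ t > 0, ∃ C : ℝ, ∀ q : PSDCone ι, q.1.trace ≤ r →
      gaussMGF (fun z => t * f z) q ≤ ENNReal.ofReal (Real.exp C) := by
  have hfc := hf.continuous
  obtain ⟨c, hc, hcint⟩ := IsGaussian.exists_integrable_exp_sq (stdGaussian (EuclideanSpace ℝ ι))
  obtain ⟨B, hB⟩ := PSDCone.exists_norm_sqrtCLM_le (ι := ι) r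
  obtain ⟨K, hK⟩ := hf.exists_le
  obtain ⟨t, ht, htc⟩ := exists_pos_mul_lt hc (K * B ^ 2)
  refine ⟨t, ht, t * K + Real.log (∫ ξ : EuclideanSpace ℝ ι, Real.exp (c * ‖ξ‖ ^ 2)
    ∂stdGaussian (EuclideanSpace ℝ ι)), fun q hq => ?_⟩
  rw [gaussMGF_eq (by fun_prop), Real.exp_add, Real.exp_log (integral_exp_pos hcint),
    ENNReal.ofReal_mul (Real.exp_pos _).le, ofReal_integral_eq_lintegral_ofReal hcint
      (ae_of_all _ fun ξ => (Real.exp_pos _).le), ← lintegral_const_mul _ (by fun_prop)]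
  refine lintegral_mono fun ξ => ?_
  rw [← ENNReal.ofReal_mul (Real.exp_pos _).le, ← Real.exp_add]
  refine ENNReal.ofReal_le_ofReal (Real.exp_le_exp.2 ?_)
  have hnorm : ‖q.sqrtCLM ξ‖ ≤ B * ‖ξ‖ :=
    (q.sqrtCLM.le_opNorm ξ).trans (by gcongr; exact hB q hq)
  calc t * f (q.sqrtCLM ξ) ≤ t * (K * (1 + (B * ‖ξ‖) ^ 2)) := by
        gcongr; exact (hK _).trans (by gcongr)
    _ = t * K + K * B ^ 2 * t * ‖ξ‖ ^ 2 := by ring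
    _ ≤ t * K + c * ‖ξ‖ ^ 2 := by gcongr

end GaussMGF

section TracePairing

variable {J : Type*} [Fintype J]

theorem trace_transpose_mul_eq_sum (θ Q : Matrix J J ℝ) :
    (θ.transpose * Q).trace = ∑ p, ∑ q, θ p q * Q p q := by
  simp only [Matrix.trace, Matrix.diag_apply, Matrix.mul_apply, Matrix.transpose_apply]
  exact Finset.sum_comm

theorem trace_smul_one_transpose_mul [DecidableEq J] (t : ℝ) (Q : Matrix J J ℝ) :
    ((t • (1 : Matrix J J ℝ)).transpose * Q).trace = t * Q.trace := by
  simp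

theorem trace_symmPart_transpose_mul (θ : Matrix J J ℝ) {Q : Matrix J J ℝ} (hQ : Q.IsSymm) :
    (((2 : ℝ)⁻¹ • (θ + θ.transpose)).transpose * Q).trace = (θ.transpose * Q).trace := by
  have h : (θ * Q).trace = (θ.transpose * Q).trace := by
    rw [← Matrix.trace_transpose, Matrix.transpose_mul, hQ.eq, Matrix.trace_mul_comm]
  rw [Matrix.transpose_smul, Matrix.transpose_add, Matrix.transpose_transpose, Matrix.smul_mul,
    Matrix.add_mul, Matrix.trace_smul, Matrix.trace_add, h, smul_eq_mul]
  ring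

end TracePairing

theorem log_ofReal_exp (c : ℝ) : ENNReal.log (ENNReal.ofReal (Real.exp c)) = (c : EReal) := by
  rw [ENNReal.log_ofReal_of_pos (Real.exp_pos _), Real.log_exp]

theorem exists_eq_ofReal_exp {M : ℝ≥0∞} (h0 : M ≠ 0) (h1 : M ≠ ∞) :
    ∃ Λ : ℝ, M = ENNReal.ofReal (Real.exp Λ) :=
  ⟨Real.log M.toReal, by rw [Real.exp_log (ENNReal.toReal_pos h0 h1), ENNReal.ofReal_toReal h1]⟩

theorem AsympLipschitzActivation.nearLipschitz {σ : ℝ → ℝ} (hσ : AsympLipschitzActivation σ) :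
    NearLipschitz σ := by
  obtain ⟨hc, L, ρ, hL, -, hρ, h⟩ := hσ
  lift L to ℝ≥0 using hL
  exact NearLipschitz.of_isLittleO hc hρ h

theorem AsympLipschitzMap.nearLipschitz {ι κ : Type} [Fintype ι] [Fintype κ]
    {f : (ι → ℝ) → (κ → ℝ)} (hf : AsympLipschitzMap f) :
    NearLipschitz fun z : EuclideanSpace ℝ ι =>
      (WithLp.toLp 2 (f z.ofLp) : EuclideanSpace ℝ κ) := by
  obtain ⟨hc, L, ρ, hL, hρ, h⟩ := hf
  lift L to ℝ≥0 using hL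
  have hcob : Tendsto (fun z : EuclideanSpace ℝ ι => z.ofLp) (Bornology.cobounded _)
      (Bornology.cobounded (ι → ℝ)) :=
    (PiLp.antilipschitzWith_ofLp 2 fun _ : ι => ℝ).tendsto_cobounded
  exact NearLipschitz.of_isLittleO (by fun_prop) (hρ.comp_tendsto hcob) fun z z' =>
    h z.ofLp z'.ofLp

namespace ConvNet

variable (A : ConvNet) {ℓ : ℕ}

/-- The component of `G^{(ℓ)}` dual to the matrix `θ`. The large deviations of `G^{(ℓ)}` are
governed by the exponential moments of these functions. -/
def dualG (ℓ : ℕ) (θ : Matrix (A.Idx (ℓ + 1)) (A.Idx (ℓ + 1)) ℝ)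
    (z : EuclideanSpace ℝ (A.Idx ℓ)) : ℝ :=
  (θ.transpose * A.G ℓ z.ofLp).trace

/-- The regularity of layer `ℓ` on which the large deviation estimates are based. -/
structure IsRegularLayer (ℓ : ℕ) : Prop where
  continuous_feature (p : A.Idx (ℓ + 1)) (m : A.Mask ℓ) :
    Continuous fun z : A.Idx ℓ → ℝ => A.σ (A.R ℓ p.1 (fun i => z (i, p.2)) m)
  nearQuadratic_dualG θ : NearQuadratic (A.dualG ℓ θ)

/-- The layers `1, …, L`, to which the conditional large deviation estimates are applied, are
regular. -/
def IsRegular : Prop := ∀ j < A.L, A.IsRegularLayer (j + 1)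

variable {A}

theorem IsRegularLayer.continuous_G (hA : A.IsRegularLayer ℓ) : Continuous (A.G ℓ) :=
  continuous_matrix fun p q => continuous_const.mul <| continuous_finsetSum _ fun m _ =>
    (hA.continuous_feature p m).mul (hA.continuous_feature q m)

theorem dualG_smul (s : ℝ) (θ : Matrix (A.Idx (ℓ + 1)) (A.Idx (ℓ + 1)) ℝ) :
    A.dualG ℓ (s • θ) = fun z => s * A.dualG ℓ θ z := by
  ext z
  simp [dualG]

section Regularity

variable (hσ : AsympLipschitzActivation A.σ)
  (hR : ∀ i : Fin (A.N (ℓ + 1)), AsympLipschitzMap (A.R ℓ i))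

include hσ hR

theorem continuous_feature (p : A.Idx (ℓ + 1)) (m : A.Mask ℓ) :
    Continuous fun z : A.Idx ℓ → ℝ => A.σ (A.R ℓ p.1 (fun i => z (i, p.2)) m) :=
  hσ.1.comp ((continuous_apply m).comp ((hR p.1).1.comp (by fun_prop)))

theorem nearLipschitz_feature (p : A.Idx (ℓ + 1)) (m : A.Mask ℓ) :
    NearLipschitz fun z : EuclideanSpace ℝ (A.Idx ℓ) =>
      A.σ (A.R ℓ p.1 (fun i => z.ofLp (i, p.2)) m) := by
  let T : EuclideanSpace ℝ (A.Idx ℓ) →ₗ[ℝ] EuclideanSpace ℝ (Fin (A.N ℓ)) :=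
    { toFun := fun z => WithLp.toLp 2 fun i => z.ofLp (i, p.2)
      map_add' := fun _ _ => rfl
      map_smul' := fun _ _ => rfl }
  exact hσ.nearLipschitz.comp
    (((NearLipschitz.of_clm (EuclideanSpace.proj m : EuclideanSpace ℝ (A.Mask ℓ) →L[ℝ] ℝ)).comp
      (hR p.1).nearLipschitz).comp
      (NearLipschitz.of_clm (LinearMap.toContinuousLinearMap T)))

theorem isRegularLayer : A.IsRegularLayer ℓ where
  continuous_feature := continuous_feature hσ hR
  nearQuadratic_dualG θ := by
    have hfeature (p : A.Idx (ℓ + 1)) (m : A.Mask ℓ) :=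
      (continuous_feature hσ hR p m).comp (PiLp.continuous_ofLp 2 _)
    have h := NearQuadratic.sum Finset.univ fun p _ => NearQuadratic.sum Finset.univ fun q _ =>
      NearQuadratic.const_mul (NearQuadratic.const_mul (NearQuadratic.sum Finset.univ fun m _ =>
        (nearLipschitz_feature hσ hR p m).nearQuadratic_mul (nearLipschitz_feature hσ hR q m)
          (hfeature p m) (hfeature q m))
        (1 / ((A.prec ℓ : ℝ) * (Fintype.card (A.Mask ℓ) : ℝ)))) (θ p q)
    convert h using 2 with z
    rw [dualG, trace_transpose_mul_eq_sum]
    rfl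

end Regularity

section CondRate

variable {Q₂ : PSDCone (A.Idx (ℓ + 1))} {Q₁ : PSDCone (A.Idx ℓ)}
  {θ : Matrix (A.Idx (ℓ + 1)) (A.Idx (ℓ + 1)) ℝ} {a b c r : ℝ}

theorem condRate_eq (Q₂ : PSDCone (A.Idx (ℓ + 1))) (Q₁ : PSDCone (A.Idx ℓ)) :
    A.condRate ℓ Q₂ Q₁ = ⨆ (θ : Matrix (A.Idx (ℓ + 1)) (A.Idx (ℓ + 1)) ℝ) (_ : θ.IsSymm),
      (((θ.transpose * Q₂.1).trace : ℝ) : EReal) - ENNReal.log (gaussMGF (A.dualG ℓ θ) Q₁) :=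
  rfl

theorem le_condRate (hθ : θ.IsSymm)
    (hc : gaussMGF (A.dualG ℓ θ) Q₁ ≤ ENNReal.ofReal (Real.exp c))
    (Q₂ : PSDCone (A.Idx (ℓ + 1))) :
    (((θ.transpose * Q₂.1).trace - c : ℝ) : EReal) ≤ A.condRate ℓ Q₂ Q₁ := by
  rw [condRate_eq, EReal.coe_sub, ← log_ofReal_exp c]
  exact le_iSup₂_of_le θ hθ (EReal.sub_le_sub le_rfl (ENNReal.log_monotone hc))

theorem condRate_nonneg (Q₂ : PSDCone (A.Idx (ℓ + 1))) (Q₁ : PSDCone (A.Idx ℓ)) :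
    0 ≤ A.condRate ℓ Q₂ Q₁ := by
  have hdual : A.dualG ℓ 0 = fun _ => 0 := funext fun z => by simp [dualG]
  simpa using le_condRate (A := A) (θ := 0) (c := 0) (Q₁ := Q₁) Matrix.isSymm_zero
    (by simp [hdual, gaussMGF_zero]) Q₂

theorem exists_dual_of_lt_condRate (hA : A.IsRegularLayer ℓ)
    (ha : (a : EReal) < A.condRate ℓ Q₂ Q₁) :
    ∃ (θ : Matrix (A.Idx (ℓ + 1)) (A.Idx (ℓ + 1)) ℝ) (c : ℝ), θ.IsSymm ∧
      (∀ᶠ q in 𝓝 Q₁, gaussMGF (A.dualG ℓ θ) q ≤ ENNReal.ofReal (Real.exp c)) ∧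
      a < (θ.transpose * Q₂.1).trace - c := by
  simp only [condRate_eq, lt_iSup_iff] at ha
  obtain ⟨θ, hθ, ha⟩ := ha
  have hG := hA.nearQuadratic_dualG θ
  have hfin : gaussMGF (A.dualG ℓ θ) Q₁ ≠ ∞ := by
    intro h
    rw [h, ENNReal.log_top, EReal.sub_top] at ha
    exact not_lt_bot ha
  obtain ⟨Λ, hΛ⟩ := exists_eq_ofReal_exp (gaussMGF_ne_zero hG.continuous Q₁) hfin
  rw [hΛ, log_ofReal_exp, ← EReal.coe_sub, EReal.coe_lt_coe_iff] at ha
  obtain ⟨s, c, hs, hsc⟩ := exists_eventually_gaussMGF_const_mul_le hG Q₁ hΛ.le ha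
  exact ⟨s • θ, c, hθ.smul s, by rwa [dualG_smul], by simpa using hsc⟩

theorem eventually_lt_condRate (hA : A.IsRegularLayer ℓ)
    (ha : (a : EReal) < A.condRate ℓ Q₂ Q₁) :
    ∀ᶠ p in 𝓝 (Q₂, Q₁), (a : EReal) < A.condRate ℓ p.1 p.2 := by
  obtain ⟨θ, c, hθ, hev, hlt⟩ := exists_dual_of_lt_condRate hA ha
  have hcont : Continuous fun Q : PSDCone (A.Idx (ℓ + 1)) => (θ.transpose * Q.1).trace - c := by
    fun_prop
  rw [nhds_prod_eq]
  filter_upwards [(hcont.continuousAt.eventually_const_lt hlt).prod_mk hev] with p hp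
  exact (EReal.coe_lt_coe_iff.2 hp.1).trans_le (le_condRate hθ hp.2 p.1)

theorem IsRegularLayer.exists_gaussMGF_dualG_smul_one_le (hA : A.IsRegularLayer ℓ) (r : ℝ) :
    ∃ t > (0 : ℝ), ∃ C : ℝ, ∀ q : PSDCone (A.Idx ℓ), q.1.trace ≤ r →
      gaussMGF (A.dualG ℓ (t • 1)) q ≤ ENNReal.ofReal (Real.exp C) := by
  simp_rw [dualG_smul]
  exact exists_gaussMGF_le_of_trace_le (hA.nearQuadratic_dualG 1) r

theorem exists_trace_le_of_condRate_le (hA : A.IsRegularLayer ℓ) (r b : ℝ) :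
    ∃ r' : ℝ, ∀ (Q₂ : PSDCone (A.Idx (ℓ + 1))) (Q₁ : PSDCone (A.Idx ℓ)), Q₁.1.trace ≤ r →
      A.condRate ℓ Q₂ Q₁ ≤ b → Q₂.1.trace ≤ r' := by
  obtain ⟨t, ht, C, hC⟩ := hA.exists_gaussMGF_dualG_smul_one_le r
  refine ⟨(b + C) / t, fun Q₂ Q₁ hQ₁ hb => ?_⟩
  have hle := (le_condRate (Matrix.isSymm_one.smul t) (hC Q₁ hQ₁) Q₂).trans hb
  rw [EReal.coe_le_coe_iff, trace_smul_one_transpose_mul] at hle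
  rw [le_div_iff₀ ht]
  linarith

/- Only symmetric `θ` enter the rate; an arbitrary `θ` may be replaced by its symmetric part. -/
theorem ofReal_exp_le_gaussMGF (hA : A.IsRegularLayer ℓ) (hb : A.condRate ℓ Q₂ Q₁ ≤ b)
    (θ : Matrix (A.Idx (ℓ + 1)) (A.Idx (ℓ + 1)) ℝ) :
    ENNReal.ofReal (Real.exp ((θ.transpose * Q₂.1).trace - b)) ≤ gaussMGF (A.dualG ℓ θ) Q₁ := by
  set θ' : Matrix (A.Idx (ℓ + 1)) (A.Idx (ℓ + 1)) ℝ := (2 : ℝ)⁻¹ • (θ + θ.transpose)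
  have hsymm : θ'.IsSymm := (Matrix.isSymm_add_transpose_self θ).smul _
  have hpair {Q : Matrix (A.Idx (ℓ + 1)) (A.Idx (ℓ + 1)) ℝ} (hQ : Q.PosSemidef) :
      (θ'.transpose * Q).trace = (θ.transpose * Q).trace :=
    trace_symmPart_transpose_mul θ (by simpa [Matrix.IsSymm] using hQ.isHermitian.eq)
  have hdual : A.dualG ℓ θ' = A.dualG ℓ θ := funext fun z => hpair (A.G_posSemidef ℓ _)
  rw [← hpair Q₂.2, ← hdual]
  by_cases hfin : gaussMGF (A.dualG ℓ θ') Q₁ = ∞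
  · exact hfin ▸ le_top
  obtain ⟨Λ, hΛ⟩ :=
    exists_eq_ofReal_exp (gaussMGF_ne_zero (hA.nearQuadratic_dualG θ').continuous Q₁) hfin
  have hle := (le_condRate hsymm hΛ.le Q₂).trans hb
  rw [EReal.coe_le_coe_iff] at hle
  rw [hΛ]
  exact ENNReal.ofReal_le_ofReal (Real.exp_le_exp.2 (by linarith))

end CondRate

end ConvNet

section LayerLaw

variable {J : Type} [Fintype J] [DecidableEq J]

/-- The law of `N` independent centred Gaussian vectors with covariance matrix `q`: the conditional
law of the pre-activations of a layer given the preceding one. -/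
def layerLaw (q : PSDCone J) (N : ℕ) : Measure (Fin N → EuclideanSpace ℝ J) :=
  Measure.pi fun _ => multivariateGaussian 0 q.1

instance (q : PSDCone J) (N : ℕ) : IsProbabilityMeasure (layerLaw q N) := by
  unfold layerLaw; infer_instance

theorem layerLaw_eq_map (q : PSDCone J) (N : ℕ) :
    layerLaw q N = (Measure.pi fun _ : Fin N => stdGaussian (EuclideanSpace ℝ J)).map
      fun ξ i => q.sqrtCLM (ξ i) := by
  rw [Measure.pi_map_pi (f := fun _ => q.sqrtCLM)
    fun _ => q.sqrtCLM.continuous.measurable.aemeasurable]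
  simp_rw [← PSDCone.multivariateGaussian_eq_map]
  rfl

end LayerLaw

section EuclideanVec

variable {J : Type*}

/-- A square matrix as a Euclidean vector, its entries being the coordinates. The pairing
`tr(θᵀ Q)` becomes the inner product. -/
def toEuclideanVec (Q : Matrix J J ℝ) : EuclideanSpace ℝ (J × J) :=
  WithLp.toLp 2 fun p => Q p.1 p.2

theorem inner_toEuclideanVec [Fintype J] (θ : EuclideanSpace ℝ (J × J)) (Q : Matrix J J ℝ) :
    inner ℝ θ (toEuclideanVec Q) =
      ((Matrix.of fun p q => θ.ofLp (p, q) : Matrix J J ℝ).transpose * Q).trace := by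
  rw [trace_transpose_mul_eq_sum, PiLp.inner_apply, Fintype.sum_prod_type]
  simp [toEuclideanVec, mul_comm]

theorem isEmbedding_toEuclideanVec : IsEmbedding (toEuclideanVec (J := J)) := by
  have hinv : Continuous fun x : EuclideanSpace ℝ (J × J) =>
      (Matrix.of fun p q => x.ofLp (p, q) : Matrix J J ℝ) :=
    continuous_matrix fun p q => by simp only [Matrix.of_apply]; fun_prop
  have hvec : Continuous (toEuclideanVec (J := J)) :=
    (PiLp.continuous_toLp 2 _).comp (continuous_pi fun p => continuous_id.matrix_elem p.1 p.2)
  exact Function.LeftInverse.isEmbedding (fun _ => rfl) hinv hvec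

end EuclideanVec

namespace ConvNet

variable {A : ConvNet} {ℓ : ℕ}

variable (A) in
/-- The average of `G^{(ℓ)}` over `N` channels, as a point of the cone. -/
def avgG (ℓ : ℕ) {N : ℕ} (z : Fin N → EuclideanSpace ℝ (A.Idx ℓ)) : PSDCone (A.Idx (ℓ + 1)) :=
  ⟨(1 / (N : ℝ)) • ∑ c, A.G ℓ (z c).ofLp,
    (Matrix.posSemidef_sum _ fun _ _ => A.G_posSemidef _ _).smul (by positivity)⟩

theorem continuous_avgG (hG : Continuous (A.G ℓ)) (N : ℕ) :
    Continuous fun z : Fin N → EuclideanSpace ℝ (A.Idx ℓ) => A.avgG ℓ z :=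
  ((continuous_finsetSum _ fun c _ => hG.comp
    ((PiLp.continuous_ofLp 2 _).comp (continuous_apply c))).const_smul (1 / (N : ℝ))).subtype_mk _

theorem natCast_mul_trace_avgG {N : ℕ} (hN : N ≠ 0)
    (θ : Matrix (A.Idx (ℓ + 1)) (A.Idx (ℓ + 1)) ℝ) (z : Fin N → EuclideanSpace ℝ (A.Idx ℓ)) :
    (N : ℝ) * (θ.transpose * (A.avgG ℓ z).1).trace = ∑ c, A.dualG ℓ θ (z c) := by
  have : (N : ℝ) ≠ 0 := Nat.cast_ne_zero.2 hN
  simp only [avgG, dualG, Matrix.mul_smul, Matrix.trace_smul, Matrix.mul_sum, Matrix.trace_sum,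
    smul_eq_mul]
  field_simp

theorem toEuclideanVec_avgG {N : ℕ} (z : Fin N → EuclideanSpace ℝ (A.Idx ℓ)) :
    toEuclideanVec (A.avgG ℓ z).1 = sampleMean (fun x => toEuclideanVec (A.G ℓ x.ofLp)) z := by
  ext p
  simp [toEuclideanVec, avgG, sampleMean, Matrix.sum_apply]

theorem layerLaw_trace_ge_le {θ : Matrix (A.Idx (ℓ + 1)) (A.Idx (ℓ + 1)) ℝ}
    (hθ : Measurable (A.dualG ℓ θ)) {q : PSDCone (A.Idx ℓ)} {c : ℝ}
    (hc : gaussMGF (A.dualG ℓ θ) q ≤ ENNReal.ofReal (Real.exp c)) (a : ℝ) (N : ℕ) :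
    layerLaw q N {z | a ≤ (θ.transpose * (A.avgG ℓ z).1).trace} ≤
      ENNReal.ofReal (Real.exp (-(N * (a - c)))) := by
  rcases Nat.eq_zero_or_pos N with rfl | hN
  · simpa using prob_le_one
  have h := pi_sum_ge_le_exp (ι := Fin N) (multivariateGaussian 0 q.1) hθ (a := a) hc
  simpa [layerLaw, ← natCast_mul_trace_avgG hN.ne', hN] using h

theorem exists_layerLaw_le_of_lt_condRate (hA : A.IsRegularLayer ℓ)
    {Q₂ : PSDCone (A.Idx (ℓ + 1))} {Q₁ : PSDCone (A.Idx ℓ)} {a : ℝ}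
    (ha : (a : EReal) < A.condRate ℓ Q₂ Q₁) :
    ∃ U₂ ∈ 𝓝 Q₂, ∃ U₁ ∈ 𝓝 Q₁, ∀ q ∈ U₁, ∀ N : ℕ,
      layerLaw q N {z | A.avgG ℓ z ∈ U₂} ≤ ENNReal.ofReal (Real.exp (-(N * a))) := by
  obtain ⟨θ, c, -, hev, hlt⟩ := exists_dual_of_lt_condRate hA ha
  have hcont : Continuous fun Q : PSDCone (A.Idx (ℓ + 1)) => (θ.transpose * Q.1).trace := by
    fun_prop
  have hU := hcont.continuousAt.eventually_const_lt (lt_sub_iff_add_lt.1 hlt)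
  refine ⟨{Q | a + c ≤ (θ.transpose * Q.1).trace}, hU.mono fun _ => le_of_lt, _, hev,
    fun q hq N => ?_⟩
  simpa using
    layerLaw_trace_ge_le (hA.nearQuadratic_dualG θ).continuous.measurable hq (a + c) N

theorem exists_layerLaw_trace_gt_le (hA : A.IsRegularLayer ℓ) (r a : ℝ) :
    ∃ r' : ℝ, ∀ q : PSDCone (A.Idx ℓ), q.1.trace ≤ r → ∀ N : ℕ,
      layerLaw q N {z | r' < (A.avgG ℓ z).1.trace} ≤ ENNReal.ofReal (Real.exp (-(N * a))) := by
  obtain ⟨t, ht, C, hC⟩ := hA.exists_gaussMGF_dualG_smul_one_le r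
  refine ⟨(a + C) / t, fun q hq N => ?_⟩
  have hle :=
    layerLaw_trace_ge_le (hA.nearQuadratic_dualG _).continuous.measurable (hC q hq) (a + C) N
  simp only [trace_smul_one_transpose_mul, add_sub_cancel_right] at hle
  refine (measure_mono fun z hz => ?_).trans hle
  exact ((div_lt_iff₀' ht).1 (Set.mem_ofPred.1 hz)).le

theorem exists_le_layerLaw_of_condRate_le (hA : A.IsRegularLayer ℓ)
    {Q₂ : PSDCone (A.Idx (ℓ + 1))} {Q₁ : PSDCone (A.Idx ℓ)} {b : ℝ}
    (hb : A.condRate ℓ Q₂ Q₁ ≤ b) {U : Set (PSDCone (A.Idx (ℓ + 1)))} (hU : U ∈ 𝓝 Q₂)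
    {ε : ℝ} (hε : 0 < ε) :
    ∃ N₀ : ℕ, ∃ U₁ ∈ 𝓝 Q₁, ∀ q ∈ U₁, ∀ N ≥ N₀,
      ENNReal.ofReal (Real.exp (-(N * (b + ε)))) ≤ layerLaw q N {z | A.avgG ℓ z ∈ U} := by
  rw [(isEmbedding_toEuclideanVec.comp .subtypeVal).nhds_eq_comap] at hU
  obtain ⟨V, hV, hVU⟩ := mem_comap.1 hU
  have hvec : Continuous fun z : EuclideanSpace ℝ (A.Idx ℓ) => toEuclideanVec (A.G ℓ z.ofLp) :=
    isEmbedding_toEuclideanVec.continuous.comp (hA.continuous_G.comp (PiLp.continuous_ofLp 2 _))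
  have hmgf (θ : EuclideanSpace ℝ (A.Idx (ℓ + 1) × A.Idx (ℓ + 1))) :
      ENNReal.ofReal (Real.exp (inner ℝ θ (toEuclideanVec Q₂.1) - b)) ≤
        ∫⁻ ξ, ENNReal.ofReal (Real.exp (inner ℝ θ (toEuclideanVec (A.G ℓ (Q₁.sqrtCLM ξ).ofLp))))
          ∂stdGaussian (EuclideanSpace ℝ (A.Idx ℓ)) := by
    simp_rw [inner_toEuclideanVec]
    exact (ofReal_exp_le_gaussMGF hA hb _).trans_eq
      (gaussMGF_eq (hA.nearQuadratic_dualG _).continuous Q₁)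
  obtain ⟨N₀, hN₀⟩ := cramer_lower_bound (stdGaussian (EuclideanSpace ℝ (A.Idx ℓ)))
    (fun q : PSDCone (A.Idx ℓ) => (hvec.comp q.sqrtCLM.continuous).measurable)
    (hvec.comp Q₁.sqrtCLM.continuous).measurable
    (fun ξ => (hvec.comp (PSDCone.continuous_sqrtCLM_apply ξ)).tendsto Q₁) _ hmgf hV hε
  refine ⟨N₀, _, hN₀, fun q hq N hN => ?_⟩
  have hmeas : Measurable fun (ξ : Fin N → EuclideanSpace ℝ (A.Idx ℓ)) i => q.sqrtCLM (ξ i) := by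
    fun_prop
  rw [layerLaw_eq_map]
  refine ((ENNReal.ofReal_le_ofReal (hq N hN)).trans_eq ofReal_measureReal).trans
    (le_trans (measure_mono fun ξ hξ => hVU ?_) (Measure.le_map_apply hmeas.aemeasurable _))
  rw [Set.mem_preimage, Function.comp_apply, toEuclideanVec_avgG]
  exact hξ

end ConvNet

section GaussianCombination

variable {κ J : Type} [Fintype κ] [Fintype J] {v : ℝ≥0}
  {a : κ → EuclideanSpace ℝ J} {q : PSDCone J}

theorem sum_mul_inner_sq_eq_dotProduct_mulVec (hq : ∀ i j, q.1 i j = v * ∑ k, a k i * a k j)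
    (t : EuclideanSpace ℝ J) :
    ∑ k, (v : ℝ) * inner ℝ (a k) t ^ 2 = t.ofLp ⬝ᵥ q.1.mulVec t.ofLp := by
  simp only [dotProduct, Matrix.mulVec, hq, PiLp.inner_apply, RCLike.inner_apply, conj_trivial,
    Finset.mul_sum, Finset.sum_mul, sq]
  rw [Finset.sum_comm]
  refine Finset.sum_congr rfl fun i _ => ?_
  rw [Finset.sum_comm]
  refine Finset.sum_congr rfl fun j _ => Finset.sum_congr rfl fun k _ => ?_
  ring

variable [DecidableEq J]

theorem map_sum_smul_pi_gaussianReal (hq : ∀ i j, q.1 i j = v * ∑ k, a k i * a k j) :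
    (Measure.pi fun _ : κ => gaussianReal 0 v).map (fun y => ∑ k, y k • a k) =
      multivariateGaussian 0 q.1 := by
  have hmeas : Measurable fun y : κ → ℝ => ∑ k, y k • a k := by fun_prop
  have : IsProbabilityMeasure ((Measure.pi fun _ : κ => gaussianReal 0 v).map
      fun y => ∑ k, y k • a k) := Measure.isProbabilityMeasure_map hmeas.aemeasurable
  refine Measure.ext_of_charFun (funext fun t => ?_)
  have hexp (y : κ → ℝ) : Complex.exp ((inner ℝ (∑ k, y k • a k) t : ℝ) * Complex.I) =
      ∏ k, Complex.exp ((inner ℝ (a k) t : ℝ) * y k * Complex.I) := by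
    rw [← Complex.exp_sum, ← Finset.sum_mul, sum_inner]
    simp [real_inner_smul_left, mul_comm]
  rw [charFun_apply, integral_map hmeas.aemeasurable (by fun_prop)]
  simp_rw [hexp]
  rw [integral_fintype_prod_eq_prod
    (f := fun k (y : ℝ) => Complex.exp ((inner ℝ (a k) t : ℝ) * y * Complex.I))]
  simp_rw [← charFun_apply_real, charFun_gaussianReal]
  rw [charFun_multivariateGaussian q.2, ← sum_mul_inner_sq_eq_dotProduct_mulVec hq,
    ← Complex.exp_sum]
  simp [Finset.sum_div]

theorem map_sum_smul_pi_gaussianReal_eq_layerLaw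
    (hq : ∀ i j, q.1 i j = v * ∑ k, a k i * a k j) (N : ℕ) :
    (Measure.pi fun _ : Fin N => Measure.pi fun _ : κ => gaussianReal 0 v).map
      (fun y c => ∑ k, y c k • a k) = layerLaw q N := by
  have hmeas : Measurable fun y : κ → ℝ => ∑ k, y k • a k := by fun_prop
  have hlaw := map_sum_smul_pi_gaussianReal hq
  have : IsProbabilityMeasure ((Measure.pi fun _ : κ => gaussianReal 0 v).map
      fun y => ∑ k, y k • a k) := Measure.isProbabilityMeasure_map hmeas.aemeasurable
  have h := Measure.pi_map_pi (μ := fun _ : Fin N => Measure.pi fun _ : κ => gaussianReal 0 v)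
    (f := fun _ y => ∑ k, y k • a k) fun _ => hmeas.aemeasurable
  rw [hlaw] at h
  exact h

end GaussianCombination

section Independence

variable {Ω α β : Type*} {m mΩ : MeasurableSpace Ω} [MeasurableSpace α] [MeasurableSpace β]
  {P : Measure Ω} [IsFiniteMeasure P] {X : Ω → α} {Y : Ω → β} {E : Set Ω}

theorem map_restrict_prodMk_eq_prod_of_indep (hm : m ≤ mΩ) (hX : Measurable[m] X)
    (hY : Measurable Y) (hind : Indep m (MeasurableSpace.comap Y inferInstance) P)
    (hE : MeasurableSet[m] E) :
    (P.restrict E).map (fun ω => (X ω, Y ω)) = ((P.restrict E).map X).prod (P.map Y) := by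
  have hXΩ : Measurable X := hX.mono hm le_rfl
  refine (Measure.prod_eq fun s t hs ht => ?_).symm
  rw [Measure.map_apply (hXΩ.prodMk hY) (hs.prod ht), Measure.map_apply hXΩ hs,
    Measure.map_apply hY ht, Measure.restrict_apply (hXΩ hs),
    Measure.restrict_apply ((hXΩ.prodMk hY) (hs.prod ht)), Set.mk_preimage_prod,
    Set.inter_right_comm]
  exact (Indep_iff _ _ _).1 hind _ _ ((hX hs).inter hE) ⟨t, ht, rfl⟩

theorem measure_inter_setOf_prodMk_mem_of_indep (hm : m ≤ mΩ) (hX : Measurable[m] X)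
    (hY : Measurable Y) (hind : Indep m (MeasurableSpace.comap Y inferInstance) P)
    (hE : MeasurableSet[m] E) {T : Set (α × β)} (hT : MeasurableSet T) :
    P (E ∩ {ω | (X ω, Y ω) ∈ T}) = ∫⁻ ω in E, P.map Y (Prod.mk (X ω) ⁻¹' T) ∂P := by
  have hXΩ : Measurable X := hX.mono hm le_rfl
  rw [← lintegral_map (f := fun x => P.map Y (Prod.mk x ⁻¹' T)) (measurable_measure_prodMk_left hT)
    hXΩ, ← Measure.prod_apply hT, ← map_restrict_prodMk_eq_prod_of_indep hm hX hY hind hE,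
    Measure.map_apply (hXΩ.prodMk hY) hT, Measure.restrict_apply (hXΩ.prodMk hY hT), Set.inter_comm]
  rfl

end Independence

namespace ConvNet

section Recursion

variable (A : ConvNet) (C : ℕ → ℕ) (w : A.Weights C)

/-- The normalised inputs of layer `j`, after extraction of patches and activation, as Euclidean
vectors: the pre-activations are their linear combinations with the weights as coefficients. -/
def inputVec : (j : ℕ) → Fin (A.chan C j) × A.Mask j → EuclideanSpace ℝ (A.Idx (j + 1))
  | 0, k => WithLp.toLp 2 fun p =>
      1 / √((Fintype.card (A.Mask 0) : ℝ) * (A.chan C 0 : ℝ)) * A.R 0 p.1 (A.x p.2 k.1) k.2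
  | j + 1, k => WithLp.toLp 2 fun p =>
      1 / √((Fintype.card (A.Mask (j + 1)) : ℝ) * (A.chan C (j + 1) : ℝ)) *
        A.σ (A.R (j + 1) p.1 (fun i => A.preact C w j k.1 (i, p.2)) k.2)

/-- The pre-activations of a layer as Euclidean vectors, one for each channel. -/
def preactVec (j : ℕ) (c : Fin (A.chan C (j + 1))) : EuclideanSpace ℝ (A.Idx (j + 1)) :=
  WithLp.toLp 2 (A.preact C w j c)

theorem preactVec_eq_sum_smul (j : ℕ) (c : Fin (A.chan C (j + 1))) :
    A.preactVec C w j c = ∑ k, w j k.2 k.1 c • A.inputVec C w j k := by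
  ext p
  cases j <;>
    simp [preactVec, preact, inputVec, Fintype.sum_prod_type, Finset.mul_sum, mul_left_comm]

/-- The sequence `K^{(1)}, K^{(2)}, …` of conditional covariance matrices. -/
def cov : (j : ℕ) → PSDCone (A.Idx (j + 1))
  | 0 => A.K1
  | j + 1 => ⟨A.KMat C w j, A.KMat_posSemidef C w j⟩

theorem cov_apply (j : ℕ) (p q : A.Idx (j + 1)) :
    (A.cov C w j).1 p q =
      ((A.prec j)⁻¹ : ℝ≥0) * ∑ k, A.inputVec C w j k p * A.inputVec C w j k q := by
  have hnorm (x y : ℝ) :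
      1 / √((Fintype.card (A.Mask j) : ℝ) * (A.chan C j : ℝ)) * x *
        (1 / √((Fintype.card (A.Mask j) : ℝ) * (A.chan C j : ℝ)) * y) =
      ((Fintype.card (A.Mask j) : ℝ) * (A.chan C j : ℝ))⁻¹ * (x * y) := by
    rw [mul_mul_mul_comm, div_mul_div_comm, Real.mul_self_sqrt (by positivity), one_mul, one_div]
  rw [Fintype.sum_prod_type]
  cases j with
  | zero =>
    simp only [cov, K1, K1Mat, inputVec, Matrix.of_apply, hnorm, ← Finset.mul_sum]
    simp [chan]
    ring_nf
    rfl
  | succ j =>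
    simp only [cov, KMat, G, inputVec, Matrix.smul_apply, Matrix.sum_apply, Matrix.of_apply,
      hnorm, ← Finset.mul_sum, smul_eq_mul]
    simp
    ring

end Recursion

section Measurability

variable {A : ConvNet} {C : ℕ → ℕ} {Ω : Type*} {m₀ : MeasurableSpace Ω} {w : Ω → A.Weights C}
  {j : ℕ}

theorem measurable_preactVec_of_inputVec (hin : ∀ k, Measurable fun ω => A.inputVec C (w ω) j k)
    (hw : ∀ m c' c, Measurable fun ω => w ω j m c' c) :
    Measurable fun ω => A.preactVec C (w ω) j := by
  refine measurable_pi_lambda _ fun c => ?_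
  simp_rw [preactVec_eq_sum_smul]
  exact Finset.measurable_fun_sum _ fun k _ => (hw _ _ _).smul (hin k)

theorem measurable_inputVec (hA : A.IsRegular) (hj : j ≤ A.L)
    (hw : ∀ ℓ < j, ∀ m c' c, Measurable fun ω => w ω ℓ m c' c)
    (k : Fin (A.chan C j) × A.Mask j) : Measurable fun ω => A.inputVec C (w ω) j k := by
  induction j with
  | zero => exact measurable_const
  | succ j ih =>
    have hpre : Measurable fun ω => A.preactVec C (w ω) j :=
      measurable_preactVec_of_inputVec
        (ih (Nat.le_of_succ_le hj) fun ℓ hℓ => hw ℓ (Nat.lt_succ_of_lt hℓ)) (hw j j.lt_succ_self)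
    have hpre_k : Measurable fun ω => (A.preactVec C (w ω) j k.1).ofLp :=
      (WithLp.measurable_ofLp 2 _).comp ((measurable_pi_apply k.1).comp hpre)
    exact (WithLp.measurable_toLp 2 _).comp <| measurable_pi_lambda _ fun p =>
      (((hA j hj).continuous_feature p k.2).measurable.comp hpre_k).const_mul _

theorem measurable_preactVec (hA : A.IsRegular) (hj : j ≤ A.L)
    (hw : ∀ ℓ ≤ j, ∀ m c' c, Measurable fun ω => w ω ℓ m c' c) :
    Measurable fun ω => A.preactVec C (w ω) j :=
  measurable_preactVec_of_inputVec (measurable_inputVec hA hj fun ℓ hℓ => hw ℓ hℓ.le)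
    (hw j le_rfl)

theorem measurable_cov (hA : A.IsRegular) (hj : j ≤ A.L)
    (hw : ∀ ℓ < j, ∀ m c' c, Measurable fun ω => w ω ℓ m c' c) :
    Measurable fun ω => A.cov C (w ω) j := by
  cases j with
  | zero => exact measurable_const
  | succ j =>
    exact (continuous_avgG (hA j hj).continuous_G _).measurable.comp
      (measurable_preactVec hA (Nat.le_of_succ_le hj) fun ℓ hℓ => hw ℓ (Nat.lt_succ_of_le hℓ))

/-- The weights of layer `j`, the first index being the channel of layer `j + 1` and the second one
that of the normalised inputs of layer `j`. -/
def layerWeights (w : A.Weights C) (j : ℕ) :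
    Fin (A.chan C (j + 1)) → Fin (A.chan C j) × A.Mask j → ℝ :=
  fun c k => w j k.2 k.1 c

theorem measurable_layerWeights (hw : ∀ m c' c, Measurable fun ω => w ω j m c' c) :
    Measurable fun ω => layerWeights (w ω) j :=
  measurable_pi_lambda _ fun c => measurable_pi_lambda _ fun k => hw k.2 k.1 c

end Measurability

section Conditioning

variable {A : ConvNet} {C : ℕ → ℕ} {Ω : Type*} {j k : ℕ}

/-- The `σ`-algebra generated by the weights of the layers in `S`. -/
@[reducible]
def weightSigma (w : Ω → A.Weights C) (S : Set ℕ) : MeasurableSpace Ω :=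
  ⨆ p ∈ {p : A.WeightIdx C | (p.1 : ℕ) ∈ S},
    MeasurableSpace.comap (fun ω => w ω p.1 p.2.1 p.2.2.1 p.2.2.2) inferInstance

theorem measurable_weightSigma (w : Ω → A.Weights C) {S : Set ℕ} (hj : j ≤ A.L)
    (hS : j ∈ S) (m : A.Mask j) (c' : Fin (A.chan C j)) (c : Fin (A.chan C (j + 1))) :
    Measurable[weightSigma w S] fun ω => w ω j m c' c := by
  have h : MeasurableSpace.comap (fun ω => w ω j m c' c) inferInstance ≤ weightSigma w S :=
    le_iSup₂_of_le (⟨⟨j, Nat.lt_succ_of_le hj⟩, m, c', c⟩ : A.WeightIdx C) hS le_rfl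
  exact (comap_measurable _).mono h le_rfl

theorem measurableSet_setOf_cov_mem_weightSigma (w : Ω → A.Weights C) (hA : A.IsRegular)
    (hj : j ≤ A.L) (hjk : j ≤ k) {U : Set (PSDCone (A.Idx (j + 1)))} (hU : MeasurableSet U) :
    MeasurableSet[weightSigma w (Set.Iio k)] {ω | A.cov C (w ω) j ∈ U} :=
  measurable_cov (m₀ := weightSigma w (Set.Iio k)) hA hj
    (fun _ hℓ => measurable_weightSigma w (hℓ.le.trans hj) (hℓ.trans_le hjk)) hU

variable [mΩ : MeasurableSpace Ω]

/-- The weights of the layers `0, …, L` are measurable, Gaussian and independent. -/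
structure IsGaussianWeights (P : Measure Ω) (w : Ω → A.Weights C) : Prop where
  measurable : ∀ ℓ ≤ A.L, ∀ m c' c, Measurable fun ω => w ω ℓ m c' c
  map_eq : ∀ ℓ ≤ A.L, ∀ m c' c, P.map (fun ω => w ω ℓ m c' c) = gaussianReal 0 (A.prec ℓ)⁻¹
  indep : iIndepFun (fun (p : A.WeightIdx C) ω => w ω p.1 p.2.1 p.2.2.1 p.2.2.2) P

namespace IsGaussianWeights

variable {P : Measure Ω} {w : Ω → A.Weights C}

theorem weightSigma_le (hw : IsGaussianWeights P w) (S : Set ℕ) : weightSigma w S ≤ mΩ :=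
  iSup₂_le fun p _ => (hw.measurable p.1 (Nat.le_of_lt_succ p.1.2) _ _ _).comap_le

theorem indep_weightSigma (hw : IsGaussianWeights P w) {S T : Set ℕ} (h : Disjoint S T) :
    Indep (weightSigma w S) (weightSigma w T) P :=
  indep_iSup_of_disjoint
    (m := fun p : A.WeightIdx C => MeasurableSpace.comap
      (fun ω => w ω p.1 p.2.1 p.2.2.1 p.2.2.2) inferInstance)
    (fun p => (hw.measurable p.1 (Nat.le_of_lt_succ p.1.2) _ _ _).comap_le)
    hw.indep.iIndep (Set.disjoint_left.2 fun _ hp hp' => Set.disjoint_left.1 h hp hp')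

theorem map_layerWeights (hw : IsGaussianWeights P w) (hj : j ≤ A.L) :
    P.map (fun ω => layerWeights (w ω) j) =
      Measure.pi fun _ => Measure.pi fun _ => gaussianReal 0 (A.prec j)⁻¹ := by
  have hinj : Function.Injective fun x : Fin (A.chan C (j + 1)) × (Fin (A.chan C j) × A.Mask j) =>
      (⟨⟨j, Nat.lt_succ_of_le hj⟩, x.2.2, x.2.1, x.1⟩ : A.WeightIdx C) := by
    rintro ⟨c, c', m⟩ ⟨d, d', m'⟩ h
    simp only [Sigma.mk.injEq, heq_eq_eq, Prod.mk.injEq, true_and] at h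
    obtain ⟨rfl, rfl, rfl⟩ := h
    rfl
  have hmeas (x : Fin (A.chan C (j + 1)) × (Fin (A.chan C j) × A.Mask j)) :=
    hw.measurable j hj x.2.2 x.2.1 x.1
  have huncurried : P.map (fun ω (x : Fin (A.chan C (j + 1)) × (Fin (A.chan C j) × A.Mask j)) =>
      w ω j x.2.2 x.2.1 x.1) = Measure.pi fun _ => gaussianReal 0 (A.prec j)⁻¹ := by
    refine ((hw.indep.precomp hinj).map_fun_eq_pi_map fun x => (hmeas x).aemeasurable).trans ?_
    congr 1
    exact funext fun x => hw.map_eq j hj _ _ _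
  have hcurry := Measure.infinitePi_map_curry
    fun (_ : Fin (A.chan C (j + 1))) (_ : Fin (A.chan C j) × A.Mask j) =>
      gaussianReal 0 (A.prec j)⁻¹
  simp_rw [Measure.infinitePi_eq_pi] at hcurry
  rw [← hcurry, ← huncurried, Measure.map_map (MeasurableEquiv.measurable _)
    (measurable_pi_lambda _ hmeas)]
  rfl

variable [IsProbabilityMeasure P] {E : Set Ω}

theorem measure_inter_preactVec_mem (hw : IsGaussianWeights P w) (hA : A.IsRegular) (hj : j ≤ A.L)
    (hE : MeasurableSet[weightSigma w (Set.Iio j)] E)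
    {S : Set (Fin (A.chan C (j + 1)) → EuclideanSpace ℝ (A.Idx (j + 1)))} (hS : MeasurableSet S) :
    P (E ∩ {ω | A.preactVec C (w ω) j ∈ S}) =
      ∫⁻ ω in E, layerLaw (A.cov C (w ω) j) (A.chan C (j + 1)) S ∂P := by
  set X : Ω → Fin (A.chan C j) × A.Mask j → EuclideanSpace ℝ (A.Idx (j + 1)) :=
    fun ω => A.inputVec C (w ω) j
  set Y : Ω → Fin (A.chan C (j + 1)) → Fin (A.chan C j) × A.Mask j → ℝ :=
    fun ω => layerWeights (w ω) j
  have hX : Measurable[weightSigma w (Set.Iio j)] X :=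
    @measurable_pi_lambda _ _ _ (weightSigma w (Set.Iio j)) _ _ <|
      measurable_inputVec (m₀ := weightSigma w (Set.Iio j)) hA hj fun _ hℓ =>
        measurable_weightSigma w (hℓ.le.trans hj) hℓ
  have hY : Measurable[weightSigma w {j}] Y :=
    measurable_layerWeights (m₀ := weightSigma w {j}) (measurable_weightSigma w hj rfl)
  have hind : Indep (weightSigma w (Set.Iio j)) (MeasurableSpace.comap Y inferInstance) P :=
    indep_of_indep_of_le_right (hw.indep_weightSigma (by simp)) hY.comap_le
  set Φ : (Fin (A.chan C j) × A.Mask j → EuclideanSpace ℝ (A.Idx (j + 1))) →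
      (Fin (A.chan C (j + 1)) → Fin (A.chan C j) × A.Mask j → ℝ) →
      Fin (A.chan C (j + 1)) → EuclideanSpace ℝ (A.Idx (j + 1)) := fun a y c => ∑ k, y c k • a k
  have hΦ : Measurable fun z : (_ × _) => Φ z.1 z.2 := by fun_prop
  have hpre (ω : Ω) : A.preactVec C (w ω) j = Φ (X ω) (Y ω) :=
    funext fun c => A.preactVec_eq_sum_smul C (w ω) j c
  have hlaw (ω : Ω) : P.map Y (Φ (X ω) ⁻¹' S) =
      layerLaw (A.cov C (w ω) j) (A.chan C (j + 1)) S := by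
    rw [hw.map_layerWeights hj,
      ← map_sum_smul_pi_gaussianReal_eq_layerLaw (A.cov_apply C (w ω) j),
      Measure.map_apply (by fun_prop) hS]
  simp_rw [← hlaw, hpre]
  exact measure_inter_setOf_prodMk_mem_of_indep (hw.weightSigma_le _) hX
    (hY.mono (hw.weightSigma_le _) le_rfl) hind hE (hΦ hS)

theorem measure_inter_cov_mem (hw : IsGaussianWeights P w) (hA : A.IsRegular) (hj : j < A.L)
    (hE : MeasurableSet[weightSigma w (Set.Iio j)] E)
    {U : Set (PSDCone (A.Idx (j + 2)))} (hU : MeasurableSet U) :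
    P (E ∩ {ω | A.cov C (w ω) (j + 1) ∈ U}) =
      ∫⁻ ω in E, layerLaw (A.cov C (w ω) j) (A.chan C (j + 1)) {z | A.avgG (j + 1) z ∈ U} ∂P :=
  hw.measure_inter_preactVec_mem hA hj.le hE
    ((continuous_avgG (hA j hj).continuous_G _).measurable hU)

theorem measure_inter_cov_mem_le (hw : IsGaussianWeights P w) (hA : A.IsRegular) (hj : j < A.L)
    (hE : MeasurableSet[weightSigma w (Set.Iio j)] E)
    {U : Set (PSDCone (A.Idx (j + 2)))} (hU : MeasurableSet U) {b : ℝ≥0∞}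
    (hb : ∀ ω ∈ E, layerLaw (A.cov C (w ω) j) (A.chan C (j + 1))
      {z | A.avgG (j + 1) z ∈ U} ≤ b) :
    P (E ∩ {ω | A.cov C (w ω) (j + 1) ∈ U}) ≤ b * P E := by
  rw [hw.measure_inter_cov_mem hA hj hE hU, ← setLIntegral_const]
  exact setLIntegral_mono' (hw.weightSigma_le _ _ hE) hb

theorem le_measure_inter_cov_mem (hw : IsGaussianWeights P w) (hA : A.IsRegular) (hj : j < A.L)
    (hE : MeasurableSet[weightSigma w (Set.Iio j)] E)
    {U : Set (PSDCone (A.Idx (j + 2)))} (hU : MeasurableSet U) {b : ℝ≥0∞}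
    (hb : ∀ ω ∈ E, b ≤ layerLaw (A.cov C (w ω) j) (A.chan C (j + 1))
      {z | A.avgG (j + 1) z ∈ U}) :
    b * P E ≤ P (E ∩ {ω | A.cov C (w ω) (j + 1) ∈ U}) := by
  rw [hw.measure_inter_cov_mem hA hj hE hU, ← setLIntegral_const]
  exact setLIntegral_mono' (hw.weightSigma_le _ _ hE) hb

end IsGaussianWeights

end Conditioning

end ConvNet

section ExponentialGrowth

open ExpGrowth

variable {u : ℕ → ℝ} {d : ℝ}

theorem tendsto_sum_mul_div {κ : Type*} {s : Finset κ} {c : ℕ → κ → ℝ} {γ a : κ → ℝ}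
    (hc : ∀ j ∈ s, Tendsto (fun n => c n j / n) atTop (𝓝 (γ j))) :
    Tendsto (fun n : ℕ => (∑ j ∈ s, c n j * a j) / n) atTop (𝓝 (∑ j ∈ s, γ j * a j)) := by
  simp_rw [Finset.sum_div, mul_div_right_comm]
  exact tendsto_finsetSum _ fun j hj => (hc j hj).mul_const _

theorem tendsto_atTop_of_tendsto_natCast_div {c : ℕ → ℕ} (hd : 0 < d)
    (hc : Tendsto (fun n => (c n : ℝ) / n) atTop (𝓝 d)) : Tendsto c atTop atTop := by
  refine tendsto_natCast_atTop_iff.1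
    ((Tendsto.pos_mul_atTop hd hc (tendsto_natCast_atTop_atTop (R := ℝ))).congr' ?_)
  filter_upwards [eventually_ne_atTop 0] with n hn
  exact div_mul_cancel₀ _ (mod_cast hn)

theorem tendsto_log_ofReal_exp_neg_div (hu : Tendsto (fun n : ℕ => u n / n) atTop (𝓝 d)) :
    Tendsto (fun n : ℕ => ENNReal.log (ENNReal.ofReal (Real.exp (-u n))) / (n : EReal)) atTop
      (𝓝 ((-d : ℝ) : EReal)) := by
  have h (n : ℕ) : ENNReal.log (ENNReal.ofReal (Real.exp (-u n))) / (n : EReal) =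
      ((-(u n / n) : ℝ) : EReal) := by
    rw [log_ofReal_exp, ← EReal.coe_coe_eq_natCast, ← EReal.coe_div, neg_div]
  simp_rw [h]
  exact (continuous_coe_real_ereal.tendsto _).comp hu.neg

theorem expGrowthSup_ofReal_exp_neg (hu : Tendsto (fun n : ℕ => u n / n) atTop (𝓝 d)) :
    expGrowthSup (fun n => ENNReal.ofReal (Real.exp (-u n))) = ((-d : ℝ) : EReal) :=
  (tendsto_log_ofReal_exp_neg_div hu).limsup_eq

theorem expGrowthInf_ofReal_exp_neg (hu : Tendsto (fun n : ℕ => u n / n) atTop (𝓝 d)) :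
    expGrowthInf (fun n => ENNReal.ofReal (Real.exp (-u n))) = ((-d : ℝ) : EReal) :=
  (tendsto_log_ofReal_exp_neg_div hu).liminf_eq

theorem expGrowthSup_measure_preimage_le_of_isCompact {Ω X : Type*} [MeasurableSpace Ω]
    [TopologicalSpace X] {P : Measure Ω} {f : ℕ → Ω → X} {K : Set X} (hK : IsCompact K)
    {b : EReal} (h : ∀ x ∈ K, ∃ U ∈ 𝓝 x, expGrowthSup (fun n => P (f n ⁻¹' U)) ≤ b) :
    expGrowthSup (fun n => P (f n ⁻¹' K)) ≤ b := by
  refine hK.induction_on (p := fun s => expGrowthSup (fun n => P (f n ⁻¹' s)) ≤ b)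
    ?_ (fun s t hst ht => ?_) (fun s t hs ht => ?_) fun x hx => ?_
  · have hzero : (fun n => P (f n ⁻¹' ∅)) = 0 := funext fun n => by simp
    rw [hzero, expGrowthSup_zero]
    exact bot_le
  · exact (expGrowthSup_monotone fun n => measure_mono (Set.preimage_mono hst)).trans ht
  · calc expGrowthSup (fun n => P (f n ⁻¹' (s ∪ t)))
        ≤ expGrowthSup ((fun n => P (f n ⁻¹' s)) + fun n => P (f n ⁻¹' t)) :=
          expGrowthSup_monotone fun n => measure_union_le _ _
      _ ≤ b := expGrowthSup_add.trans_le (sup_le hs ht)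
  · obtain ⟨U, hU, hle⟩ := h x hx
    exact ⟨U, mem_nhdsWithin_of_mem_nhds hU, hle⟩

end ExponentialGrowth

section ERealSum

variable {κ : Type*}

theorem coe_finsetSum_ereal (s : Finset κ) (f : κ → ℝ) :
    ((∑ k ∈ s, f k : ℝ) : EReal) = ∑ k ∈ s, (f k : EReal) :=
  map_sum (⟨⟨Real.toEReal, EReal.coe_zero⟩, EReal.coe_add⟩ : ℝ →+ EReal) f s

theorem exists_coe_lt_of_lt_add {x y : EReal} {a : ℝ} (h : (a : EReal) < x + y) :
    ∃ b c : ℝ, (b : EReal) < x ∧ (c : EReal) < y ∧ a < b + c := by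
  by_contra! hle
  refine h.not_ge (EReal.add_le_of_forall_lt fun x' hx' y' hy' => ?_)
  obtain ⟨b, hxb, hbx⟩ := EReal.lt_iff_exists_real_btwn.1 hx'
  obtain ⟨c, hyc, hcy⟩ := EReal.lt_iff_exists_real_btwn.1 hy'
  calc x' + y' ≤ (b : EReal) + c := add_le_add hxb.le hyc.le
    _ ≤ a := mod_cast hle b c hbx hcy

theorem exists_forall_coe_lt_of_lt_sum {s : Finset κ} {x : κ → EReal} {a : ℝ}
    (ha : (a : EReal) < ∑ k ∈ s, x k) :
    ∃ b : κ → ℝ, (∀ k ∈ s, (b k : EReal) < x k) ∧ a < ∑ k ∈ s, b k := by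
  classical
  induction s using Finset.induction_on generalizing a with
  | empty => exact ⟨0, by simp, by simpa using ha⟩
  | insert i s hi ih =>
    rw [Finset.sum_insert hi] at ha
    obtain ⟨c, a', hc, ha', haca⟩ := exists_coe_lt_of_lt_add ha
    obtain ⟨b, hb, hab⟩ := ih ha'
    refine ⟨Function.update b i c, fun k hk => ?_, ?_⟩
    · rcases eq_or_ne k i with rfl | hki
      · rwa [Function.update_self]
      · rw [Function.update_of_ne hki]
        exact hb k (Finset.mem_of_mem_insert_of_ne hk hki)
    · rw [Finset.sum_insert hi, Function.update_self, Finset.sum_update_of_notMem hi]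
      linarith

theorem exists_forall_coe_lt_of_lt_sum_mul {s : Finset κ} {α : κ → ℝ} (hα : ∀ k ∈ s, 0 < α k)
    {x : κ → EReal} {a : ℝ} (ha : (a : EReal) < ∑ k ∈ s, (α k : EReal) * x k) :
    ∃ b : κ → ℝ, (∀ k ∈ s, (b k : EReal) < x k) ∧ a < ∑ k ∈ s, α k * b k := by
  obtain ⟨b, hb, hab⟩ := exists_forall_coe_lt_of_lt_sum ha
  refine ⟨fun k => b k / α k, fun k hk => ?_, hab.trans_le (Finset.sum_le_sum fun k hk => ?_)⟩
  · rw [EReal.coe_div, EReal.div_lt_iff (mod_cast hα k hk) (EReal.coe_ne_top _), mul_comm]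
    exact hb k hk
  · rw [mul_div_cancel₀ _ (hα k hk).ne']

end ERealSum

theorem measurableSet_setOf_forall_mem {Ω : Type*} {_ : MeasurableSpace Ω} {S : Set ℕ}
    {E : ℕ → Set Ω} (h : ∀ j ∈ S, MeasurableSet (E j)) :
    MeasurableSet {ω | ∀ j ∈ S, ω ∈ E j} := by
  have hinter : {ω | ∀ j ∈ S, ω ∈ E j} = ⋂ j ∈ S, E j := by ext ω; simp
  exact hinter ▸ MeasurableSet.biInter S.to_countable h

theorem exists_seq_of_forall_lt_exists {β : Type*} {R : ℕ → β → β → Prop} {L : ℕ} (b₀ : β)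
    (h : ∀ j < L, ∀ b, ∃ b', R j b b') :
    ∃ b : ℕ → β, b 0 = b₀ ∧ ∀ j < L, R j (b j) (b (j + 1)) := by
  choose f hf using h
  refine ⟨Nat.rec b₀ fun j b => if hj : j < L then f j hj b else b, rfl, fun j hj => ?_⟩
  simpa only [hj, dite_true] using hf j hj _

theorem exists_and_not_succ_of_exists_not {p : ℕ → Prop} {L : ℕ} (h₀ : p 0)
    (h : ∃ j ≤ L, ¬p j) : ∃ j < L, p j ∧ ¬p (j + 1) := by
  by_contra! hsucc
  obtain ⟨j, hj, hpj⟩ := h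
  refine hpj ?_
  clear hpj
  induction j with
  | zero => exact h₀
  | succ j ih => exact hsucc j hj (ih (Nat.le_of_succ_le hj))

namespace ConvNet

section CovarianceSequence

variable {A : ConvNet} {C : ℕ → ℕ} {Ω : Type*} [MeasurableSpace Ω] {P : Measure Ω}
  [IsProbabilityMeasure P] {w : Ω → A.Weights C}

theorem IsGaussianWeights.measure_forall_cov_mem_le (hw : IsGaussianWeights P w) (hA : A.IsRegular)
    {U₁ : ∀ j, Set (PSDCone (A.Idx (j + 1)))} {U₂ : ∀ j, Set (PSDCone (A.Idx (j + 2)))}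
    (hU₁ : ∀ j, MeasurableSet (U₁ j)) (hU₂ : ∀ j, MeasurableSet (U₂ j)) {b : ℕ → ℝ≥0∞}
    (hb : ∀ j < A.L, ∀ q ∈ U₁ j,
      layerLaw q (A.chan C (j + 1)) {z | A.avgG (j + 1) z ∈ U₂ j} ≤ b j)
    {k : ℕ} (hk : k ≤ A.L) :
    P {ω | ∀ j < k, A.cov C (w ω) j ∈ U₁ j ∧ A.cov C (w ω) (j + 1) ∈ U₂ j} ≤
      ∏ j ∈ Finset.range k, b j := by
  induction k with
  | zero => simp
  | succ k ih =>
    set E := {ω | ∀ j < k, A.cov C (w ω) j ∈ U₁ j ∧ A.cov C (w ω) (j + 1) ∈ U₂ j}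
    set E' := {ω | A.cov C (w ω) k ∈ U₁ k}
    have hE : MeasurableSet[weightSigma w (Set.Iio k)] (E ∩ E') := by
      refine MeasurableSet.inter (measurableSet_setOf_forall_mem (S := Set.Iio k) fun j hj =>
        MeasurableSet.inter ?_ ?_) ?_
      · exact measurableSet_setOf_cov_mem_weightSigma w hA (by grind) (le_of_lt hj) (hU₁ j)
      · exact measurableSet_setOf_cov_mem_weightSigma w hA (by grind) hj (hU₂ j)
      · exact measurableSet_setOf_cov_mem_weightSigma w hA (by grind) le_rfl (hU₁ k)
    calc P {ω | ∀ j < k + 1, A.cov C (w ω) j ∈ U₁ j ∧ A.cov C (w ω) (j + 1) ∈ U₂ j}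
        ≤ P ((E ∩ E') ∩ {ω | A.cov C (w ω) (k + 1) ∈ U₂ k}) := measure_mono fun ω hω =>
          ⟨⟨fun j hj => hω j (hj.trans k.lt_succ_self), (hω k k.lt_succ_self).1⟩,
            (hω k k.lt_succ_self).2⟩
      _ ≤ b k * P (E ∩ E') :=
          hw.measure_inter_cov_mem_le hA hk hE (hU₂ k) fun ω hω => hb k hk _ hω.2
      _ ≤ b k * ∏ j ∈ Finset.range k, b j := by
          gcongr
          exact (measure_mono Set.inter_subset_left).trans (ih (Nat.le_of_succ_le hk))
      _ = ∏ j ∈ Finset.range (k + 1), b j := by rw [Finset.prod_range_succ, mul_comm]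

theorem IsGaussianWeights.mul_measure_forall_cov_mem_le (hw : IsGaussianWeights P w)
    (hA : A.IsRegular) {k : ℕ} (hk : k < A.L) {V V' : ∀ j, Set (PSDCone (A.Idx (j + 1)))}
    (hV' : ∀ j, MeasurableSet (V' j)) (hV : MeasurableSet (V (k + 1)))
    (hV'V : ∀ j ≤ k, V' j ⊆ V j) {b : ℝ≥0∞}
    (hb : ∀ q ∈ V' k, b ≤ layerLaw q (A.chan C (k + 1)) {z | A.avgG (k + 1) z ∈ V (k + 1)}) :
    b * P {ω | ∀ j ≤ k, A.cov C (w ω) j ∈ V' j} ≤ P {ω | ∀ j ≤ k + 1, A.cov C (w ω) j ∈ V j} := by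
  have hE : MeasurableSet[weightSigma w (Set.Iio k)] {ω | ∀ j ≤ k, A.cov C (w ω) j ∈ V' j} :=
    measurableSet_setOf_forall_mem (S := Set.Iic k) fun j hj =>
      measurableSet_setOf_cov_mem_weightSigma w hA (le_trans hj hk.le) hj (hV' j)
  refine (hw.le_measure_inter_cov_mem hA hk hE hV fun ω hω => hb _ (hω k le_rfl)).trans
    (measure_mono fun ω hω j hj => ?_)
  rcases Nat.le_succ_iff.1 hj with h | rfl
  · exact hV'V j h (hω.1 j h)
  · exact hω.2

theorem exists_nhds_measure_forall_cov_mem_le (P : Measure Ω) [IsProbabilityMeasure P]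
    (hA : A.IsRegular) {q : ∀ j, PSDCone (A.Idx (j + 1))} {a : ℕ → ℝ}
    (ha : ∀ j < A.L, (a j : EReal) < A.condRate (j + 1) (q (j + 1)) (q j)) :
    ∃ (U₁ : ∀ j, Set (PSDCone (A.Idx (j + 1)))) (U₂ : ∀ j, Set (PSDCone (A.Idx (j + 2)))),
      (∀ j < A.L, U₁ j ∈ 𝓝 (q j) ∧ U₂ j ∈ 𝓝 (q (j + 1))) ∧
      ∀ (C : ℕ → ℕ) (w : Ω → A.Weights C), IsGaussianWeights P w →
        P {ω | ∀ j < A.L, A.cov C (w ω) j ∈ U₁ j ∧ A.cov C (w ω) (j + 1) ∈ U₂ j} ≤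
          ENNReal.ofReal (Real.exp (-∑ j ∈ Finset.range A.L, (C (j + 1) : ℝ) * a j)) := by
  choose! U₂ hU₂ U₁ hU₁ hU using fun j hj =>
    exists_layerLaw_le_of_lt_condRate (hA j hj) (ha j hj)
  refine ⟨fun j => interior (U₁ j), fun j => interior (U₂ j), fun j hj =>
    ⟨interior_mem_nhds.2 (hU₁ j hj), interior_mem_nhds.2 (hU₂ j hj)⟩, fun C w hw => ?_⟩
  refine (hw.measure_forall_cov_mem_le hA (fun j => isOpen_interior.measurableSet)
    (fun j => isOpen_interior.measurableSet)
    (b := fun j => ENNReal.ofReal (Real.exp (-(C (j + 1) * a j)))) (fun j hj q hq => ?_)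
    le_rfl).trans_eq ?_
  · refine (measure_mono fun z hz => ?_).trans (hU j hj q (interior_subset hq) (C (j + 1)))
    exact interior_subset (s := U₂ j) hz
  · rw [← ENNReal.ofReal_prod_of_nonneg fun j _ => (Real.exp_pos _).le, ← Real.exp_sum,
      Finset.sum_neg_distrib]

theorem exists_le_measure_forall_cov_mem (P : Measure Ω) [IsProbabilityMeasure P]
    (hA : A.IsRegular) {q : ∀ j, PSDCone (A.Idx (j + 1))} (hq0 : q 0 = A.K1) {b : ℕ → ℝ}
    (hb : ∀ j < A.L, A.condRate (j + 1) (q (j + 1)) (q j) ≤ b j) {ε : ℝ} (hε : 0 < ε)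
    {k : ℕ} (hk : k ≤ A.L) {V : ∀ j, Set (PSDCone (A.Idx (j + 1)))}
    (hV : ∀ j, IsOpen (V j) ∧ q j ∈ V j) :
    ∃ N₀ : ℕ, ∀ (C : ℕ → ℕ) (w : Ω → A.Weights C), IsGaussianWeights P w →
      (∀ j < k, N₀ ≤ C (j + 1)) →
        ENNReal.ofReal (Real.exp (-∑ j ∈ Finset.range k, (C (j + 1) : ℝ) * (b j + ε))) ≤
          P {ω | ∀ j ≤ k, A.cov C (w ω) j ∈ V j} := by
  induction k generalizing V with
  | zero =>
    have hmem (C : ℕ → ℕ) (w : A.Weights C) : A.cov C w 0 ∈ V 0 :=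
      show A.K1 ∈ V 0 from hq0 ▸ (hV 0).2
    exact ⟨0, fun C w _ _ => by simp [hmem]⟩
  | succ k ih =>
    obtain ⟨N₁, U₁, hU₁, hU⟩ := exists_le_layerLaw_of_condRate_le (hA k hk) (hb k hk)
      ((hV (k + 1)).1.mem_nhds (hV (k + 1)).2) hε
    set V' := Function.update V k (V k ∩ interior U₁)
    have hV' : ∀ j, IsOpen (V' j) ∧ q j ∈ V' j :=
      (Function.forall_update_iff V (p := fun j s => IsOpen s ∧ q j ∈ s)).2
        ⟨⟨(hV k).1.inter isOpen_interior, (hV k).2, mem_interior_iff_mem_nhds.2 hU₁⟩,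
          fun j _ => hV j⟩
    have hV'V : V' ≤ V := update_le_self_iff.2 Set.inter_subset_left
    obtain ⟨N₀, hN₀⟩ := ih (Nat.le_of_succ_le hk) hV'
    have hVk : ∀ x ∈ V' k, x ∈ U₁ := fun x hx =>
      interior_subset ((Function.update_self k _ V).le hx).2
    refine ⟨max N₀ N₁, fun C w hw hC => ?_⟩
    rw [Finset.sum_range_succ, neg_add, Real.exp_add, ENNReal.ofReal_mul (Real.exp_pos _).le,
      mul_comm]
    calc ENNReal.ofReal (Real.exp (-(C (k + 1) * (b k + ε)))) *
          ENNReal.ofReal (Real.exp (-∑ j ∈ Finset.range k, (C (j + 1) : ℝ) * (b j + ε)))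
        ≤ ENNReal.ofReal (Real.exp (-(C (k + 1) * (b k + ε)))) *
            P {ω | ∀ j ≤ k, A.cov C (w ω) j ∈ V' j} := by
          gcongr
          exact hN₀ C w hw fun j hj => (le_max_left _ _).trans (hC j (Nat.lt_succ_of_lt hj))
      _ ≤ P {ω | ∀ j ≤ k + 1, A.cov C (w ω) j ∈ V j} :=
          hw.mul_measure_forall_cov_mem_le hA hk (fun j => (hV' j).1.measurableSet)
            (hV (k + 1)).1.measurableSet (fun j _ => hV'V j) fun x hx =>
              hU x (hVk x hx) _ ((le_max_right _ _).trans (hC k k.lt_succ_self))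

theorem exists_measure_lt_trace_cov_le (P : Measure Ω) [IsProbabilityMeasure P]
    (hA : A.IsRegular) (a : ℕ → ℝ) :
    ∃ r : ℕ → ℝ, ∀ (C : ℕ → ℕ) (w : Ω → A.Weights C), IsGaussianWeights P w →
      P {ω | ∃ j ≤ A.L, r j < (A.cov C (w ω) j).1.trace} ≤
        ∑ j ∈ Finset.range A.L, ENNReal.ofReal (Real.exp (-(C (j + 1) * a j))) := by
  obtain ⟨r, hr0, hr⟩ := exists_seq_of_forall_lt_exists A.K1.1.trace fun j hj r =>
    exists_layerLaw_trace_gt_le (hA j hj) r (a j)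
  refine ⟨r, fun C w hw => ?_⟩
  set V : ∀ j, Set (PSDCone (A.Idx (j + 1))) := fun j => {Q | Q.1.trace ≤ r j}
  have hV (j : ℕ) : MeasurableSet (V j) :=
    (isClosed_le PSDCone.continuous_trace continuous_const).measurableSet
  set E : ℕ → Set Ω := fun j =>
    {ω | A.cov C (w ω) j ∈ V j} ∩ {ω | A.cov C (w ω) (j + 1) ∈ (V (j + 1))ᶜ}
  have hsub : {ω | ∃ j ≤ A.L, r j < (A.cov C (w ω) j).1.trace} ⊆ ⋃ j ∈ Finset.range A.L, E j := by
    rintro ω ⟨j, hj, hω⟩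
    obtain ⟨i, hi, hmem⟩ := exists_and_not_succ_of_exists_not
      (p := fun j => A.cov C (w ω) j ∈ V j) hr0.ge ⟨j, hj, hω.not_ge⟩
    exact Set.mem_biUnion (Finset.mem_coe.2 (Finset.mem_range.2 hi)) hmem
  refine (measure_mono hsub).trans ((measure_biUnion_finset_le _ _).trans
    (Finset.sum_le_sum fun j hj => ?_))
  have hjL := Finset.mem_range.1 hj
  refine (hw.measure_inter_cov_mem_le hA hjL
    (measurableSet_setOf_cov_mem_weightSigma w hA hjL.le le_rfl (hV j)) (hV (j + 1)).compl
    fun ω hω => ?_).trans (mul_le_of_le_one_right' prob_le_one)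
  refine (measure_mono fun z hz => ?_).trans (hr j hjL (A.cov C (w ω) j) hω (C (j + 1)))
  exact not_le.1 (show ¬(A.avgG (j + 1) z).1.trace ≤ r (j + 1) from hz)

end CovarianceSequence

section RateFunction

variable (A : ConvNet)

/-- The sequence `K^{(1)}, Q_2, …, Q_{L+1}` obtained from a tuple `(Q_2, …, Q_{L+1})`, so that the
index `j` stands for `Q_{j+1}`; the junk value `0` is used past the end of the tuple. -/
def extend (Q : A.CovTuple) : (j : ℕ) → PSDCone (A.Idx (j + 1))
  | 0 => A.K1
  | j + 1 => if h : j < A.L then Q ⟨j, h⟩ else ⟨0, Matrix.PosSemidef.zero⟩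

variable {A} {α : ℕ → ℝ}

theorem extend_succ (Q : A.CovTuple) {j : ℕ} (hj : j < A.L) :
    A.extend Q (j + 1) = Q ⟨j, hj⟩ :=
  dif_pos hj

theorem extend_covTuple {C : ℕ → ℕ} (w : A.Weights C) {j : ℕ} (hj : j ≤ A.L) :
    A.extend (A.covTuple C w) j = A.cov C w j := by
  cases j with
  | zero => rfl
  | succ j => exact extend_succ _ hj

theorem entry_eq_extend (Q : A.CovTuple) {j : ℕ} (hj : j ≤ A.L) :
    A.entry Q j hj = A.extend Q j := by
  cases j with
  | zero => rfl
  | succ j => exact (extend_succ Q hj).symm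

theorem continuous_extend (j : ℕ) : Continuous fun Q : A.CovTuple => A.extend Q j := by
  cases j with
  | zero => exact continuous_const
  | succ j =>
    by_cases hj : j < A.L
    · simpa only [extend_succ _ hj] using continuous_apply _
    · simpa only [extend, hj, dite_false] using continuous_const

theorem rate_eq_sum_range (α : ℕ → ℝ) (Q : A.CovTuple) :
    A.rate α Q = ∑ j ∈ Finset.range A.L, (α (j + 1) : EReal) *
      A.condRate (j + 1) (A.extend Q (j + 1)) (A.extend Q j) := by
  rw [rate, Finset.sum_range]
  refine Finset.sum_congr rfl fun k _ => ?_
  rw [entry_eq_extend, extend_succ Q k.2]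

theorem mul_condRate_nonneg (hα : ∀ j < A.L, 0 < α (j + 1)) (Q : A.CovTuple) :
    ∀ j ∈ Finset.range A.L,
      0 ≤ (α (j + 1) : EReal) * A.condRate (j + 1) (A.extend Q (j + 1)) (A.extend Q j) :=
  fun j hj => mul_nonneg (mod_cast (hα j (Finset.mem_range.1 hj)).le) (condRate_nonneg _ _)

theorem rate_nonneg (hα : ∀ j < A.L, 0 < α (j + 1)) (Q : A.CovTuple) : 0 ≤ A.rate α Q :=
  rate_eq_sum_range α Q ▸ Finset.sum_nonneg (mul_condRate_nonneg hα Q)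

theorem condRate_le_of_rate_le (hα : ∀ j < A.L, 0 < α (j + 1)) {Q : A.CovTuple} {a : ℝ}
    (h : A.rate α Q ≤ a) {j : ℕ} (hj : j < A.L) :
    A.condRate (j + 1) (A.extend Q (j + 1)) (A.extend Q j) ≤ ((a / α (j + 1) : ℝ) : EReal) := by
  rw [EReal.coe_div, EReal.le_div_iff_mul_le (mod_cast hα j hj) (EReal.coe_ne_top _), mul_comm]
  rw [rate_eq_sum_range] at h
  exact (Finset.single_le_sum (mul_condRate_nonneg hα Q) (Finset.mem_range.2 hj)).trans h

theorem exists_rate_eq_coe_sum (hα : ∀ j < A.L, 0 < α (j + 1)) {Q : A.CovTuple}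
    (h : A.rate α Q ≠ ⊤) :
    ∃ b : ℕ → ℝ, (∀ j < A.L, A.condRate (j + 1) (A.extend Q (j + 1)) (A.extend Q j) = b j) ∧
      A.rate α Q = ((∑ j ∈ Finset.range A.L, α (j + 1) * b j : ℝ) : EReal) := by
  have hle : A.rate α Q ≤ ((A.rate α Q).toReal : EReal) := EReal.le_coe_toReal h
  have hb (j : ℕ) (hj : j < A.L) : A.condRate (j + 1) (A.extend Q (j + 1)) (A.extend Q j) =
      ((A.condRate (j + 1) (A.extend Q (j + 1)) (A.extend Q j)).toReal : EReal) :=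
    (EReal.coe_toReal ((condRate_le_of_rate_le hα hle hj).trans_lt (EReal.coe_lt_top _)).ne
      (ne_bot_of_le_ne_bot EReal.zero_ne_bot (condRate_nonneg _ _))).symm
  refine ⟨_, hb, ?_⟩
  rw [rate_eq_sum_range, coe_finsetSum_ereal]
  refine Finset.sum_congr rfl fun j hj => ?_
  rw [EReal.coe_mul, ← hb j (Finset.mem_range.1 hj)]

theorem lowerSemicontinuous_rate (hA : A.IsRegular) (hα : ∀ j < A.L, 0 < α (j + 1)) :
    LowerSemicontinuous (A.rate α) := by
  intro Q y hy
  obtain ⟨a, hya, haQ⟩ := EReal.lt_iff_exists_real_btwn.1 hy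
  rw [rate_eq_sum_range] at haQ
  obtain ⟨b, hb, hab⟩ := exists_forall_coe_lt_of_lt_sum_mul
    (fun j hj => hα j (Finset.mem_range.1 hj)) haQ
  have hev : ∀ j ∈ Finset.range A.L, ∀ᶠ Q' in 𝓝 Q,
      (b j : EReal) < A.condRate (j + 1) (A.extend Q' (j + 1)) (A.extend Q' j) := fun j hj =>
    ((continuous_extend (j + 1)).prodMk (continuous_extend j)).tendsto Q |>.eventually
      (eventually_lt_condRate (hA j (Finset.mem_range.1 hj)) (hb j hj))
  filter_upwards [(Filter.eventually_all_finset _).2 hev] with Q' hQ'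
  calc y < (a : EReal) := hya
    _ ≤ ((∑ j ∈ Finset.range A.L, α (j + 1) * b j : ℝ) : EReal) := mod_cast hab.le
    _ ≤ A.rate α Q' := by
      rw [rate_eq_sum_range, coe_finsetSum_ereal]
      refine Finset.sum_le_sum fun j hj => ?_
      rw [EReal.coe_mul]
      exact mul_le_mul_of_nonneg_left (hQ' j hj).le
        (mod_cast (hα j (Finset.mem_range.1 hj)).le)

theorem isCompact_setOf_forall_trace_le (r : ℕ → ℝ) :
    IsCompact {Q : A.CovTuple | ∀ k : Fin A.L, (Q k).1.trace ≤ r (k + 1)} := by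
  have hpi : {Q : A.CovTuple | ∀ k : Fin A.L, (Q k).1.trace ≤ r (k + 1)} =
      Set.univ.pi fun k : Fin A.L => {q | q.1.trace ≤ r (k + 1)} := by
    ext Q
    simp
  exact hpi ▸ isCompact_univ_pi fun k => PSDCone.isCompact_trace_le (r (k + 1))

theorem isGoodRateFunction_rate (hA : A.IsRegular) (hα : ∀ j < A.L, 0 < α (j + 1)) :
    IsGoodRateFunction (A.rate α) := by
  refine ⟨fun Q => ne_bot_of_le_ne_bot EReal.zero_ne_bot (rate_nonneg hα Q),
    lowerSemicontinuous_rate hA hα, fun a => ?_⟩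
  obtain ⟨r, hr0, hr⟩ := exists_seq_of_forall_lt_exists A.K1.1.trace fun j hj r =>
    exists_trace_le_of_condRate_le (hA j hj) r (a / α (j + 1))
  refine (isCompact_setOf_forall_trace_le r).of_isClosed_subset
    ((lowerSemicontinuous_rate hA hα).isClosed_preimage _) fun Q hQ => ?_
  have htrace (j : ℕ) : j ≤ A.L → (A.extend Q j).1.trace ≤ r j := by
    induction j with
    | zero => exact fun _ => hr0.ge
    | succ j ih =>
      exact fun hj => hr j hj _ _ (ih (Nat.le_of_succ_le hj)) (condRate_le_of_rate_le hα hQ hj)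
  exact fun k => extend_succ Q k.2 ▸ htrace (k + 1) k.2

end RateFunction

section LargeDeviations

open ExpGrowth

variable {A : ConvNet} {α : ℕ → ℝ} {C : ℕ → ℕ → ℕ} {Ω : Type*} [MeasurableSpace Ω]
  {P : Measure Ω} {w : (n : ℕ) → Ω → A.Weights (C n)}

theorem IsGaussianWeights.measurable_covTuple {C : ℕ → ℕ} {w : Ω → A.Weights C}
    (hw : IsGaussianWeights P w) (hA : A.IsRegular) :
    Measurable fun ω => A.covTuple C (w ω) :=
  measurable_pi_lambda _ fun k => measurable_cov hA (j := k + 1) k.2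
    fun ℓ hℓ => hw.measurable ℓ (hℓ.le.trans k.2)

theorem exists_isOpen_forall_extend_mem {O : Set A.CovTuple} (hO : IsOpen O) {Q : A.CovTuple}
    (hQ : Q ∈ O) :
    ∃ V : ∀ j, Set (PSDCone (A.Idx (j + 1))), (∀ j, IsOpen (V j) ∧ A.extend Q j ∈ V j) ∧
      ∀ Q', (∀ j ≤ A.L, A.extend Q' j ∈ V j) → Q' ∈ O := by
  obtain ⟨u, hu, huO⟩ := isOpen_pi_iff'.1 hO Q hQ
  refine ⟨fun | 0 => Set.univ | j + 1 => {q | ∀ h : j < A.L, q ∈ u ⟨j, h⟩}, fun j => ?_,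
    fun Q' hQ' => huO fun k _ => extend_succ Q' k.2 ▸ hQ' (k + 1) k.2 k.2⟩
  cases j with
  | zero => exact ⟨isOpen_univ, trivial⟩
  | succ j =>
    refine ⟨?_, fun h => extend_succ Q h ▸ (hu ⟨j, h⟩).2⟩
    simp only [Set.ofPred_forall]
    exact isOpen_iInter_of_finite fun h => (hu ⟨j, h⟩).1

variable [IsProbabilityMeasure P]

theorem neg_rate_le_expGrowthInf (hA : A.IsRegular) (hα : ∀ j < A.L, 0 < α (j + 1))
    (hC : ∀ j < A.L, Tendsto (fun n => (C n (j + 1) : ℝ) / n) atTop (𝓝 (α (j + 1))))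
    (hw : ∀ n, IsGaussianWeights P (w n)) {O : Set A.CovTuple} (hO : IsOpen O)
    {Q : A.CovTuple} (hQ : Q ∈ O) :
    -A.rate α Q ≤ expGrowthInf fun n => P {ω | A.covTuple (C n) (w n ω) ∈ O} := by
  rcases eq_or_ne (A.rate α Q) ⊤ with htop | htop
  · simp [htop]
  obtain ⟨b, hb, hbQ⟩ := exists_rate_eq_coe_sum hα htop
  obtain ⟨V, hV, hVO⟩ := exists_isOpen_forall_extend_mem hO hQ
  have hlower : ∀ ε > 0, ((-∑ j ∈ Finset.range A.L, α (j + 1) * (b j + ε) : ℝ) : EReal) ≤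
      expGrowthInf fun n => P {ω | A.covTuple (C n) (w n ω) ∈ O} := by
    intro ε hε
    obtain ⟨N₀, hN₀⟩ := exists_le_measure_forall_cov_mem P hA (q := A.extend Q) rfl
      (fun j hj => (hb j hj).le) hε le_rfl hV
    rw [← expGrowthInf_ofReal_exp_neg (tendsto_sum_mul_div fun j hj =>
      hC j (Finset.mem_range.1 hj))]
    refine expGrowthInf_eventually_monotone ?_
    have hlarge : ∀ᶠ n in atTop, ∀ j ∈ Finset.range A.L, N₀ ≤ C n (j + 1) :=
      (Filter.eventually_all_finset _).2 fun j hj =>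
        have hj' := Finset.mem_range.1 hj
        (tendsto_atTop_of_tendsto_natCast_div (hα j hj') (hC j hj')).eventually_ge_atTop N₀
    filter_upwards [hlarge] with n hn
    refine (hN₀ (C n) (w n) (hw n) fun j hj => hn j (Finset.mem_range.2 hj)).trans
      (measure_mono fun ω hω => hVO _ fun j hj => ?_)
    exact extend_covTuple (w n ω) hj ▸ hω j hj
  have hcont : Continuous fun ε : ℝ =>
      ((-∑ j ∈ Finset.range A.L, α (j + 1) * (b j + ε) : ℝ) : EReal) :=
    continuous_coe_real_ereal.comp (by fun_prop)
  have hlim := (hcont.tendsto 0).mono_left (nhdsWithin_le_nhds (s := Set.Ioi 0))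
  rw [hbQ, ← EReal.coe_neg]
  simpa only [add_zero] using le_of_tendsto hlim (eventually_mem_nhdsWithin.mono hlower)

theorem exists_nhds_expGrowthSup_le (hA : A.IsRegular) (hα : ∀ j < A.L, 0 < α (j + 1))
    (hC : ∀ j < A.L, Tendsto (fun n => (C n (j + 1) : ℝ) / n) atTop (𝓝 (α (j + 1))))
    (hw : ∀ n, IsGaussianWeights P (w n)) {Q : A.CovTuple} {a : ℝ} (ha : a < A.rate α Q) :
    ∃ U ∈ 𝓝 Q,
      expGrowthSup (fun n => P {ω | A.covTuple (C n) (w n ω) ∈ U}) ≤ ((-a : ℝ) : EReal) := by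
  rw [rate_eq_sum_range] at ha
  obtain ⟨b, hb, hab⟩ := exists_forall_coe_lt_of_lt_sum_mul
    (fun j hj => hα j (Finset.mem_range.1 hj)) ha
  obtain ⟨U₁, U₂, hU, hle⟩ := exists_nhds_measure_forall_cov_mem_le P hA (q := A.extend Q)
    fun j hj => hb j (Finset.mem_range.2 hj)
  refine ⟨{Q' | ∀ j ∈ Finset.range A.L, A.extend Q' j ∈ U₁ j ∧ A.extend Q' (j + 1) ∈ U₂ j},
    (Filter.eventually_all_finset _).2 fun j hj => ?_, ?_⟩
  · have hUj := hU j (Finset.mem_range.1 hj)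
    exact ((continuous_extend j).tendsto Q |>.eventually hUj.1).and
      ((continuous_extend (j + 1)).tendsto Q |>.eventually hUj.2)
  calc expGrowthSup _
      ≤ expGrowthSup fun n => ENNReal.ofReal
          (Real.exp (-∑ j ∈ Finset.range A.L, (C n (j + 1) : ℝ) * b j)) := by
        refine expGrowthSup_monotone fun n =>
          (measure_mono fun ω hω j hj => ?_).trans (hle (C n) (w n) (hw n))
        rw [← extend_covTuple (w n ω) hj.le, ← extend_covTuple (w n ω) hj]
        exact hω j (Finset.mem_range.2 hj)
    _ = ((-∑ j ∈ Finset.range A.L, α (j + 1) * b j : ℝ) : EReal) :=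
        expGrowthSup_ofReal_exp_neg (tendsto_sum_mul_div fun j hj => hC j (Finset.mem_range.1 hj))
    _ ≤ ((-a : ℝ) : EReal) := mod_cast neg_le_neg hab.le

theorem expGrowthSup_le_of_isCompact (hA : A.IsRegular) (hα : ∀ j < A.L, 0 < α (j + 1))
    (hC : ∀ j < A.L, Tendsto (fun n => (C n (j + 1) : ℝ) / n) atTop (𝓝 (α (j + 1))))
    (hw : ∀ n, IsGaussianWeights P (w n)) {K : Set A.CovTuple} (hK : IsCompact K) {a : ℝ}
    (ha : ∀ Q ∈ K, a < A.rate α Q) :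
    expGrowthSup (fun n => P {ω | A.covTuple (C n) (w n ω) ∈ K}) ≤ ((-a : ℝ) : EReal) :=
  expGrowthSup_measure_preimage_le_of_isCompact hK fun Q hQ =>
    exists_nhds_expGrowthSup_le hA hα hC hw (ha Q hQ)

theorem exists_expGrowthSup_lt_trace_le (hA : A.IsRegular) (hα : ∀ j < A.L, 0 < α (j + 1))
    (hC : ∀ j < A.L, Tendsto (fun n => (C n (j + 1) : ℝ) / n) atTop (𝓝 (α (j + 1))))
    (hw : ∀ n, IsGaussianWeights P (w n)) (a : ℝ) :
    ∃ r : ℕ → ℝ, expGrowthSup (fun n =>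
      P {ω | ∃ j ≤ A.L, r j < (A.cov (C n) (w n ω) j).1.trace}) ≤ ((-a : ℝ) : EReal) := by
  obtain ⟨r, hr⟩ := exists_measure_lt_trace_cov_le P hA fun j => a / α (j + 1)
  refine ⟨r, (expGrowthSup_monotone fun n => hr (C n) (w n) (hw n)).trans ?_⟩
  have hsum := expGrowthSup_sum (fun j n => ENNReal.ofReal
    (Real.exp (-(C n (j + 1) * (a / α (j + 1)))))) (Finset.range A.L)
  rw [Finset.sum_fn] at hsum
  refine hsum.trans_le (iSup₂_le fun j hj => ?_)
  have hj' := Finset.mem_range.1 hj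
  have hlim := (hC j hj').mul_const (a / α (j + 1))
  simp_rw [← mul_div_right_comm, mul_div_cancel₀ a (hα j hj').ne'] at hlim
  exact (expGrowthSup_ofReal_exp_neg hlim).le

theorem expGrowthSup_le_neg_iInf_rate (hA : A.IsRegular) (hα : ∀ j < A.L, 0 < α (j + 1))
    (hC : ∀ j < A.L, Tendsto (fun n => (C n (j + 1) : ℝ) / n) atTop (𝓝 (α (j + 1))))
    (hw : ∀ n, IsGaussianWeights P (w n)) {F : Set A.CovTuple} (hF : IsClosed F) :
    expGrowthSup (fun n => P {ω | A.covTuple (C n) (w n ω) ∈ F}) ≤ -⨅ Q ∈ F, A.rate α Q := by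
  refine EReal.le_of_forall_lt_iff_le.1 fun c hc => ?_
  rw [EReal.neg_lt_comm, ← EReal.coe_neg] at hc
  obtain ⟨r, hr⟩ := exists_expGrowthSup_lt_trace_le hA hα hC hw (-c)
  set K : Set A.CovTuple := {Q | ∀ k : Fin A.L, (Q k).1.trace ≤ r (k + 1)}
  have hFK := expGrowthSup_le_of_isCompact hA hα hC hw
    ((isCompact_setOf_forall_trace_le r).inter_left hF) fun Q hQ => hc.trans_le (iInf₂_le Q hQ.1)
  rw [← neg_neg c]
  refine (expGrowthSup_monotone fun n => ?_).trans
    (expGrowthSup_add.trans_le (sup_le hFK hr))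
  refine (measure_mono fun ω hω => ?_).trans (measure_union_le _ _)
  by_cases h : ∃ j ≤ A.L, r j < (A.cov (C n) (w n ω) j).1.trace
  · exact Or.inr h
  · push Not at h
    exact Or.inl ⟨hω, fun k => h (k + 1) k.2⟩

theorem satisfiesLDP_covTuple (hA : A.IsRegular) (hα : ∀ j < A.L, 0 < α (j + 1))
    (hC : ∀ j < A.L, Tendsto (fun n => (C n (j + 1) : ℝ) / n) atTop (𝓝 (α (j + 1))))
    (hw : ∀ n, IsGaussianWeights P (w n)) :
    SatisfiesLDP (fun n => P.map fun ω => A.covTuple (C n) (w n ω)) (A.rate α) := by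
  refine ⟨fun O hO => ?_, fun F hF => ?_⟩
  · simp_rw [Measure.map_apply ((hw _).measurable_covTuple hA) hO.measurableSet]
    exact EReal.neg_le.1 (le_iInf₂ fun Q hQ =>
      EReal.neg_le.1 (neg_rate_le_expGrowthInf hA hα hC hw hO hQ))
  · simp_rw [Measure.map_apply ((hw _).measurable_covTuple hA) hF.measurableSet]
    exact expGrowthSup_le_neg_iInf_rate hA hα hC hw hF

end LargeDeviations

section Modification

variable {A : ConvNet} {C : ℕ → ℕ}

theorem preact_congr {w w' : A.Weights C} {j : ℕ} (h : ∀ ℓ ≤ j, w ℓ = w' ℓ) :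
    A.preact C w j = A.preact C w' j := by
  induction j with
  | zero =>
    funext c p
    rw [preact, preact, h 0 le_rfl]
  | succ j ih =>
    funext c p
    rw [preact, preact, h (j + 1) le_rfl, ih fun ℓ hℓ => h ℓ (Nat.le_succ_of_le hℓ)]

theorem covTuple_congr {w w' : A.Weights C} (h : ∀ ℓ ≤ A.L, w ℓ = w' ℓ) :
    A.covTuple C w = A.covTuple C w' := by
  funext k
  refine Subtype.ext ?_
  simp only [covTuple, KMat, preact_congr fun ℓ hℓ => h ℓ (hℓ.trans k.2.le)]

theorem exists_isGaussianWeights {Ω : Type*} [MeasurableSpace Ω] {P : Measure Ω}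
    {W : (ℓ : ℕ) → A.Mask ℓ → Fin (A.chan C ℓ) → Fin (A.chan C (ℓ + 1)) → Ω → ℝ}
    (hlaw : ∀ ℓ ≤ A.L, ∀ m c' c, HasLaw (W ℓ m c' c) (gaussianReal 0 (A.prec ℓ)⁻¹) P)
    (hindep : iIndepFun (fun p : A.WeightIdx C => W p.1 p.2.1 p.2.2.1 p.2.2.2) P) :
    ∃ w : Ω → A.Weights C, IsGaussianWeights P w ∧
      (fun ω => A.covTuple C fun ℓ m c' c => W ℓ m c' c ω) =ᵐ[P] fun ω => A.covTuple C (w ω) := by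
  have hex (ℓ : ℕ) (m) (c') (c) : ∃ f : Ω → ℝ, ℓ ≤ A.L → Measurable f ∧ W ℓ m c' c =ᵐ[P] f := by
    by_cases hℓ : ℓ ≤ A.L
    · exact ⟨_, fun _ => ⟨(hlaw ℓ hℓ m c' c).aemeasurable.measurable_mk,
        (hlaw ℓ hℓ m c' c).aemeasurable.ae_eq_mk⟩⟩
    · exact ⟨0, fun h => absurd h hℓ⟩
  choose f hf using hex
  have hWf (p : A.WeightIdx C) :
      W p.1 p.2.1 p.2.2.1 p.2.2.2 =ᵐ[P] f p.1 p.2.1 p.2.2.1 p.2.2.2 :=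
    (hf _ _ _ _ (Nat.le_of_lt_succ p.1.2)).2
  refine ⟨fun ω ℓ m c' c => f ℓ m c' c ω, ⟨fun ℓ hℓ m c' c => (hf ℓ m c' c hℓ).1,
    fun ℓ hℓ m c' c => ?_, hindep.congr hWf⟩, ?_⟩
  · rw [← (hlaw ℓ hℓ m c' c).map_eq]
    exact (Measure.map_congr (hf ℓ m c' c hℓ).2).symm
  · filter_upwards [ae_all_iff.2 hWf] with ω hω
    refine covTuple_congr fun ℓ hℓ => ?_
    funext m c' c
    exact hω ⟨⟨ℓ, Nat.lt_succ_of_le hℓ⟩, m, c', c⟩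

end Modification

end ConvNet

end

theorem theorem3 {Ω : Type*} [MeasurableSpace Ω] (Pr : Measure Ω) [IsProbabilityMeasure Pr]
    (A : ConvNet)
    (C : ℕ → ℕ → ℕ) (α : ℕ → ℝ)
    (W : (n : ℕ) → (ℓ : ℕ) → (m : A.Mask ℓ) → (c' : Fin (A.chan (C n) ℓ)) →
      (c : Fin (A.chan (C n) (ℓ + 1))) → Ω → ℝ)
    -- Gaussian prior: independent weights with law `N(0, 1 / λ_ℓ)` in the layer `ℓ`
    (hprec : ∀ ℓ ≤ A.L, 0 < A.prec ℓ)
    (hlaw : ∀ (n ℓ : ℕ), ℓ ≤ A.L → ∀ (m : A.Mask ℓ) (c' : Fin (A.chan (C n) ℓ))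
      (c : Fin (A.chan (C n) (ℓ + 1))),
      HasLaw (W n ℓ m c' c) (gaussianReal 0 (A.prec ℓ)⁻¹) Pr)
    (hindep : ∀ n : ℕ, iIndepFun
      (fun p : A.WeightIdx (C n) => W n p.1 p.2.1 p.2.2.1 p.2.2.2) Pr)
    -- infinite channels limit
    (hα : ∀ ℓ, 1 ≤ ℓ → ℓ ≤ A.L → 0 < α ℓ)
    (hC : ∀ ℓ, 1 ≤ ℓ → ℓ ≤ A.L →
      Tendsto (fun n : ℕ => (C n ℓ : ℝ) / (n : ℝ)) atTop (𝓝 (α ℓ)))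
    -- asymptotic Lipschitz condition
    (hσ : AsympLipschitzActivation A.σ)
    (hR : ∀ ℓ, 1 ≤ ℓ → ℓ ≤ A.L → ∀ i : Fin (A.N (ℓ + 1)), AsympLipschitzMap (A.R ℓ i)) :
    (∀ n, AEMeasurable (fun ω => A.covTuple (C n) (fun ℓ m c' c => W n ℓ m c' c ω)) Pr) ∧
    IsGoodRateFunction (A.rate α) ∧
    SatisfiesLDP
      (fun n => Pr.map (fun ω => A.covTuple (C n) (fun ℓ m c' c => W n ℓ m c' c ω)))
      (A.rate α) := by
  have hA : A.IsRegular := fun j hj => ConvNet.isRegularLayer hσ (hR (j + 1) j.succ_pos hj)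
  have hα' (j : ℕ) (hj : j < A.L) : 0 < α (j + 1) := hα (j + 1) j.succ_pos hj
  have hC' (j : ℕ) (hj : j < A.L) :
      Tendsto (fun n => (C n (j + 1) : ℝ) / n) atTop (𝓝 (α (j + 1))) :=
    hC (j + 1) j.succ_pos hj
  choose w hw hWw using fun n => ConvNet.exists_isGaussianWeights (hlaw n) (hindep n)
  refine ⟨fun n => ((hw n).measurable_covTuple hA).aemeasurable.congr (hWw n).symm,
    ConvNet.isGoodRateFunction_rate hA hα', ?_⟩
  simp_rw [fun n => Measure.map_congr (hWw n)]
  exact ConvNet.satisfiesLDP_covTuple hA hα' hC' hw
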